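/- **Model.** Let $0<p_{01}\le 1$, $0<p_{10}\le 1$, not both equal to $1$. A Gilbert–Elliott channel is the (irreducible, aperiodic) Markov chain on $\{0,1\}$ with transition matrix $\Pi=(\pi(s,u))_{s,u\in\{0,1\}}$, $\pi(0,1)=p_{01}$, $\pi(1,0)=p_{10}$; state $1$ in a slot means that the symbol sent in that slot is received, state $0$ that it is erased. Put $$\gamma=\frac{p_{01}}{p_{01}+p_{10}},\qquad \Lambda(\beta,\Pi)=\sup_{\theta\in\mathbb R}\{\theta\beta-\log\rho(\Pi_\theta)\}\in(-\infty,+\infty],\qquad \Pi_\theta=\big(\pi(s,u)e^{\theta u}\big)_{s,u\in\{0,1\}},$$ where $\rho(\Pi_\theta)$ is the largest (Perron–Frobenius) eigenvalue of $\Pi_\theta$, and $$\mathcal R(r)=\sup\Big\{\beta:\ r\ge\frac{\beta}{\Lambda(\beta,\Pi)},\ 0\le\beta<\gamma\Big\}\quad(\text{with }\beta/\infty=0),\qquad K_0=\min\Big\{m\ge0:\ \sum_{d=0}^m(1-p_{10})^dp_{10}+p_{01}\ge1\Big\}.$$ A transmitter broadcasts to $n\ge1$ receivers whose channels evolve independently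 of one another as such chains, from an arbitrary initial state. Packets are sent in coding blocks of $K\ge1$ packets, one coded symbol per slot; a block is completed as soon as every receiver has received $K$ of its coded symbols. With an infinite backlog the next block starts in the next slot; let $R(t)$ be the number of blocks completed in the first $t$ slots. In the queueing system the numbers of packets arriving in the slots are i.i.d. with mean $\lambda$ and finite variance and are independent of the channels; the transmitter is idle while fewer than $K$ packets are in the system (the channels continue to evolve), otherwise it transmits the block formed by the first $K$ packets, which leave the system when the block is completed. The system is *stable* if, from every initial condition, $\limsup_{N\to\infty}\frac1N\sum_{t<N}\mathbb E[Q_t]<\infty$, where $Q_t$ is the number of packets in the system after $t$ slots. **Theorem.** For all $n,K\ge1$ there is a constant $\eta(n,K)$, the throughput, such that from every initial state $K\,R(t)/t\to\eta(n,K)$ almost surely as $t\to\infty$, and: 1. for all $n\ge2$ and $K\ge1$, $$\eta(n,K)>\frac{K}{K+K_0}\,\mathcal R\Big(\frac{K+K_0}{\log n}\Big);$$ 2. for all $n\ge2$ and $K\ge1$, the queueing system with $n$ receivers, block size $K$ and arrival rate $\lambda$ is stable if $$\lambda\le\frac{K}{K+K_0}\,\mathcal R\Big(\frac{K+K_0}{\log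 n}\Big);$$ 3. (asymptotic tightness) if $K=K(n)$ and $K(n)/\log n\to c\in(0,\infty)$ as $n\to\infty$, then $$\lim_{n\to\infty}\frac{K(n)}{K(n)+K_0}\,\mathcal R\Big(\frac{K(n)+K_0}{\log n}\Big)=\mathcal R(c)=\lim_{n\to\infty}\eta(n,K(n)).$$ -/

import Mathlib

open MeasureTheory ProbabilityTheory Filter Topology
open scoped ENNReal

noncomputable section

/-- Parameters of a Gilbert–Elliott channel: a two-state Markov chain (state `1` = packet received,
state `0` = packet erased) with `p01` the probability of moving from `0` to `1` and `p10` the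
probability of moving from `1` to `0`. For two states, the chain is irreducible iff both
parameters are positive, and it is then aperiodic iff they are not both equal to `1`. -/
structure GilbertElliott where
  p01 : ℝ
  p10 : ℝ
  p01_pos : 0 < p01
  p01_le_one : p01 ≤ 1
  p10_pos : 0 < p10
  p10_le_one : p10 ≤ 1
  aperiodic : ¬ (p01 = 1 ∧ p10 = 1)

namespace GilbertElliott

variable (c : GilbertElliott)

/-- One-step transition probabilities of one receiver's channel; `true` is state `1`. -/
def trans : Bool → Bool → ℝ
  | false, false => 1 - c.p01
  | false, true => c.p01
  | true, false => c.p10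
  | true, true => 1 - c.p10

/-- Capacity: the stationary probability of state `1`. -/
def capacity : ℝ := c.p01 / (c.p10 + c.p01)

/-! ### The rate function -/

/-- The tilted transition matrix `π(s,u) e^{θ f(u)}`, with `f` the channel state as a number. -/
def tilted (θ : ℝ) : Matrix Bool Bool ℝ :=
  Matrix.of fun s u => c.trans s u * Real.exp (θ * (if u then 1 else 0))

/-- The largest (Perron–Frobenius) eigenvalue of the tilted matrix. -/
def perron (θ : ℝ) : ℝ := sSup (spectrum ℝ (c.tilted θ))

/-- The large deviation rate function; it can take the value `+∞`. -/
def rate (β : ℝ) : EReal := ⨆ θ : ℝ, ((θ * β - Real.log (c.perron θ) : ℝ) : EReal)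

/-- `R(r) = sup {β | r ≥ β / Λ(β), 0 ≤ β < γ}`. On this range `Λ(β)` lies in `(0, +∞]`, and
`β / (+∞) = 0`. -/
def R (r : ℝ) : ℝ :=
  sSup {β : ℝ | (β : EReal) / c.rate β ≤ (r : EReal) ∧ 0 ≤ β ∧ β < c.capacity}

/-- The least `m ≥ 0` with `∑_{d=0}^m (1 - p10)^d p10 + p01 ≥ 1`. -/
def K₀ : ℕ := sInf {m : ℕ | 1 ≤ (∑ d ∈ Finset.range (m + 1), (1 - c.p10) ^ d * c.p10) + c.p01}

/-! ### The channel process of `n` receivers -/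

/-- The law of the next channel state of one receiver whose current state is `s`. -/
def stepOne (s : Bool) : Measure Bool :=
  ENNReal.ofReal (c.trans s true) • Measure.dirac true +
    ENNReal.ofReal (c.trans s false) • Measure.dirac false

instance (s : Bool) : IsProbabilityMeasure (c.stepOne s) := by
  constructor
  have h1 := c.p01_pos
  have h2 := c.p01_le_one
  have h3 := c.p10_pos
  have h4 := c.p10_le_one
  cases s
  · simp only [stepOne, trans, Measure.add_apply, Measure.smul_apply, measure_univ, smul_eq_mul,
      mul_one]
    rw [← ENNReal.ofReal_add (by linarith) (by linarith)]
    simp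
  · simp only [stepOne, trans, Measure.add_apply, Measure.smul_apply, measure_univ, smul_eq_mul,
      mul_one]
    rw [← ENNReal.ofReal_add (by linarith) (by linarith)]
    simp

/-- The transition kernel of the joint state of `n` receivers, which evolve independently. -/
def step (n : ℕ) : Kernel (Fin n → Bool) (Fin n → Bool) :=
  Kernel.ofFunOfCountable fun x => Measure.pi fun i => c.stepOne (x i)

instance (n : ℕ) : IsMarkovKernel (c.step n) :=
  ⟨fun x => inferInstanceAs (IsProbabilityMeasure (Measure.pi fun i => c.stepOne (x i)))⟩

/-- The same kernel, as a kernel from the whole past up to slot `m`. -/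
def stepPast (n m : ℕ) : Kernel ((_ : Finset.Iic m) → (Fin n → Bool)) (Fin n → Bool) :=
  (c.step n).comap (fun h => h ⟨m, Finset.mem_Iic.2 le_rfl⟩) (measurable_pi_apply _)

instance (n m : ℕ) : IsMarkovKernel (c.stepPast n m) := by
  unfold stepPast
  infer_instance

/-- The law of the channel states `X 0, X 1, X 2, …` of `n` receivers, where the initial state
`X 0` has law `μ₀` and `X t` is the vector of channel states in time slot `t ≥ 1`. -/
def channelLaw (n : ℕ) (μ₀ : Measure (Fin n → Bool)) [IsProbabilityMeasure μ₀] :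
    Measure (ℕ → Fin n → Bool) :=
  Kernel.trajMeasure (X := fun _ => Fin n → Bool) μ₀ (c.stepPast n)

end GilbertElliott

/-! ### Transmission of coding blocks -/

/-- `a i` is the number of symbols of the current block received by receiver `i`; after one more
transmission, in channel state `x`, these numbers are `receive a x`. -/
def receive {n : ℕ} (a : Fin n → ℕ) (x : Fin n → Bool) : Fin n → ℕ :=
  fun i => a i + if x i then 1 else 0

open scoped Classical in
/-- Infinite backlog. After `t` slots: the number of symbols of the current block that each
receiver has received, and the number of blocks completed so far. A block is complete as soon as
every receiver has received `K` of its symbols, and the next block starts in the next slot. -/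
def backlogged {n : ℕ} (K : ℕ) (X : ℕ → Fin n → Bool) : ℕ → (Fin n → ℕ) × ℕ
  | 0 => (0, 0)
  | t + 1 =>
    let s := backlogged K X t
    let a := receive s.1 (X (t + 1))
    if ∀ i, K ≤ a i then (0, s.2 + 1) else (a, s.2)

/-- `R(t)`: the number of blocks completed in the first `t` slots under infinite backlog. -/
def blocksDone {n : ℕ} (K : ℕ) (X : ℕ → Fin n → Bool) (t : ℕ) : ℕ := (backlogged K X t).2

open scoped Classical in
/-- The queueing system with initially `q₀` packets and `A t` packet arrivals in slot `t ≥ 1`.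
After `t` slots: the number of packets in the system, and the number of symbols of the current
block that each receiver has received. The transmitter is idle while there are fewer than `K`
packets; otherwise it transmits a symbol of the block formed by the first `K` packets, and these
leave the system when every receiver has received `K` symbols of the block. -/
def queueState {n : ℕ} (K q₀ : ℕ) (X : ℕ → Fin n → Bool) (A : ℕ → ℕ) : ℕ → ℕ × (Fin n → ℕ)
  | 0 => (q₀, 0)
  | t + 1 =>
    let s := queueState K q₀ X A t
    if s.1 < K then (s.1 + A (t + 1), 0)
    else
      let a := receive s.2 (X (t + 1))
      if ∀ i, K ≤ a i then (s.1 - K + A (t + 1), 0) else (s.1 + A (t + 1), a)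

/-- The number of packets in the system after `t` slots. -/
def queueLength {n : ℕ} (K q₀ : ℕ) (X : ℕ → Fin n → Bool) (A : ℕ → ℕ) (t : ℕ) : ℕ :=
  (queueState K q₀ X A t).1

namespace GilbertElliott

variable (c : GilbertElliott)

/-- `η` is the throughput with `n` receivers and block size `K`: from every initial state (or
distribution of it), almost surely `K * R(t) / t → η` as `t → ∞`. -/
def IsThroughput (n K : ℕ) (η : ℝ) : Prop :=
  ∀ (μ₀ : Measure (Fin n → Bool)) [IsProbabilityMeasure μ₀],
    ∀ᵐ X ∂(c.channelLaw n μ₀),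
      Tendsto (fun t : ℕ => (K : ℝ) * ((blocksDone K X t : ℝ) / (t : ℝ))) atTop (𝓝 η)

/-- The system with i.i.d. arrival numbers of law `ν`, independent of the channels, is (strongly)
stable: from every initial condition, the time average of the expected queue length stays
bounded. -/
def IsStable (n K : ℕ) (ν : Measure ℕ) : Prop :=
  ∀ (μ₀ : Measure (Fin n → Bool)) [IsProbabilityMeasure μ₀] (q₀ : ℕ),
    limsup (fun N : ℕ => (∑ t ∈ Finset.range N,
        ∫⁻ ω, (queueLength K q₀ ω.1 ω.2 t : ℝ≥0∞)
          ∂((c.channelLaw n μ₀).prod (Measure.infinitePi fun _ : ℕ => ν))) / (N : ℝ≥0∞)) atTop < ⊤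

end GilbertElliott

end

/-! Write Ψ = `logRet` for the cumulant generating function of the return time to state 1. A
receiver's receptions form a delayed renewal process, so the time to collect K symbols has
exponential moment e^{KΨ(s)} up to a factor depending on the initial state. Passing from counts to
times turns the Perron root into Ψ: ρ(Π_θ) = e^{-s} for θ = -Ψ(s) (`perron_neg_logRet`).
Consequently R(r) is the supremum of s/(Ψ(s) + 1/r) over s > 0 with finite moments (`div_le_R`,
`exists_lt_div_of_lt_R`), the form in which it meets completion times.

Upper bound on the expected completion time E T. Starting in state 0 costs at most K₀ extra return
times (`hitMgf_le_retMgf_pow`). A union bound over the receivers and Jensen's inequality give s E T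
< log n + (K + K₀)Ψ(s) (`mul_blockTime_lt`), that is, E T · s/(Ψ(s) + 1/r) < K + K₀ with r = (K +
K₀)/log n. To keep the inequality strict for R(r) itself, the supremum must be attained. It is, by
compactness, unless p01 = 1 and R(r) ≤ 1/2; in that case two erasures never follow each other and E
T < 2K suffices (`blockTime_mul_R_lt`).

Lower bound. A Cramér-type estimate (`exists_le_tail`) bounds from below the probability that one
receiver needs more than μ₁K slots, for μ₁ slightly below Ψ'(s). If β > R(r), some s has Ψ'(s) > 1/β
while n times this probability still diverges (`exists_exponent`), so E T ≥ K/β eventually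
(`eventually_le_blockTime`).

From times to rates. The channel states together with the remaining receptions form a finite Markov
chain. Poisson's equation (`exists_poisson`) turns the number of completed blocks minus ηt into a
martingale up to a bounded correction, so the throughput exists. Extremal states of `remTime` + m·h
show that it lies between K/max E T and K/min E T over initial channel states (`exists_blockRate`);
no stationary law is needed. For the queue, q + (K/m)·`remTime` has negative drift, and its square
is a Lyapunov function (`isStable_of_lt`). -/

noncomputable section

namespace GilbertElliott

variable (c : GilbertElliott)

/-! ### Generating functions of hitting and return times of state `1` -/

/-- The exponential moment `E₀ e^{sτ}` of the time `τ` to reach state `1` from state `0`. -/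
def hitMgf (s : ℝ) : ℝ := c.p01 * Real.exp s / (1 - (1 - c.p01) * Real.exp s)

/-- The exponential moment `E₁ e^{sτ}` of the time `τ` to return to state `1`. -/
def retMgf (s : ℝ) : ℝ := Real.exp s * ((1 - c.p10) + c.p10 * c.hitMgf s)

/-- The cumulant generating function of the return time to state `1`. -/
def logRet (s : ℝ) : ℝ := Real.log (c.retMgf s)

/-- The exponential moments of order `s` are finite. -/
def MgfFinite (s : ℝ) : Prop := (1 - c.p01) * Real.exp s < 1

variable {c}

lemma MgfFinite.mono {s t : ℝ} (ht : c.MgfFinite t) (h : s ≤ t) : c.MgfFinite s :=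
  lt_of_le_of_lt (mul_le_mul_of_nonneg_left (Real.exp_le_exp.2 h)
    (sub_nonneg.2 c.p01_le_one)) ht

lemma MgfFinite.of_nonpos {s : ℝ} (h : s ≤ 0) : c.MgfFinite s := by
  have : c.MgfFinite 0 := by
    have := c.p01_pos
    simp only [MgfFinite, Real.exp_zero]
    linarith
  exact this.mono h

lemma hitMgf_eq {s : ℝ} (hs : c.MgfFinite s) :
    c.hitMgf s = Real.exp s * (c.p01 + (1 - c.p01) * c.hitMgf s) := by
  have : 1 - (1 - c.p01) * Real.exp s ≠ 0 := by
    have : (1 - c.p01) * Real.exp s < 1 := hs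
    linarith
  unfold hitMgf
  rw [mul_add, ← sub_eq_zero]
  obtain ⟨D, hD⟩ : ∃ D, D = 1 - (1 - c.p01) * Real.exp s := ⟨_, rfl⟩
  rw [← hD] at this ⊢
  field_simp
  rw [hD]
  ring

/-- Jensen's inequality for the hitting time, whose mean is 1/p01. After clearing the denominator it
becomes 1 + x ≤ e^x at two points whose weighted mean is 0. -/
lemma exp_div_le_hitMgf {s : ℝ} (hs : c.MgfFinite s) : Real.exp (s / c.p01) ≤ c.hitMgf s := by
  have h0 := c.p01_pos
  have h1 := c.p01_le_one
  have hd : 0 < 1 - (1 - c.p01) * Real.exp s := by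
    have : (1 - c.p01) * Real.exp s < 1 := hs
    linarith
  rw [hitMgf, le_div_iff₀ hd]
  have e1 : Real.exp s = Real.exp (s / c.p01) * Real.exp (s - s / c.p01) := by
    rw [← Real.exp_add]
    congr 1
    ring
  have k1 := Real.add_one_le_exp (s - s / c.p01)
  have k2 := Real.add_one_le_exp s
  have key : 1 ≤ c.p01 * Real.exp (s - s / c.p01) + (1 - c.p01) * Real.exp s := by
    have e2 : c.p01 * ((s - s / c.p01) + 1) + (1 - c.p01) * (s + 1) = 1 := by
      field_simp
      ring
    have := mul_le_mul_of_nonneg_left k1 h0.le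
    have := mul_le_mul_of_nonneg_left k2 (sub_nonneg.2 h1)
    linarith
  have := mul_le_mul_of_nonneg_left key (Real.exp_pos (s / c.p01)).le
  calc Real.exp (s / c.p01) * (1 - (1 - c.p01) * Real.exp s)
      ≤ c.p01 * (Real.exp (s / c.p01) * Real.exp (s - s / c.p01)) := by linarith
    _ = c.p01 * Real.exp s := by rw [← e1]

lemma capacity_pos : 0 < c.capacity :=
  div_pos c.p01_pos (add_pos c.p10_pos c.p01_pos)

/-- Jensen's inequality for the return time: its mean is 1 + p10/p01, the reciprocal of the
capacity. -/
lemma exp_div_capacity_le_retMgf {s : ℝ} (hs : c.MgfFinite s) :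
    Real.exp (s / c.capacity) ≤ c.retMgf s := by
  have h0 := c.p01_pos
  have h2 := c.p10_pos
  have h3 := c.p10_le_one
  set y := s / c.p01 with hy
  have k1 := Real.add_one_le_exp (-(y * c.p10))
  have k2 := Real.add_one_le_exp (y * (1 - c.p10))
  have key : 1 ≤ (1 - c.p10) * Real.exp (-(y * c.p10)) + c.p10 * Real.exp (y * (1 - c.p10)) := by
    have := mul_le_mul_of_nonneg_left k1 (sub_nonneg.2 h3)
    have := mul_le_mul_of_nonneg_left k2 h2.le
    nlinarith
  have e : s / c.capacity = s + y * c.p10 := by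
    rw [capacity, hy]
    field_simp
    ring
  rw [e, Real.exp_add, retMgf]
  refine mul_le_mul_of_nonneg_left ?_ (Real.exp_pos s).le
  have e3 : Real.exp (y * c.p10) * Real.exp (-(y * c.p10)) = 1 := by
    rw [← Real.exp_add]; simp
  have e4 : Real.exp (y * c.p10) * Real.exp (y * (1 - c.p10)) = Real.exp y := by
    rw [← Real.exp_add]; ring_nf
  calc Real.exp (y * c.p10) ≤ Real.exp (y * c.p10) *
        ((1 - c.p10) * Real.exp (-(y * c.p10)) + c.p10 * Real.exp (y * (1 - c.p10))) :=
        le_mul_of_one_le_right (Real.exp_pos _).le key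
    _ = (1 - c.p10) * (Real.exp (y * c.p10) * Real.exp (-(y * c.p10))) +
        c.p10 * (Real.exp (y * c.p10) * Real.exp (y * (1 - c.p10))) := by ring
    _ = (1 - c.p10) + c.p10 * Real.exp y := by rw [e3, e4]; ring
    _ ≤ _ := by
      have := mul_le_mul_of_nonneg_left (exp_div_le_hitMgf hs) h2.le
      linarith

lemma retMgf_pos {s : ℝ} (hs : c.MgfFinite s) : 0 < c.retMgf s :=
  (Real.exp_pos _).trans_le (exp_div_capacity_le_retMgf hs)

lemma hitMgf_pos {s : ℝ} (hs : c.MgfFinite s) : 0 < c.hitMgf s :=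
  (Real.exp_pos _).trans_le (exp_div_le_hitMgf hs)

lemma one_le_hitMgf {s : ℝ} (hs : c.MgfFinite s) (h0 : 0 ≤ s) : 1 ≤ c.hitMgf s :=
  (Real.one_le_exp (div_nonneg h0 c.p01_pos.le)).trans (exp_div_le_hitMgf hs)

lemma one_le_retMgf {s : ℝ} (hs : c.MgfFinite s) (h0 : 0 ≤ s) : 1 ≤ c.retMgf s :=
  (Real.one_le_exp (div_nonneg h0 capacity_pos.le)).trans (exp_div_capacity_le_retMgf hs)

lemma exp_logRet {s : ℝ} (hs : c.MgfFinite s) : Real.exp (c.logRet s) = c.retMgf s :=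
  Real.exp_log (retMgf_pos hs)

lemma div_capacity_le_logRet {s : ℝ} (hs : c.MgfFinite s) : s / c.capacity ≤ c.logRet s := by
  rw [logRet, Real.le_log_iff_exp_le (retMgf_pos hs)]
  exact exp_div_capacity_le_retMgf hs

lemma logRet_nonneg {s : ℝ} (hs : c.MgfFinite s) (h0 : 0 ≤ s) : 0 ≤ c.logRet s :=
  Real.log_nonneg (one_le_retMgf hs h0)

lemma hitMgf_zero : c.hitMgf 0 = 1 := by
  have := c.p01_pos
  simp [hitMgf, this.ne']

lemma retMgf_zero : c.retMgf 0 = 1 := by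
  simp [retMgf, hitMgf_zero]

lemma logRet_zero : c.logRet 0 = 0 := by
  simp [logRet, retMgf_zero]

lemma hitMgf_mono {s t : ℝ} (ht : c.MgfFinite t) (h : s ≤ t) : c.hitMgf s ≤ c.hitMgf t := by
  have h0 := c.p01_pos
  have h1 := c.p01_le_one
  have hd : 0 < 1 - (1 - c.p01) * Real.exp t := by
    have : (1 - c.p01) * Real.exp t < 1 := ht
    linarith
  have he := Real.exp_le_exp.2 h
  have := mul_le_mul_of_nonneg_left he (sub_nonneg.2 h1)
  exact div_le_div₀ (by positivity) (mul_le_mul_of_nonneg_left he h0.le) hd (by linarith)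

lemma retMgf_mono {s t : ℝ} (ht : c.MgfFinite t) (h : s ≤ t) : c.retMgf s ≤ c.retMgf t := by
  have h2 := c.p10_pos
  have h3 := c.p10_le_one
  have hg := hitMgf_pos (ht.mono h)
  have := hitMgf_mono ht h
  refine mul_le_mul (Real.exp_le_exp.2 h) ?_ ?_ (Real.exp_pos _).le
  · gcongr
  · have : 0 ≤ c.p10 * c.hitMgf s := by positivity
    linarith

lemma contDiffAt_logRet {s : ℝ} (hs : c.MgfFinite s) : ContDiffAt ℝ 1 c.logRet s := by
  have hd : 1 - (1 - c.p01) * Real.exp s ≠ 0 := by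
    have : (1 - c.p01) * Real.exp s < 1 := hs
    linarith
  have h1 : ContDiffAt ℝ 1 c.hitMgf s := by
    unfold hitMgf
    exact ContDiffAt.div (by fun_prop) (by fun_prop) hd
  have h2 : ContDiffAt ℝ 1 c.retMgf s := by
    unfold retMgf
    fun_prop
  exact h2.log (retMgf_pos hs).ne'

lemma isOpen_mgfFinite : IsOpen {s | c.MgfFinite s} :=
  isOpen_lt (by fun_prop) continuous_const

lemma continuousOn_deriv_logRet : ContinuousOn (deriv c.logRet) {s | c.MgfFinite s} :=
  ContDiffOn.continuousOn_deriv_of_isOpen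
    (fun _ hs => (contDiffAt_logRet hs).contDiffWithinAt) isOpen_mgfFinite le_rfl

lemma hasDerivAt_logRet {s : ℝ} (hs : c.MgfFinite s) :
    HasDerivAt c.logRet (deriv c.logRet s) s :=
  ((contDiffAt_logRet hs).differentiableAt one_ne_zero).hasDerivAt

/-- The Jensen line s/γ lies below Ψ and touches it at 0, hence is tangent there; nothing has to be
differentiated explicitly. -/
lemma hasDerivAt_logRet_zero : HasDerivAt c.logRet (1 / c.capacity) 0 := by
  have h := hasDerivAt_logRet (c := c) (s := 0) (MgfFinite.of_nonpos le_rfl)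
  have hmin : IsLocalMin (fun s => c.logRet s - s / c.capacity) 0 := by
    filter_upwards [isOpen_mgfFinite.mem_nhds
      (MgfFinite.of_nonpos (c := c) (s := 0) le_rfl)] with s hs
    have := div_capacity_le_logRet hs
    simp only [logRet_zero, zero_div, sub_zero]
    linarith
  have h2 := h.sub ((hasDerivAt_id (0 : ℝ)).div_const c.capacity)
  have := hmin.hasDerivAt_eq_zero h2
  rwa [show deriv c.logRet 0 = 1 / c.capacity by linarith] at h

/-! ### The Perron–Frobenius eigenvalue -/

lemma mem_spectrum_tilted (θ z : ℝ) : z ∈ spectrum ℝ (c.tilted θ) ↔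
    (z - (1 - c.p01)) * (z - (1 - c.p10) * Real.exp θ) = c.p01 * c.p10 * Real.exp θ := by
  rw [spectrum.mem_iff, Matrix.isUnit_iff_isUnit_det, isUnit_iff_ne_zero, not_not,
    ← Matrix.det_reindex_self finTwoEquiv.symm, Matrix.det_fin_two]
  simp [tilted, trans, finTwoEquiv, Matrix.algebraMap_eq_diagonal, Matrix.diagonal]
  constructor <;> intro h <;> linarith

/-- A root above the diagonal entry 1 - p01 is the largest one: there both factors on the left are
positive, and both increase to the right of it. -/
lemma perron_eq {θ z : ℝ} (hz : 1 - c.p01 < z)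
    (h : (z - (1 - c.p01)) * (z - (1 - c.p10) * Real.exp θ) = c.p01 * c.p10 * Real.exp θ) :
    c.perron θ = z := by
  refine IsGreatest.csSup_eq ⟨(mem_spectrum_tilted θ z).2 h, fun w hw => ?_⟩
  rw [mem_spectrum_tilted] at hw
  by_contra! hlt
  have hp := c.p01_pos
  have hq := c.p10_pos
  have hy := Real.exp_pos θ
  have hrhs : 0 < c.p01 * c.p10 * Real.exp θ := by positivity
  have h2 : 0 < z - (1 - c.p10) * Real.exp θ := by
    by_contra! hneg
    have := mul_nonpos_of_nonneg_of_nonpos (sub_nonneg.2 hz.le) hneg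
    linarith
  have : (z - (1 - c.p01)) * (z - (1 - c.p10) * Real.exp θ) <
      (w - (1 - c.p01)) * (w - (1 - c.p10) * Real.exp θ) :=
    mul_lt_mul'' (by linarith) (by linarith) (by linarith) h2.le
  linarith

/-- A cycle through state 1 picks up one factor e^θ and, for the eigenvalue e^{-s}, the moment
`retMgf s`; the eigenvalue equation says that their product is 1. -/
lemma perron_neg_logRet {s : ℝ} (hs : c.MgfFinite s) :
    c.perron (-c.logRet s) = Real.exp (-s) := by
  have hd : 0 < 1 - (1 - c.p01) * Real.exp s := by
    have : (1 - c.p01) * Real.exp s < 1 := hs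
    linarith
  have hφ := retMgf_pos hs
  have hy := Real.exp_pos s
  apply perron_eq
  · rw [Real.exp_neg, ← one_div, lt_div_iff₀ (Real.exp_pos s)]
    exact hs
  · rw [Real.exp_neg, Real.exp_neg, exp_logRet hs]
    rw [retMgf, hitMgf] at *
    generalize Real.exp s = y at *
    obtain ⟨D, hD⟩ : ∃ D, D = 1 - (1 - c.p01) * y := ⟨_, rfl⟩
    rw [← hD] at hd hφ ⊢
    have e : y * ((1 - c.p10) + c.p10 * (c.p01 * y / D))
        = y * ((1 - c.p10) * D + c.p10 * c.p01 * y) / D := by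
      field_simp
    rw [e] at hφ ⊢
    have hnum : 0 < (1 - c.p10) * D + c.p10 * c.p01 * y := by
      have := (div_pos_iff_of_pos_right hd).1 hφ
      exact pos_of_mul_pos_right this hy.le
    have e1 : y⁻¹ - (1 - c.p01) = D / y := by rw [hD]; field_simp
    have e2 : y⁻¹ - (1 - c.p10) * (y * ((1 - c.p10) * D + c.p10 * c.p01 * y) / D)⁻¹ =
        c.p10 * c.p01 / ((1 - c.p10) * D + c.p10 * c.p01 * y) := by
      rw [inv_div]
      generalize hM : (1 - c.p10) * D + c.p10 * c.p01 * y = M at *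
      field_simp
      linarith
    rw [e1, e2, inv_div]
    field_simp

/-- Makes the change of variable θ = -Ψ(s) onto, so the supremum over θ becomes one over s. The root
z of the characteristic polynomial gives s = -log z. -/
lemma exists_logRet_eq (θ : ℝ) :
    ∃ s, c.MgfFinite s ∧ c.logRet s = -θ ∧ (θ ≤ 0 → 0 ≤ s) := by
  have hp := c.p01_pos
  have hp1 := c.p01_le_one
  have hq := c.p10_pos
  have hq1 := c.p10_le_one
  have hy := Real.exp_pos θ
  set y := Real.exp θ with hydef
  set q : ℝ → ℝ := fun z => (z - (1 - c.p01)) * (z - (1 - c.p10) * y) - c.p01 * c.p10 * y with hqd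
  have hqc : Continuous q := by fun_prop
  have hqa : q (1 - c.p01) < 0 := by
    simp only [hqd, sub_self, zero_mul, zero_sub, Left.neg_neg_iff]
    positivity
  obtain ⟨z, hza, hz1, hz⟩ : ∃ z, 1 - c.p01 < z ∧ (θ ≤ 0 → z ≤ 1) ∧ q z = 0 := by
    -- The right endpoint is 1 or e^θ, according to the sign of θ. The choice 1 for θ ≤ 0 is what
    -- yields z ≤ 1, that is, s ≥ 0.
    have hb : ∃ b, 1 - c.p01 ≤ b ∧ (θ ≤ 0 → b ≤ 1) ∧ 0 ≤ q b := by
      rcases le_total θ 0 with h | h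
      · refine ⟨1, by linarith, fun _ => le_rfl, ?_⟩
        have : y ≤ 1 := Real.exp_le_one_iff.2 h
        have e : q 1 = c.p01 * (1 - y) := by simp only [hqd]; ring
        rw [e]
        exact mul_nonneg hp.le (by linarith)
      · have : 1 ≤ y := Real.one_le_exp h
        refine ⟨y, by linarith, fun h' => ?_, ?_⟩
        · have : y ≤ 1 := Real.exp_le_one_iff.2 h'
          linarith
        · have e' : q y = c.p10 * y * (y - 1) := by
            simp only [hqd]
            ring
          rw [e']
          have : 0 ≤ y - 1 := by linarith
          positivity
    obtain ⟨b, hb1, hb2, hb3⟩ := hb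
    obtain ⟨z, hz, hz0⟩ := intermediate_value_Icc hb1 hqc.continuousOn
      (show (0 : ℝ) ∈ Set.Icc (q (1 - c.p01)) (q b) from ⟨hqa.le, hb3⟩)
    refine ⟨z, lt_of_le_of_ne hz.1 ?_, fun h => hz.2.trans (hb2 h), hz0⟩
    rintro rfl
    exact hqa.ne hz0
  have hz0 : 0 < z := by linarith
  have hqz : (z - (1 - c.p01)) * (z - (1 - c.p10) * y) = c.p01 * c.p10 * y := sub_eq_zero.1 hz
  have hfin : c.MgfFinite (-Real.log z) := by
    rw [MgfFinite, Real.exp_neg, Real.exp_log hz0, ← div_eq_mul_inv, div_lt_one hz0]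
    exact hza
  refine ⟨-Real.log z, hfin, ?_, fun h => ?_⟩
  · rw [logRet, show -θ = Real.log (y⁻¹) by rw [Real.log_inv, hydef, Real.log_exp]]
    congr 1
    rw [retMgf, hitMgf, Real.exp_neg, Real.exp_log hz0]
    have hd : z - (1 - c.p01) ≠ 0 := by linarith
    have hd' : 1 - (1 - c.p01) * z⁻¹ ≠ 0 := by
      have : 1 - (1 - c.p01) * z⁻¹ = (z - (1 - c.p01)) / z := by field_simp
      rw [this]
      exact div_ne_zero hd hz0.ne'
    have e : c.p01 * z⁻¹ / (1 - (1 - c.p01) * z⁻¹) = c.p01 / (z - (1 - c.p01)) := by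
      rw [div_eq_div_iff hd' hd]
      field_simp
    rw [e]
    field_simp
    linarith
  · have := Real.log_nonpos hz0.le (hz1 h)
    linarith

/-! ### The rate function -/

lemma le_rate {s : ℝ} (hs : c.MgfFinite s) (β : ℝ) :
    ((s - β * c.logRet s : ℝ) : EReal) ≤ c.rate β := by
  refine le_trans (le_of_eq ?_)
    (le_iSup (fun θ : ℝ => ((θ * β - Real.log (c.perron θ) : ℝ) : EReal)) (-c.logRet s))
  rw [perron_neg_logRet hs, Real.log_exp]
  congr 1
  ring

/-- Below capacity only s > 0 matters: since Ψ(s) ≥ s/γ, the value s - βΨ(s) is not positive for s ≤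
0. -/
lemma exists_lt_of_lt_rate {β b : ℝ} (hβ : β ≤ c.capacity) (hb0 : 0 ≤ b)
    (hb : (b : EReal) < c.rate β) :
    ∃ s, 0 < s ∧ c.MgfFinite s ∧ b < s - β * c.logRet s := by
  obtain ⟨θ, hθ⟩ := lt_iSup_iff.1 hb
  obtain ⟨s, hs, hsθ, hs0⟩ := exists_logRet_eq (c := c) θ
  obtain rfl : θ = -c.logRet s := by linarith
  rw [perron_neg_logRet hs, Real.log_exp, EReal.coe_lt_coe_iff] at hθ
  have hlt : b < s - β * c.logRet s := by linarith
  refine ⟨s, ?_, hs, hlt⟩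
  by_contra! hs'
  have h1 := div_capacity_le_logRet hs
  rw [div_le_iff₀ capacity_pos] at h1
  rcases le_total (-c.logRet s) 0 with h | h
  · have : s = 0 := le_antisymm hs' (hs0 h)
    subst this
    rw [logRet_zero] at hlt
    linarith
  · nlinarith

/-- The function s - βΨ(s) vanishes at 0 with slope 1 - β/γ > 0. -/
lemma rate_pos {β : ℝ} (hβ : β < c.capacity) : 0 < c.rate β := by
  have hγ := capacity_pos (c := c)
  have hder : HasDerivAt (fun s => s - β * c.logRet s) (1 - β * (1 / c.capacity)) 0 :=
    (hasDerivAt_id (0 : ℝ)).sub (hasDerivAt_logRet_zero.const_mul β)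
  have hpos : 0 < 1 - β * (1 / c.capacity) := by
    rw [mul_one_div, sub_pos, div_lt_one hγ]
    exact hβ
  have hev : ∀ᶠ s in 𝓝[>] (0 : ℝ), 0 < s - β * c.logRet s := by
    have h2 := hasDerivWithinAt_iff_tendsto_slope' (by simp) |>.1
      (hder.hasDerivWithinAt (s := Set.Ioi 0))
    filter_upwards [h2.eventually (lt_mem_nhds hpos), self_mem_nhdsWithin] with s hs hs0
    have hs0' : (0 : ℝ) < s := hs0
    rw [slope_def_field, logRet_zero] at hs
    have := (div_pos_iff_of_pos_right (by linarith)).1 hs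
    linarith
  have hfin : ∀ᶠ s in 𝓝[>] (0 : ℝ), c.MgfFinite s :=
    nhdsWithin_le_nhds (isOpen_mgfFinite.mem_nhds (MgfFinite.of_nonpos (c := c) le_rfl))
  obtain ⟨s, hs, hsf⟩ := (hev.and hfin).exists
  exact lt_of_lt_of_le (by exact_mod_cast hs) (le_rate hsf β)

/-! ### The achievable rate `R` -/

lemma bddAbove_R (r : ℝ) :
    BddAbove {β : ℝ | (β : EReal) / c.rate β ≤ (r : EReal) ∧ 0 ≤ β ∧ β < c.capacity} :=
  ⟨c.capacity, fun _ h => h.2.2.le⟩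

lemma zero_mem_R {r : ℝ} (hr : 0 ≤ r) :
    (0 : ℝ) ∈ {β : ℝ | (β : EReal) / c.rate β ≤ (r : EReal) ∧ 0 ≤ β ∧ β < c.capacity} := by
  refine ⟨?_, le_rfl, capacity_pos⟩
  simpa using hr

lemma R_nonneg {r : ℝ} (hr : 0 ≤ r) : 0 ≤ c.R r :=
  le_csSup (bddAbove_R r) (zero_mem_R hr)

/-- Every exponential moment gives a lower bound for `R`. -/
lemma div_le_R {r s : ℝ} (hr : 0 < r) (hs0 : 0 ≤ s) (hs : c.MgfFinite s) :
    s / (c.logRet s + 1 / r) ≤ c.R r := by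
  have hγ := capacity_pos (c := c)
  have h1 := div_capacity_le_logRet hs
  have hΨ := logRet_nonneg hs hs0
  have hr' : 0 < 1 / r := by positivity
  -- This β solves s - βΨ(s) = β/r, so s certifies that the rate at β is at least β/r.
  set β := s / (c.logRet s + 1 / r) with hβ
  have hden : 0 < c.logRet s + 1 / r := by positivity
  have hβ0 : 0 ≤ β := by positivity
  have hβγ : β < c.capacity := by
    rw [hβ, div_lt_iff₀ hden]
    rw [div_le_iff₀ hγ] at h1
    nlinarith
  refine le_csSup (bddAbove_R r) ⟨?_, hβ0, hβγ⟩
  have hle : ((β / r : ℝ) : EReal) ≤ c.rate β := by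
    refine le_trans (le_of_eq ?_) (le_rate hs β)
    congr 1
    have : β * (c.logRet s + 1 / r) = s := by rw [hβ]; field_simp
    have e : s = β * c.logRet s + β / r := by linear_combination -this
    linarith
  have hpos := rate_pos hβγ
  by_cases htop : c.rate β = ⊤
  · rw [htop, EReal.div_top]
    exact_mod_cast hr.le
  · rw [EReal.div_le_iff_le_mul hpos htop]
    lift c.rate β to ℝ using ⟨htop, (bot_lt_of_lt hpos).ne'⟩ with x
    norm_cast at hle ⊢
    rw [div_le_iff₀ hr] at hle
    linarith

/-- `R` is the supremum of the lower bounds given by exponential moments. -/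
lemma exists_lt_div_of_lt_R {r b : ℝ} (hr : 0 < r) (hb0 : 0 ≤ b) (hb : b < c.R r) :
    ∃ s, 0 < s ∧ c.MgfFinite s ∧ b < s / (c.logRet s + 1 / r) := by
  obtain ⟨β, ⟨hβr, hβ0, hβγ⟩, hbβ⟩ := exists_lt_of_lt_csSup ⟨0, zero_mem_R hr.le⟩ hb
  have hpos := rate_pos hβγ
  have hβpos : 0 < β := hb0.trans_lt hbβ
  have hle : ((b / r : ℝ) : EReal) < c.rate β := by
    by_cases htop : c.rate β = ⊤
    · rw [htop]
      exact EReal.coe_lt_top _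
    · rw [EReal.div_le_iff_le_mul hpos htop] at hβr
      lift c.rate β to ℝ using ⟨htop, (bot_lt_of_lt hpos).ne'⟩ with x
      norm_cast at hβr ⊢
      rw [div_lt_iff₀ hr]
      linarith
  obtain ⟨s, hs0, hs, hlt⟩ := exists_lt_of_lt_rate hβγ.le (by positivity) hle
  refine ⟨s, hs0, hs, ?_⟩
  have hΨ := logRet_nonneg hs hs0.le
  have hr' : 0 < 1 / r := by positivity
  rw [lt_div_iff₀ (by positivity)]
  have : b * c.logRet s ≤ β * c.logRet s := mul_le_mul_of_nonneg_right hbβ.le hΨ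
  have : b * (c.logRet s + 1 / r) = b * c.logRet s + b / r := by ring
  linarith

lemma R_mono {r r' : ℝ} (hr : 0 < r) (h : r ≤ r') : c.R r ≤ c.R r' := by
  refine le_of_forall_lt fun b hb => ?_
  rcases lt_or_ge b 0 with hb0 | hb0
  · exact hb0.trans_le (R_nonneg (hr.le.trans h))
  obtain ⟨s, hs0, hs, hlt⟩ := exists_lt_div_of_lt_R hr hb0 hb
  refine hlt.trans_le (le_trans ?_ (div_le_R (hr.trans_le h) hs0.le hs))
  have hΨ := logRet_nonneg hs hs0.le
  have : 0 < r' := hr.trans_le h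
  gcongr

/-- R(r)/r is nonincreasing. Together with monotonicity of R this gives continuity on r > 0 without
any analysis of the rate function. -/
lemma mul_R_le {r r' : ℝ} (hr : 0 < r) (h : r ≤ r') : r / r' * c.R r' ≤ c.R r := by
  have hr' : 0 < r' := hr.trans_le h
  suffices c.R r' ≤ r' / r * c.R r by
    calc r / r' * c.R r' ≤ r / r' * (r' / r * c.R r) := by gcongr
      _ = c.R r := by field_simp
  refine le_of_forall_lt fun b hb => ?_
  rcases lt_or_ge b 0 with hb0 | hb0
  · exact hb0.trans_le (mul_nonneg (by positivity) (R_nonneg hr.le))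
  obtain ⟨s, hs0, hs, hlt⟩ := exists_lt_div_of_lt_R hr' hb0 hb
  refine hlt.trans_le (le_trans ?_
    (mul_le_mul_of_nonneg_left (div_le_R hr hs0.le hs) (by positivity)))
  have hΨ := logRet_nonneg hs hs0.le
  rw [← mul_div_assoc, div_le_div_iff₀ (by positivity) (by positivity)]
  have : r' / r * s * (c.logRet s + 1 / r') = s * (r' / r * c.logRet s + 1 / r) := by
    field_simp
  rw [this]
  have h1 : 1 ≤ r' / r := (one_le_div hr).2 h
  have := mul_le_mul_of_nonneg_right h1 hΨ
  exact mul_le_mul_of_nonneg_left (by linarith) hs0.le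

lemma tendsto_R {ι : Type*} {l : Filter ι} {f : ι → ℝ} {r : ℝ} (hr : 0 < r)
    (hf : Tendsto f l (𝓝 r)) : Tendsto (fun i => c.R (f i)) l (𝓝 (c.R r)) := by
  have hlow : Tendsto (fun i => min 1 (f i / r) * c.R r) l (𝓝 (c.R r)) := by
    have : Tendsto (fun i => min 1 (f i / r)) l (𝓝 (min 1 (r / r))) :=
      tendsto_const_nhds.min (hf.div_const r)
    rw [div_self hr.ne', min_self] at this
    simpa using this.mul_const (c.R r)
  have hup : Tendsto (fun i => max 1 (f i / r) * c.R r) l (𝓝 (c.R r)) := by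
    have : Tendsto (fun i => max 1 (f i / r)) l (𝓝 (max 1 (r / r))) :=
      tendsto_const_nhds.max (hf.div_const r)
    rw [div_self hr.ne', max_self] at this
    simpa using this.mul_const (c.R r)
  have hR := R_nonneg (c := c) hr.le
  refine tendsto_of_tendsto_of_tendsto_of_le_of_le' hlow hup ?_ ?_
  · filter_upwards [hf.eventually (lt_mem_nhds hr)] with i hi
    rcases le_total r (f i) with h | h
    · calc _ ≤ 1 * c.R r := mul_le_mul_of_nonneg_right (min_le_left _ _) hR
        _ ≤ _ := by rw [one_mul]; exact R_mono hr h
    · exact (mul_le_mul_of_nonneg_right (min_le_right _ _) hR).trans (mul_R_le hi h)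
  · filter_upwards [hf.eventually (lt_mem_nhds hr)] with i hi
    rcases le_total r (f i) with h | h
    · have := mul_R_le (c := c) hr h
      refine le_trans ?_ (mul_le_mul_of_nonneg_right (le_max_right _ _) hR)
      rw [div_mul_eq_mul_div, div_le_iff₀ hi] at this
      rw [div_mul_eq_mul_div, le_div_iff₀ hr]
      linarith
    · refine le_trans (R_mono hi h) ?_
      exact le_mul_of_one_le_left hR (le_max_left _ _)

/-! ### Hitting times against sums of return times -/

/-- The geometric sum defining `K₀` telescopes to 1 - (1 - p10)^(m+1). -/
lemma pow_K₀_le : (1 - c.p10) ^ (c.K₀ + 1) ≤ c.p01 := by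
  have hp := c.p01_pos
  have hq := c.p10_pos
  have hq1 := c.p10_le_one
  have hsum : ∀ m : ℕ, (∑ d ∈ Finset.range (m + 1), (1 - c.p10) ^ d * c.p10) =
      1 - (1 - c.p10) ^ (m + 1) := by
    intro m
    rw [← Finset.sum_mul]
    have := mul_neg_geom_sum (1 - c.p10) (m + 1)
    rw [← this]
    ring
  have hne : {m : ℕ | 1 ≤ (∑ d ∈ Finset.range (m + 1), (1 - c.p10) ^ d * c.p10) +
      c.p01}.Nonempty := by
    obtain ⟨m, hm⟩ := exists_pow_lt_of_lt_one hp (show 1 - c.p10 < 1 by linarith)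
    refine ⟨m, ?_⟩
    have : (1 - c.p10) ^ (m + 1) ≤ (1 - c.p10) ^ m :=
      pow_le_pow_of_le_one (by linarith) (by linarith) (Nat.le_succ m)
    simp only [Set.mem_ofPred_eq, hsum]
    linarith
  have := Nat.sInf_mem hne
  simp only [Set.mem_ofPred_eq, hsum] at this
  rw [K₀]
  simp only [hsum] at this ⊢
  linarith

/-- The right side is the mean of g^S for S binomial(m, q); it is at least the mean of g^(min S 1)
because g ≥ 1. -/
lemma le_add_mul_pow {q g : ℝ} (hq : 0 ≤ q) (hq1 : q ≤ 1) (hg : 1 ≤ g) (m : ℕ) :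
    (1 - q) ^ m + (1 - (1 - q) ^ m) * g ≤ ((1 - q) + q * g) ^ m := by
  induction m with
  | zero => simp
  | succ m ih =>
    have hb : 0 ≤ (1 - q) ^ m := pow_nonneg (by linarith) m
    have hb1 : (1 - q) ^ m ≤ 1 := pow_le_one₀ (by linarith) (by linarith)
    rw [pow_succ ((1 - q) + q * g)]
    refine le_trans ?_ (mul_le_mul_of_nonneg_right ih (by nlinarith))
    rw [pow_succ]
    generalize (1 - q) ^ m = b at *
    have : 0 ≤ (1 - b) * q * (g * (g - 1)) := by
      have : 0 ≤ g * (g - 1) := mul_nonneg (by linarith) (by linarith)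
      have : 0 ≤ 1 - b := by linarith
      positivity
    nlinarith

/-- This is where `K₀` enters. Among K₀ + 1 returns to state 1, at least one makes an excursion to 0
with probability at least 1 - p01, the probability that a hitting time from 0 lasts beyond its first
slot. So these returns dominate one hitting time. -/
lemma hitMgf_le_retMgf_pow {s : ℝ} (hs : c.MgfFinite s) (h0 : 0 ≤ s) :
    c.hitMgf s ≤ c.retMgf s ^ (c.K₀ + 1) := by
  have hq := c.p10_pos
  have hq1 := c.p10_le_one
  have hg := one_le_hitMgf hs h0
  have h1 := le_add_mul_pow hq.le hq1 hg (c.K₀ + 1)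
  have h2 := pow_K₀_le (c := c)
  have he := Real.one_le_exp h0
  rw [retMgf, mul_pow]
  calc c.hitMgf s = Real.exp s * (c.p01 + (1 - c.p01) * c.hitMgf s) := hitMgf_eq hs
    _ ≤ Real.exp s * ((1 - c.p10) + c.p10 * c.hitMgf s) ^ (c.K₀ + 1) := by
        refine mul_le_mul_of_nonneg_left (le_trans ?_ h1) (Real.exp_pos s).le
        nlinarith
    _ ≤ _ := by
        refine mul_le_mul_of_nonneg_right (le_self_pow₀ he (by simp)) (pow_nonneg ?_ _)
        nlinarith

end GilbertElliott

namespace GilbertElliott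

variable (c : GilbertElliott)

/-! ### Reception by a single receiver -/

/-- The probability that a receiver in state `x` receives fewer than `k` symbols in the next `t`
slots. -/
def tail : ℕ → Bool → ℕ → ℝ
  | _, _, 0 => 0
  | 0, _, _ + 1 => 1
  | t + 1, x, k + 1 => c.trans x true * tail t true k + c.trans x false * tail t false (k + 1)

/-- The exponential moment of order `s` of the time a receiver in state `x` needs to receive `k`
symbols. -/
def timeMgf (s : ℝ) : Bool → ℕ → ℝ
  | _, 0 => 1
  | true, k + 1 => c.retMgf s ^ (k + 1)
  | false, k + 1 => c.hitMgf s * c.retMgf s ^ k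

variable {c}

lemma trans_nonneg (x y : Bool) : 0 ≤ c.trans x y := by
  have := c.p01_pos
  have := c.p01_le_one
  have := c.p10_pos
  have := c.p10_le_one
  cases x <;> cases y <;> simp only [trans] <;> linarith

lemma trans_true_add_false (x : Bool) : c.trans x true + c.trans x false = 1 := by
  cases x <;> simp [trans]

lemma tail_nonneg_le_one (t : ℕ) : ∀ x k, 0 ≤ c.tail t x k ∧ c.tail t x k ≤ 1 := by
  induction t with
  | zero => rintro x (_ | k) <;> simp [tail]
  | succ t ih =>
    rintro x (_ | k)
    · simp [tail]
    · have h1 := trans_nonneg (c := c) x true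
      have h2 := trans_nonneg (c := c) x false
      have h3 := trans_true_add_false (c := c) x
      obtain ⟨a1, a2⟩ := ih true k
      obtain ⟨b1, b2⟩ := ih false (k + 1)
      simp only [tail]
      exact ⟨by positivity, by nlinarith⟩

lemma tail_nonneg (t : ℕ) (x : Bool) (k : ℕ) : 0 ≤ c.tail t x k := (tail_nonneg_le_one t x k).1

lemma tail_le_one (t : ℕ) (x : Bool) (k : ℕ) : c.tail t x k ≤ 1 := (tail_nonneg_le_one t x k).2

lemma tail_zero_right (t : ℕ) (x : Bool) : c.tail t x 0 = 0 := by
  cases t <;> rfl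

lemma tail_succ_le (t : ℕ) : ∀ x k, c.tail (t + 1) x k ≤ c.tail t x k := by
  induction t with
  | zero =>
    rintro x (_ | k)
    · simp [tail]
    · exact tail_le_one _ _ _
  | succ t ih =>
    rintro x (_ | k)
    · simp [tail]
    · change c.trans x true * c.tail (t + 1) true k + c.trans x false * c.tail (t + 1) false (k + 1) ≤
        c.trans x true * c.tail t true k + c.trans x false * c.tail t false (k + 1)
      exact add_le_add (mul_le_mul_of_nonneg_left (ih _ _) (trans_nonneg _ _))
        (mul_le_mul_of_nonneg_left (ih _ _) (trans_nonneg _ _))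

/-- Truncated subtraction covers k = 0 as well, so that products over receivers can be expanded
uniformly. -/
lemma one_sub_tail_succ (t : ℕ) (x : Bool) (k : ℕ) :
    1 - c.tail (t + 1) x k =
      ∑ y : Bool, c.trans x y * (1 - c.tail t y (k - if y then 1 else 0)) := by
  have h := trans_true_add_false (c := c) x
  rcases k with _ | k
  · simp [tail, tail_zero_right, h]
  · simp only [tail, Fintype.sum_bool, if_true, Nat.add_sub_cancel, Bool.false_eq_true, if_false,
      Nat.sub_zero]
    linear_combination -h

lemma timeMgf_true (s : ℝ) (k : ℕ) : c.timeMgf s true k = c.retMgf s ^ k := by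
  cases k <;> simp [timeMgf]

lemma timeMgf_succ {s : ℝ} (hs : c.MgfFinite s) (x : Bool) (k : ℕ) :
    c.timeMgf s x (k + 1) = Real.exp s *
      (c.trans x true * c.timeMgf s true k + c.trans x false * c.timeMgf s false (k + 1)) := by
  rw [timeMgf_true]
  cases x
  · simp only [timeMgf, trans]
    linear_combination (c.retMgf s ^ k) * hitMgf_eq hs
  · simp only [timeMgf, trans]
    rw [pow_succ]
    nth_rw 2 [retMgf]
    ring

lemma timeMgf_pos {s : ℝ} (hs : c.MgfFinite s) (x : Bool) (k : ℕ) : 0 < c.timeMgf s x k := by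
  have h1 := retMgf_pos hs
  have h2 := hitMgf_pos hs
  rcases k with _ | k
  · simp [timeMgf]
  · cases x <;> simp only [timeMgf] <;> positivity

lemma one_le_timeMgf {s : ℝ} (hs : c.MgfFinite s) (h0 : 0 ≤ s) (x : Bool) (k : ℕ) :
    1 ≤ c.timeMgf s x k := by
  have h1 := one_le_retMgf hs h0
  have h2 := one_le_hitMgf hs h0
  rcases k with _ | k
  · simp [timeMgf]
  · cases x
    · exact one_le_mul_of_one_le_of_one_le h2 (one_le_pow₀ h1)
    · exact one_le_pow₀ h1

lemma timeMgf_le {s : ℝ} (hs : c.MgfFinite s) (h0 : 0 ≤ s) (x : Bool) (k : ℕ) :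
    c.timeMgf s x k ≤ c.retMgf s ^ (k + c.K₀) := by
  have h1 := one_le_retMgf hs h0
  rcases k with _ | k
  · exact one_le_pow₀ h1
  · cases x
    · rw [show k + 1 + c.K₀ = (c.K₀ + 1) + k by ring, pow_add]
      exact mul_le_mul_of_nonneg_right (hitMgf_le_retMgf_pow hs h0) (by positivity)
    · exact pow_le_pow_right₀ h1 (Nat.le_add_right _ _)

/-- By summation by parts, the left side tends to E e^{sT} as N grows. Bounding partial sums by
induction on the horizon, with the first-step recursion, needs no random variable T. -/
lemma one_add_sum_tail_le {s : ℝ} (hs : c.MgfFinite s) (h0 : 0 ≤ s) (N : ℕ) : ∀ x k,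
    1 + ∑ t ∈ Finset.range N, (Real.exp (s * (t + 1)) - Real.exp (s * t)) * c.tail t x k ≤
      c.timeMgf s x k := by
  induction N with
  | zero => intro x k; simpa using one_le_timeMgf hs h0 x k
  | succ N ih =>
    rintro x (_ | k)
    · simp [tail_zero_right, timeMgf]
    · have h3 := trans_true_add_false (c := c) x
      rw [timeMgf_succ hs, Finset.sum_range_succ']
      have e : ∀ t : ℕ, (Real.exp (s * ((t + 1 : ℕ) + 1)) - Real.exp (s * (t + 1 : ℕ))) *
          c.tail (t + 1) x (k + 1) =
          Real.exp s * (c.trans x true * ((Real.exp (s * (t + 1)) - Real.exp (s * t)) *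
            c.tail t true k) + c.trans x false * ((Real.exp (s * (t + 1)) - Real.exp (s * t)) *
            c.tail t false (k + 1))) := by
        intro t
        have e1 : Real.exp (s * ((t + 1 : ℕ) + 1)) = Real.exp s * Real.exp (s * (t + 1)) := by
          rw [← Real.exp_add]; push_cast; ring_nf
        have e2 : Real.exp (s * (t + 1 : ℕ)) = Real.exp s * Real.exp (s * t) := by
          rw [← Real.exp_add]; push_cast; ring_nf
        rw [e1, e2, tail]
        ring
      rw [Finset.sum_congr rfl fun t _ => e t, ← Finset.mul_sum, Finset.sum_add_distrib,
        ← Finset.mul_sum, ← Finset.mul_sum]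
      have i1 := mul_le_mul_of_nonneg_left (ih true k) (trans_nonneg (c := c) x true)
      have i2 := mul_le_mul_of_nonneg_left (ih false (k + 1)) (trans_nonneg (c := c) x false)
      have := mul_le_mul_of_nonneg_left (add_le_add i1 i2) (Real.exp_pos s).le
      refine le_trans (le_of_eq ?_) this
      simp only [tail, Nat.cast_zero, mul_zero, Real.exp_zero, zero_add, mul_one]
      linear_combination -(Real.exp s) * h3

lemma exists_pos_mgfFinite : ∃ s : ℝ, 0 < s ∧ c.MgfFinite s := by
  have hfin : ∀ᶠ s in 𝓝[>] (0 : ℝ), c.MgfFinite s :=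
    nhdsWithin_le_nhds (isOpen_mgfFinite.mem_nhds (MgfFinite.of_nonpos (c := c) le_rfl))
  obtain ⟨s, hs, hs0⟩ := (hfin.and self_mem_nhdsWithin).exists
  exact ⟨s, hs0, hs⟩

/-- Chernoff's bound: a single term of the preceding sum already forces geometric decay. -/
lemma summable_tail (x : Bool) (k : ℕ) : Summable fun t => c.tail t x k := by
  obtain ⟨s, hs0, hs⟩ := exists_pos_mgfFinite (c := c)
  have he : 1 < Real.exp s := Real.one_lt_exp_iff.2 hs0
  refine Summable.of_nonneg_of_le (fun t => tail_nonneg t x k) (fun t => ?_)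
    ((summable_geometric_of_lt_one (Real.exp_pos (-s)).le
      (Real.exp_lt_one_iff.2 (neg_lt_zero.2 hs0))).mul_left (c.timeMgf s x k / (Real.exp s - 1)))
  have h := one_add_sum_tail_le hs hs0.le (t + 1) x k
  have hpos : ∀ j : ℕ, 0 ≤ (Real.exp (s * (j + 1)) - Real.exp (s * j)) * c.tail j x k := by
    intro j
    refine mul_nonneg (sub_nonneg.2 (Real.exp_le_exp.2 ?_)) (tail_nonneg _ _ _)
    nlinarith
  have h2 := Finset.single_le_sum (fun j _ => hpos j) (Finset.self_mem_range_succ t)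
  have e1 : Real.exp (s * (t + 1)) - Real.exp (s * t) = Real.exp (s * t) * (Real.exp s - 1) := by
    rw [mul_add, Real.exp_add, mul_one]
    ring
  have e2 : Real.exp (-s) ^ t = (Real.exp (s * t))⁻¹ := by
    rw [← Real.exp_nat_mul, ← Real.exp_neg]
    ring_nf
  rw [e2, ← div_eq_mul_inv, div_div, le_div_iff₀ (mul_pos (by linarith) (Real.exp_pos _))]
  rw [e1] at h2
  linarith

/-! ### Completion of a block -/

variable (c) in
/-- The probability that, after `t` slots, not every receiver `i` has received `k i` symbols. -/
def blockTail {n : ℕ} (t : ℕ) (x : Fin n → Bool) (k : Fin n → ℕ) : ℝ :=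
  1 - ∏ i, (1 - c.tail t (x i) (k i))

variable (c) in
/-- The expected time until every receiver `i` has received `k i` symbols. -/
def blockTime {n : ℕ} (x : Fin n → Bool) (k : Fin n → ℕ) : ℝ := ∑' t, c.blockTail t x k

variable (c) in
/-- The one-step transition probabilities of `n` receivers. -/
def weight {n : ℕ} (x y : Fin n → Bool) : ℝ := ∏ i, c.trans (x i) (y i)

variable {n : ℕ}

lemma weight_nonneg (x y : Fin n → Bool) : 0 ≤ c.weight x y :=
  Finset.prod_nonneg fun _ _ => trans_nonneg _ _

lemma sum_weight_mul_prod (x : Fin n → Bool) (f : Fin n → Bool → ℝ) :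
    ∑ y, c.weight x y * ∏ i, f i (y i) = ∏ i, ∑ b, c.trans (x i) b * f i b := by
  rw [Finset.prod_univ_sum, Fintype.piFinset_univ]
  simp [weight, Finset.prod_mul_distrib]

lemma sum_weight (x : Fin n → Bool) : ∑ y, c.weight x y = 1 := by
  have := sum_weight_mul_prod (c := c) x fun _ _ => 1
  simpa [trans_true_add_false] using this

lemma blockTail_nonneg (t : ℕ) (x : Fin n → Bool) (k : Fin n → ℕ) : 0 ≤ c.blockTail t x k :=
  sub_nonneg.2 (Finset.prod_le_one (fun _ _ => sub_nonneg.2 (tail_le_one _ _ _))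
    fun _ _ => sub_le_self _ (tail_nonneg _ _ _))

lemma blockTail_le_one (t : ℕ) (x : Fin n → Bool) (k : Fin n → ℕ) : c.blockTail t x k ≤ 1 :=
  sub_le_self _ (Finset.prod_nonneg fun _ _ => sub_nonneg.2 (tail_le_one _ _ _))

lemma blockTail_antitone (x : Fin n → Bool) (k : Fin n → ℕ) :
    Antitone fun t => c.blockTail t x k :=
  antitone_nat_of_succ_le fun _ => sub_le_sub_left (Finset.prod_le_prod
    (fun _ _ => sub_nonneg.2 (tail_le_one _ _ _))
    fun _ _ => sub_le_sub_left (tail_succ_le _ _ _) _) _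

/-- Independence enters here: the product of the one-receiver recursions is the recursion for the
joint chain. -/
lemma blockTail_succ (t : ℕ) (x : Fin n → Bool) (k : Fin n → ℕ) :
    c.blockTail (t + 1) x k =
      ∑ y, c.weight x y * c.blockTail t y fun i => k i - if y i then 1 else 0 := by
  simp only [blockTail, mul_sub, mul_one, Finset.sum_sub_distrib, sum_weight]
  rw [sum_weight_mul_prod (c := c) x fun i b => 1 - c.tail t b (k i - if b then 1 else 0)]
  simp only [one_sub_tail_succ]

lemma blockTail_zero_of_exists {x : Fin n → Bool} {k : Fin n → ℕ} (h : ∃ i, k i ≠ 0) :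
    c.blockTail 0 x k = 1 := by
  obtain ⟨i, hi⟩ := h
  rw [blockTail, Finset.prod_eq_zero (Finset.mem_univ i), sub_zero]
  obtain ⟨m, hm⟩ := Nat.exists_eq_succ_of_ne_zero hi
  rw [hm, Nat.succ_eq_add_one, tail, sub_self]

lemma blockTail_of_forall {x : Fin n → Bool} {k : Fin n → ℕ} (h : ∀ i, k i = 0) (t : ℕ) :
    c.blockTail t x k = 0 := by
  simp [blockTail, h, tail_zero_right]

lemma one_sub_prod_le_sum {ι : Type*} (s : Finset ι) (f : ι → ℝ) (h0 : ∀ i, 0 ≤ f i)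
    (h1 : ∀ i, f i ≤ 1) : 1 - ∏ i ∈ s, (1 - f i) ≤ ∑ i ∈ s, f i := by
  classical
  induction s using Finset.induction_on with
  | empty => simp
  | insert a s ha ih =>
    rw [Finset.prod_insert ha, Finset.sum_insert ha]
    have hp1 : ∏ i ∈ s, (1 - f i) ≤ 1 :=
      Finset.prod_le_one (fun i _ => sub_nonneg.2 (h1 i)) fun i _ => sub_le_self _ (h0 i)
    nlinarith [h0 a]

lemma blockTail_le_sum (t : ℕ) (x : Fin n → Bool) (k : Fin n → ℕ) :
    c.blockTail t x k ≤ ∑ i, c.tail t (x i) (k i) :=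
  one_sub_prod_le_sum _ _ (fun _ => tail_nonneg _ _ _) fun _ => tail_le_one _ _ _

lemma summable_blockTail (x : Fin n → Bool) (k : Fin n → ℕ) :
    Summable fun t => c.blockTail t x k :=
  Summable.of_nonneg_of_le (fun _ => blockTail_nonneg _ _ _) (fun _ => blockTail_le_sum _ _ _)
    (summable_sum fun _ _ => summable_tail _ _)

lemma blockTime_nonneg (x : Fin n → Bool) (k : Fin n → ℕ) : 0 ≤ c.blockTime x k :=
  tsum_nonneg fun _ => blockTail_nonneg _ _ _

lemma blockTime_of_forall {x : Fin n → Bool} {k : Fin n → ℕ} (h : ∀ i, k i = 0) :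
    c.blockTime x k = 0 := by
  simp [blockTime, blockTail_of_forall h]

lemma blockTime_of_exists {x : Fin n → Bool} {k : Fin n → ℕ} (h : ∃ i, k i ≠ 0) :
    c.blockTime x k =
      1 + ∑ y, c.weight x y * c.blockTime y fun i => k i - if y i then 1 else 0 := by
  rw [blockTime, (summable_blockTail x k).tsum_eq_zero_add, blockTail_zero_of_exists h]
  simp only [blockTail_succ, blockTime]
  rw [Summable.tsum_finsetSum fun y _ => (summable_blockTail _ _).mul_left _]
  simp only [tsum_mul_left]

lemma one_le_blockTime {x : Fin n → Bool} {k : Fin n → ℕ} (h : ∃ i, k i ≠ 0) :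
    1 ≤ c.blockTime x k := by
  rw [blockTime_of_exists h]
  exact le_add_of_nonneg_right
    (Finset.sum_nonneg fun _ _ => mul_nonneg (weight_nonneg _ _) (blockTime_nonneg _ _))

/-- Markov's inequality, from the monotonicity of the tail. -/
lemma mul_blockTail_le_blockTime (M : ℕ) (x : Fin n → Bool) (k : Fin n → ℕ) :
    M * c.blockTail M x k ≤ c.blockTime x k := by
  refine le_trans ?_ ((summable_blockTail x k).sum_le_tsum (Finset.range M)
    fun _ _ => blockTail_nonneg _ _ _)
  calc (M : ℝ) * c.blockTail M x k = ∑ _t ∈ Finset.range M, c.blockTail M x k := by simp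
    _ ≤ _ := Finset.sum_le_sum fun t ht =>
      blockTail_antitone x k (Finset.mem_range.1 ht).le

/-- Jensen's inequality for a time with tail probabilities `v t`. -/
lemma exp_mul_sum_le {v : ℕ → ℝ} (h0 : ∀ t, 0 ≤ v t) (h1 : ∀ t, v t ≤ 1) {s : ℝ} (hs : 0 ≤ s)
    (N : ℕ) : Real.exp (s * ∑ t ∈ Finset.range N, v t) ≤
      1 + ∑ t ∈ Finset.range N, (Real.exp (s * (t + 1)) - Real.exp (s * t)) * v t := by
  induction N with
  | zero => simp
  | succ N ih =>
    rw [Finset.sum_range_succ, Finset.sum_range_succ, mul_add, Real.exp_add]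
    have hA : ∑ t ∈ Finset.range N, v t ≤ N := by
      calc _ ≤ ∑ _t ∈ Finset.range N, (1 : ℝ) := Finset.sum_le_sum fun t _ => h1 t
        _ = N := by simp
    have hE : Real.exp (s * ∑ t ∈ Finset.range N, v t) ≤ Real.exp (s * N) :=
      Real.exp_le_exp.2 (mul_le_mul_of_nonneg_left hA hs)
    -- Convexity of exp on [0, s], as v N is in [0, 1]. The prefactor is at most e^{sN} because the
    -- first N values sum to at most N.
    have hc : Real.exp (s * v N) ≤ 1 + v N * (Real.exp s - 1) := by
      have := convexOn_exp.2 (Set.mem_univ 0) (Set.mem_univ s) (sub_nonneg.2 (h1 N)) (h0 N)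
        (by ring)
      simp only [smul_eq_mul, mul_zero, zero_add, Real.exp_zero, mul_one] at this
      rw [mul_comm s]
      linarith
    have h1' : 0 ≤ Real.exp s - 1 := sub_nonneg.2 (Real.one_le_exp hs)
    have e1 : Real.exp (s * (N + 1)) = Real.exp (s * N) * Real.exp s := by
      rw [← Real.exp_add]; ring_nf
    have hv : 0 ≤ v N * (Real.exp s - 1) := mul_nonneg (h0 N) h1'
    rw [e1]
    calc _ ≤ Real.exp (s * ∑ t ∈ Finset.range N, v t) * (1 + v N * (Real.exp s - 1)) :=
          mul_le_mul_of_nonneg_left hc (Real.exp_pos _).le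
      _ = Real.exp (s * ∑ t ∈ Finset.range N, v t) +
          Real.exp (s * ∑ t ∈ Finset.range N, v t) * (v N * (Real.exp s - 1)) := by ring
      _ ≤ _ + Real.exp (s * N) * (v N * (Real.exp s - 1)) :=
          add_le_add ih (mul_le_mul_of_nonneg_right hE hv)
      _ = _ := by ring

/-- Union bound on the tails, then Jensen: e^{s E T} ≤ 1 + n(W - 1), where W dominates every
one-receiver exponential moment. -/
lemma mul_blockTime_lt {s : ℝ} (hs : c.MgfFinite s) (h0 : 0 ≤ s) (hn : 2 ≤ n) (K : ℕ)
    (x : Fin n → Bool) :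
    s * c.blockTime x (fun _ => K) < Real.log n + (K + c.K₀) * c.logRet s := by
  have hn0 : (0 : ℝ) < n := by positivity
  have hn2 : (2 : ℝ) ≤ n := by exact_mod_cast hn
  set W := c.retMgf s ^ (K + c.K₀) with hW
  have hW0 : 0 < W := pow_pos (retMgf_pos hs) _
  have key : ∀ N, Real.exp (s * ∑ t ∈ Finset.range N, c.blockTail t x fun _ => K) ≤
      n * W - (n - 1) := by
    intro N
    refine (exp_mul_sum_le (fun t => blockTail_nonneg t x _) (fun t => blockTail_le_one t x _)
      h0 N).trans ?_
    calc 1 + ∑ t ∈ Finset.range N, (Real.exp (s * (t + 1)) - Real.exp (s * t)) *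
          c.blockTail t x (fun _ => K)
        ≤ 1 + ∑ t ∈ Finset.range N, (Real.exp (s * (t + 1)) - Real.exp (s * t)) *
          ∑ i, c.tail t (x i) K := by
          refine add_le_add le_rfl (Finset.sum_le_sum fun t _ => mul_le_mul_of_nonneg_left
            (blockTail_le_sum t x _) (sub_nonneg.2 (Real.exp_le_exp.2 (by nlinarith))))
      _ = 1 + ∑ i, ∑ t ∈ Finset.range N, (Real.exp (s * (t + 1)) - Real.exp (s * t)) *
          c.tail t (x i) K := by
          simp only [Finset.mul_sum]
          rw [Finset.sum_comm]
      _ ≤ 1 + ∑ _i : Fin n, (W - 1) := by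
          refine add_le_add le_rfl (Finset.sum_le_sum fun i _ => ?_)
          have := one_add_sum_tail_le hs h0 N (x i) K
          have := timeMgf_le hs h0 (x i) K
          linarith
      _ = _ := by
          simp only [Finset.sum_const, Finset.card_univ, Fintype.card_fin, nsmul_eq_mul]
          ring
  have hlim : Real.exp (s * c.blockTime x fun _ => K) ≤ n * W - (n - 1) := by
    have ht := (summable_blockTail (c := c) x fun _ => K).hasSum.tendsto_sum_nat
    exact le_of_tendsto ((Real.continuous_exp.tendsto _).comp (ht.const_mul s))
      (Eventually.of_forall key)
  -- Strictness comes from the discarded n - 1, positive since n ≥ 2.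
  have hlt : Real.exp (s * c.blockTime x fun _ => K) < n * W := by linarith
  have e : (n : ℝ) * W = Real.exp (Real.log n + (K + c.K₀) * c.logRet s) := by
    rw [Real.exp_add, Real.exp_log hn0, hW, ← exp_logRet hs, ← Real.exp_nat_mul]
    push_cast
    rfl
  rwa [e, Real.exp_lt_exp] at hlt

/-! ### Comparison with `R` -/

/-- Every erasure is followed by a reception, so two slots per symbol suffice, and a start in state
0 saves one slot. -/
lemma tail_eq_zero_of_p01_eq_one (h : c.p01 = 1) (t : ℕ) : ∀ k,
    (2 * k ≤ t → c.tail t true k = 0) ∧ (2 * k ≤ t + 1 → c.tail t false k = 0) := by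
  induction t with
  | zero =>
    rintro (_ | k)
    · simp [tail]
    · exact ⟨fun h => by omega, fun h => by omega⟩
  | succ t ih =>
    rintro (_ | k)
    · simp [tail]
    · refine ⟨fun hk => ?_, fun hk => ?_⟩
      · rw [tail, (ih k).1 (by omega), (ih (k + 1)).2 (by omega)]
        simp
      · rw [tail, (ih k).1 (by omega)]
        simp [trans, h]

/-- At most 2K slots are needed, and since aperiodicity forces p10 < 1, all receivers finish one
slot earlier with positive probability. -/
lemma blockTime_lt_of_p01_eq_one (h : c.p01 = 1) {K : ℕ} (hK : 1 ≤ K) (x : Fin n → Bool) :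
    c.blockTime x (fun _ => K) < 2 * K := by
  obtain ⟨m, rfl⟩ : ∃ m, K = m + 1 := ⟨K - 1, by omega⟩
  have hq : c.p10 < 1 := lt_of_le_of_ne c.p10_le_one fun h' => c.aperiodic ⟨h, h'⟩
  have h0 : ∀ t ∉ Finset.range (2 * m + 2), c.blockTail t x (fun _ => m + 1) = 0 := by
    intro t ht
    rw [Finset.mem_range, not_lt] at ht
    have : ∀ b, c.tail t b (m + 1) = 0 := by
      rintro (_ | _)
      · exact (tail_eq_zero_of_p01_eq_one h t _).2 (by omega)
      · exact (tail_eq_zero_of_p01_eq_one h t _).1 (by omega)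
    simp [blockTail, this]
  have hlast : c.blockTail (2 * m + 1) x (fun _ => m + 1) < 1 := by
    refine sub_lt_self _ (Finset.prod_pos fun i _ => ?_)
    rw [sub_pos]
    cases x i
    · rw [(tail_eq_zero_of_p01_eq_one h _ (m + 1)).2 (by omega)]
      exact one_pos
    · rw [tail, (tail_eq_zero_of_p01_eq_one h _ _).1 (by omega)]
      have := mul_le_of_le_one_right c.p10_pos.le (tail_le_one (c := c) (2 * m) false (m + 1))
      simp only [trans, mul_zero, zero_add]
      linarith
  rw [blockTime, tsum_eq_sum h0, Finset.sum_range_succ]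
  have : ∑ t ∈ Finset.range (2 * m + 1), c.blockTail t x (fun _ => m + 1) ≤ 2 * m + 1 := by
    calc _ ≤ ∑ _t ∈ Finset.range (2 * m + 1), (1 : ℝ) :=
          Finset.sum_le_sum fun t _ => blockTail_le_one _ _ _
      _ = _ := by simp
  push_cast
  linarith

/-- If `p01 = 1`, the return time generating function grows like `e^{2s}`. -/
lemma two_mul_add_log_le_logRet (h : c.p01 = 1) (s : ℝ) :
    2 * s + Real.log c.p10 ≤ c.logRet s := by
  have hq := c.p10_pos
  have hq1 := c.p10_le_one
  have e : Real.exp (2 * s) = Real.exp s * Real.exp s := by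
    rw [← Real.exp_add]; ring_nf
  have e2 : Real.exp (2 * s + Real.log c.p10) = Real.exp s * (c.p10 * Real.exp s) := by
    rw [Real.exp_add, Real.exp_log hq, e]
    ring
  have h1 : c.retMgf s = Real.exp s * ((1 - c.p10) + c.p10 * Real.exp s) := by
    simp [retMgf, hitMgf, h]
  have hpos := Real.exp_pos s
  have hle : Real.exp (2 * s + Real.log c.p10) ≤ c.retMgf s := by
    rw [e2, h1]
    exact mul_le_mul_of_nonneg_left (by linarith) hpos.le
  exact (Real.le_log_iff_exp_le ((Real.exp_pos _).trans_le hle)).2 hle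

/-- A quantitative form of Ψ → ∞ at the pole (1 - p01)e^s = 1; it keeps near-optimal exponents away
from the pole. -/
lemma mul_one_sub_ge {s : ℝ} (hs : c.MgfFinite s) (h0 : 0 ≤ s) :
    c.p10 * c.p01 ≤ Real.exp (c.logRet s) * (1 - (1 - c.p01) * Real.exp s) := by
  have hp := c.p01_pos
  have hq := c.p10_pos
  have hq1 := c.p10_le_one
  have hd : 0 < 1 - (1 - c.p01) * Real.exp s := by
    have : (1 - c.p01) * Real.exp s < 1 := hs
    linarith
  have he := Real.one_le_exp h0
  have hg := hitMgf_pos hs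
  have e : c.hitMgf s * (1 - (1 - c.p01) * Real.exp s) = c.p01 * Real.exp s := by
    rw [hitMgf, div_mul_cancel₀ _ hd.ne']
  rw [exp_logRet hs]
  calc c.p10 * c.p01 ≤ c.p10 * (c.p01 * Real.exp s) := by
        gcongr
        exact le_mul_of_one_le_right hp.le he
    _ = (c.p10 * c.hitMgf s) * (1 - (1 - c.p01) * Real.exp s) := by rw [mul_assoc, e]
    _ ≤ _ := by
        refine mul_le_mul_of_nonneg_right ?_ hd.le
        rw [retMgf]
        calc c.p10 * c.hitMgf s ≤ (1 - c.p10) + c.p10 * c.hitMgf s := by linarith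
          _ ≤ _ := le_mul_of_one_le_left (by positivity) he

lemma R_pos {r : ℝ} (hr : 0 < r) : 0 < c.R r := by
  obtain ⟨s, hs0, hs⟩ := exists_pos_mgfFinite (c := c)
  have := logRet_nonneg hs hs0.le
  exact lt_of_lt_of_le (by positivity) (div_le_R hr hs0.le hs)

/-- Exponents that nearly attain the supremum stay in a compact set, except when `p01 = 1` and
`R r ≤ 1 / 2`. -/
lemma exists_isCompact {r : ℝ} (hr : 0 < r) (h : ¬ (c.p01 = 1 ∧ c.R r ≤ 1 / 2)) :
    ∃ S : Set ℝ, IsCompact S ∧ (∀ s ∈ S, 0 ≤ s ∧ c.MgfFinite s) ∧ ∃ b, 0 ≤ b ∧ b < c.R r ∧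
      ∀ s, 0 < s → c.MgfFinite s → b < s / (c.logRet s + 1 / r) → s ∈ S := by
  have hR := R_pos (c := c) hr
  by_cases hp : c.p01 = 1
  · have hR2 : 1 / 2 < c.R r := by
      by_contra! h'
      exact h ⟨hp, h'⟩
    obtain ⟨b, hb, hbR⟩ := exists_between hR2
    have hfin : ∀ s, c.MgfFinite s := fun s => by simp [MgfFinite, hp]
    -- Since Ψ(s) ≥ 2s + log p10, a ratio above b gives (2b - 1)s < -b log p10; this bounds s
    -- because b > 1/2.
    refine ⟨Set.Icc 0 (b * (-Real.log c.p10) / (2 * b - 1)), isCompact_Icc,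
      fun s hs => ⟨hs.1, hfin s⟩, b, by linarith, hbR, fun s hs0 hs hlt => ⟨hs0.le, ?_⟩⟩
    have h1 := two_mul_add_log_le_logRet hp s
    have hΨ := logRet_nonneg hs hs0.le
    have hr' : 0 < 1 / r := by positivity
    rw [lt_div_iff₀ (by positivity)] at hlt
    rw [le_div_iff₀ (by linarith)]
    nlinarith
  · have hp1 : 0 < 1 - c.p01 := sub_pos.2 (lt_of_le_of_ne c.p01_le_one hp)
    have hp0 := c.p01_pos
    have hq0 := c.p10_pos
    set b := c.R r / 2 with hb
    have hb0 : 0 < b := by positivity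
    set B := -Real.log (1 - c.p01) with hB
    have hsB : ∀ s, c.MgfFinite s → s ≤ B := by
      intro s hs
      have h1 : Real.exp s ≤ (1 - c.p01)⁻¹ := by
        rw [← one_div, le_div_iff₀ hp1, mul_comm]
        exact le_of_lt hs
      rw [hB, ← Real.log_inv]
      exact (Real.le_log_iff_exp_le (by positivity)).2 h1
    -- A ratio above b gives Ψ(s) < s/b ≤ B/b, and then `mul_one_sub_ge` holds with a fixed
    -- constant: a closed condition that excludes the pole.
    refine ⟨Set.Icc 0 B ∩ {s | c.p10 * c.p01 ≤
        Real.exp (B / b) * (1 - (1 - c.p01) * Real.exp s)},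
      isCompact_Icc.inter_right (isClosed_le continuous_const (by fun_prop)),
      fun s hs => ⟨hs.1.1, ?_⟩, b, hb0.le, by linarith, fun s hs0 hs hlt => ⟨⟨hs0.le, hsB s hs⟩, ?_⟩⟩
    · have h2 : 0 < Real.exp (B / b) * (1 - (1 - c.p01) * Real.exp s) :=
        lt_of_lt_of_le (by positivity) hs.2
      have := pos_of_mul_pos_right h2 (Real.exp_pos _).le
      rw [MgfFinite]
      linarith
    · have hΨ := logRet_nonneg hs hs0.le
      have hr' : 0 < 1 / r := by positivity
      rw [lt_div_iff₀ (by positivity)] at hlt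
      have h3 : c.logRet s ≤ B / b := by
        rw [le_div_iff₀ hb0]
        have := hsB s hs
        nlinarith
      refine (mul_one_sub_ge hs hs0.le).trans ?_
      refine mul_le_mul_of_nonneg_right (Real.exp_le_exp.2 h3) ?_
      have : (1 - c.p01) * Real.exp s < 1 := hs
      linarith

lemma exists_div_eq_R {r : ℝ} (hr : 0 < r) (h : ¬ (c.p01 = 1 ∧ c.R r ≤ 1 / 2)) :
    ∃ s, 0 < s ∧ c.MgfFinite s ∧ c.R r ≤ s / (c.logRet s + 1 / r) := by
  obtain ⟨S, hS, hSf, b, hb0, hbR, hbS⟩ := exists_isCompact hr h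
  have hr' : 0 < 1 / r := by positivity
  obtain ⟨s1, h1, h1f, hlt1⟩ := exists_lt_div_of_lt_R hr hb0 hbR
  have hcont : ContinuousOn (fun s => s / (c.logRet s + 1 / r)) S := by
    intro s hs
    have h2 : ContinuousAt c.logRet s := (contDiffAt_logRet (hSf s hs).2).continuousAt
    have := logRet_nonneg (hSf s hs).2 (hSf s hs).1
    exact (continuousAt_id.div (h2.add continuousAt_const)
      (add_pos_of_nonneg_of_pos this hr').ne').continuousWithinAt
  obtain ⟨s, hsS, hmax⟩ := hS.exists_isMaxOn ⟨s1, hbS s1 h1 h1f hlt1⟩ hcont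
  have hle : c.R r ≤ s / (c.logRet s + 1 / r) := by
    refine le_of_forall_lt fun b' hb' => ?_
    obtain ⟨s2, h2, h2f, hlt2⟩ := exists_lt_div_of_lt_R hr (le_max_of_le_left hb0)
      (max_lt hbR hb')
    exact ((le_max_right b b').trans_lt hlt2).trans_le
      (hmax (hbS s2 h2 h2f ((le_max_left b b').trans_lt hlt2)))
  refine ⟨s, (hSf s hsS).1.lt_of_ne ?_, (hSf s hsS).2, hle⟩
  rintro rfl
  have := R_pos (c := c) hr
  simp only [zero_div] at hle
  linarith

/-- The expected completion time of a block beats the bound given by `R`. -/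
theorem blockTime_mul_R_lt (hn : 2 ≤ n) {K : ℕ} (hK : 1 ≤ K) (x : Fin n → Bool) :
    c.blockTime x (fun _ => K) * c.R (((K : ℝ) + c.K₀) / Real.log n) < (K : ℝ) + c.K₀ := by
  have hlog : 0 < Real.log n := Real.log_pos (by exact_mod_cast hn)
  have hK0 : (1 : ℝ) ≤ K := by exact_mod_cast hK
  have hKK : (0 : ℝ) < (K : ℝ) + c.K₀ := by positivity
  have hr : 0 < ((K : ℝ) + c.K₀) / Real.log n := by positivity
  have hV := blockTime_nonneg (c := c) x fun _ => K
  set r := ((K : ℝ) + c.K₀) / Real.log n with hrdef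
  by_cases h : c.p01 = 1 ∧ c.R r ≤ 1 / 2
  · have h1 := blockTime_lt_of_p01_eq_one h.1 hK x
    have h2 := mul_le_mul_of_nonneg_left h.2 hV
    have : (0 : ℝ) ≤ c.K₀ := by positivity
    linarith
  · obtain ⟨s, hs0, hs, hle⟩ := exists_div_eq_R hr h
    have h1 := mul_blockTime_lt hs hs0.le hn K x
    have hΨ := logRet_nonneg hs hs0.le
    have hr' : 0 < 1 / r := by positivity
    refine (mul_le_mul_of_nonneg_left hle hV).trans_lt ?_
    rw [← mul_div_assoc, div_lt_iff₀ (by positivity), mul_comm]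
    have : ((K : ℝ) + c.K₀) * (c.logRet s + 1 / r) =
        Real.log n + (K + c.K₀) * c.logRet s := by
      rw [hrdef]
      field_simp
      ring
    rwa [this]

end GilbertElliott

namespace GilbertElliott

variable {c : GilbertElliott} {n : ℕ}

/-! ### Lower bounds for completion times -/

lemma timeMgf_mono {s t : ℝ} (ht : c.MgfFinite t) (h : s ≤ t) (x : Bool) (k : ℕ) :
    c.timeMgf s x k ≤ c.timeMgf t x k := by
  have h1 := retMgf_mono ht h
  have h2 := hitMgf_mono ht h
  have h3 := (retMgf_pos (ht.mono h)).le
  have h4 := (hitMgf_pos ht).le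
  rcases k with _ | k
  · simp [timeMgf]
  · cases x
    · exact mul_le_mul h2 (pow_le_pow_left₀ h3 h1 _) (by positivity) h4
    · exact pow_le_pow_left₀ h3 h1 _

/-- The mean of the pointwise bound e^{sT} ≤ e^{sN} + e^{-δN} e^{(s+δ)T}, according to whether T ≤ N
or T > N. -/
lemma timeMgf_le_exp_add {s δ : ℝ} (hs0 : 0 ≤ s) (hδ : 0 ≤ δ) (hs : c.MgfFinite (s + δ)) (N : ℕ) :
    ∀ x k, c.timeMgf s x k ≤
      Real.exp (s * N) + Real.exp (-(δ * N)) * c.timeMgf (s + δ) x k := by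
  have hss : c.MgfFinite s := hs.mono (by linarith)
  induction N with
  | zero =>
    intro x k
    have := timeMgf_mono hs (by linarith : s ≤ s + δ) x k
    simp only [Nat.cast_zero, mul_zero, neg_zero, Real.exp_zero, one_mul]
    linarith
  | succ N ih =>
    rintro x (_ | k)
    · have h1 : 1 ≤ Real.exp (s * (N + 1 : ℕ)) := Real.one_le_exp (by positivity)
      have h2 := Real.exp_pos (-(δ * (N + 1 : ℕ)))
      simp only [timeMgf]
      linarith
    · have h3 := trans_true_add_false (c := c) x
      have i1 := mul_le_mul_of_nonneg_left (ih true k) (trans_nonneg (c := c) x true)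
      have i2 := mul_le_mul_of_nonneg_left (ih false (k + 1)) (trans_nonneg (c := c) x false)
      have := mul_le_mul_of_nonneg_left (add_le_add i1 i2) (Real.exp_pos s).le
      rw [timeMgf_succ hss, timeMgf_succ hs]
      refine this.trans (le_of_eq ?_)
      have e1 : Real.exp (s * (N + 1 : ℕ)) = Real.exp s * Real.exp (s * N) := by
        rw [← Real.exp_add]; push_cast; ring_nf
      have e2 : Real.exp (-(δ * (N + 1 : ℕ))) * Real.exp (s + δ) =
          Real.exp s * Real.exp (-(δ * N)) := by
        rw [← Real.exp_add, ← Real.exp_add]; push_cast; ring_nf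
      rw [← mul_assoc (Real.exp (-(δ * (N + 1 : ℕ)))), e1, e2]
      linear_combination (Real.exp s * Real.exp (s * N)) * h3

/-- Splitting an exponential moment according to whether the time is at most `M`, lies between `M`
and `N`, or exceeds `N`. -/
lemma timeMgf_le_three {s δ : ℝ} (hs0 : 0 ≤ s) (hδ : 0 ≤ δ) (hs : c.MgfFinite (s + δ)) (M : ℕ) :
    ∀ N, M ≤ N → ∀ x k, c.timeMgf s x k ≤ Real.exp (δ * M) * c.timeMgf (s - δ) x k +
      Real.exp (s * N) * c.tail M x k + Real.exp (-(δ * N)) * c.timeMgf (s + δ) x k := by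
  have hss : c.MgfFinite s := hs.mono (by linarith)
  have hsd : c.MgfFinite (s - δ) := hs.mono (by linarith)
  induction M with
  | zero =>
    rintro N - x (_ | k)
    · have h2 := Real.exp_pos (-(δ * N))
      simp only [timeMgf, tail]
      simp only [Nat.cast_zero, mul_zero, Real.exp_zero, mul_one, add_zero, le_add_iff_nonneg_right]
      exact h2.le
    · have h1 := timeMgf_le_exp_add hs0 hδ hs N x (k + 1)
      have h2 := timeMgf_pos hsd x (k + 1)
      have h3 : 0 ≤ Real.exp (δ * (0 : ℕ)) * c.timeMgf (s - δ) x (k + 1) := by positivity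
      simp only [tail, mul_one]
      linarith
  | succ M ih =>
    rintro N hMN x k
    obtain ⟨N, rfl⟩ : ∃ N', N = N' + 1 := ⟨N - 1, by omega⟩
    rcases k with _ | k
    · have h1 : 1 ≤ Real.exp (δ * (M + 1 : ℕ)) := Real.one_le_exp (by positivity)
      have h2 := Real.exp_pos (-(δ * (N + 1 : ℕ)))
      simp only [timeMgf, tail, mul_one, mul_zero]
      linarith
    · have i1 := mul_le_mul_of_nonneg_left (ih N (by omega) true k)
        (trans_nonneg (c := c) x true)
      have i2 := mul_le_mul_of_nonneg_left (ih N (by omega) false (k + 1))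
        (trans_nonneg (c := c) x false)
      have := mul_le_mul_of_nonneg_left (add_le_add i1 i2) (Real.exp_pos s).le
      rw [timeMgf_succ hss, timeMgf_succ hs, timeMgf_succ hsd, tail]
      refine this.trans (le_of_eq ?_)
      have e1 : Real.exp (s * (N + 1 : ℕ)) = Real.exp s * Real.exp (s * N) := by
        rw [← Real.exp_add]; push_cast; ring_nf
      have e2 : Real.exp (-(δ * (N + 1 : ℕ))) * Real.exp (s + δ) =
          Real.exp s * Real.exp (-(δ * N)) := by
        rw [← Real.exp_add, ← Real.exp_add]; push_cast; ring_nf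
      have e3 : Real.exp (δ * (M + 1 : ℕ)) * Real.exp (s - δ) =
          Real.exp s * Real.exp (δ * M) := by
        rw [← Real.exp_add, ← Real.exp_add]; push_cast; ring_nf
      rw [← mul_assoc (Real.exp (-(δ * (N + 1 : ℕ)))), ← mul_assoc (Real.exp (δ * (M + 1 : ℕ))),
        e1, e2, e3]
      ring

/-- The initial state changes the exponential moment only by a factor independent of k; this and the
next bound make the large deviation estimate uniform in it. -/
lemma mul_pow_le_timeMgf {s : ℝ} (hs : c.MgfFinite s) (x : Bool) (k : ℕ) :
    min 1 (c.hitMgf s / c.retMgf s) * c.retMgf s ^ k ≤ c.timeMgf s x k := by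
  have h1 := retMgf_pos hs
  have h2 := hitMgf_pos hs
  rcases k with _ | k
  · simp [timeMgf]
  · cases x
    · refine (mul_le_mul_of_nonneg_right (min_le_right _ _) (by positivity)).trans (le_of_eq ?_)
      simp only [timeMgf, pow_succ]
      field_simp
    · refine (mul_le_mul_of_nonneg_right (min_le_left _ _) (by positivity)).trans (le_of_eq ?_)
      simp only [timeMgf, one_mul]

lemma timeMgf_le_mul_pow {s : ℝ} (hs : c.MgfFinite s) (x : Bool) (k : ℕ) :
    c.timeMgf s x k ≤ max 1 (c.hitMgf s / c.retMgf s) * c.retMgf s ^ k := by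
  have h1 := retMgf_pos hs
  have h2 := hitMgf_pos hs
  rcases k with _ | k
  · simp [timeMgf]
  · cases x
    · refine le_trans (le_of_eq ?_) (mul_le_mul_of_nonneg_right (le_max_right _ _) (by positivity))
      simp only [timeMgf, pow_succ]
      field_simp
    · refine le_trans (le_of_eq ?_) (mul_le_mul_of_nonneg_right (le_max_left _ _) (by positivity))
      simp only [timeMgf, one_mul]

/-- First-order expansion of Ψ at s on both sides. It makes the contributions of T below μ₁K and
above μ₂K exponentially smaller than e^{KΨ(s)}. -/
lemma exists_shift {s μ₁ μ₂ : ℝ} (hs : c.MgfFinite s) (h1 : μ₁ < deriv c.logRet s)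
    (h2 : deriv c.logRet s < μ₂) : ∃ δ, 0 < δ ∧ c.MgfFinite (s + δ) ∧
      c.logRet (s - δ) + δ * μ₁ < c.logRet s ∧ c.logRet (s + δ) - δ * μ₂ < c.logRet s := by
  have hd := hasDerivAt_logRet hs
  have hfin : ∀ᶠ δ in 𝓝[>] (0 : ℝ), c.MgfFinite (s + δ) := by
    have : Tendsto (fun δ : ℝ => s + δ) (𝓝[>] 0) (𝓝 s) := by
      have : Tendsto (fun δ : ℝ => s + δ) (𝓝 0) (𝓝 (s + 0)) :=
        (continuous_const.add continuous_id).tendsto 0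
      rw [add_zero] at this
      exact this.mono_left nhdsWithin_le_nhds
    exact this.eventually (isOpen_mgfFinite.mem_nhds hs)
  have hplus : ∀ᶠ δ in 𝓝[>] (0 : ℝ), c.logRet (s + δ) - δ * μ₂ < c.logRet s := by
    have h := (hasDerivAt_iff_tendsto_slope_zero.1 hd).mono_left
      (nhdsWithin_mono (0 : ℝ) fun x (hx : x ∈ Set.Ioi 0) => ne_of_gt hx)
    filter_upwards [h.eventually (gt_mem_nhds h2), self_mem_nhdsWithin] with δ hδ hδ0
    have hδ0' : (0 : ℝ) < δ := hδ0
    rw [smul_eq_mul, inv_mul_lt_iff₀ hδ0'] at hδ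
    linarith
  have hminus : ∀ᶠ δ in 𝓝[>] (0 : ℝ), c.logRet (s - δ) + δ * μ₁ < c.logRet s := by
    have hd' : HasDerivAt (fun δ => -c.logRet (s - δ)) (deriv c.logRet s) 0 := by
      have hd0 : HasDerivAt c.logRet (deriv c.logRet s) (s - 0) := by rwa [sub_zero]
      have := (hd0.comp 0 ((hasDerivAt_id (0 : ℝ)).const_sub s)).neg
      rwa [mul_neg, mul_one, neg_neg] at this
    have h := (hasDerivAt_iff_tendsto_slope_zero.1 hd').mono_left
      (nhdsWithin_mono (0 : ℝ) fun x (hx : x ∈ Set.Ioi 0) => ne_of_gt hx)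
    filter_upwards [h.eventually (lt_mem_nhds h1), self_mem_nhdsWithin] with δ hδ hδ0
    have hδ0' : (0 : ℝ) < δ := hδ0
    rw [smul_eq_mul, lt_inv_mul_iff₀ hδ0'] at hδ
    simp only [zero_add, sub_zero] at hδ
    linarith
  obtain ⟨δ, ⟨⟨⟨a, b⟩, d⟩, e⟩⟩ := ((hfin.and hplus).and hminus).and self_mem_nhdsWithin |>.exists
  exact ⟨δ, e, a, d, b⟩

/-- A large deviation lower bound for the number of received symbols. -/
lemma exists_le_tail {s μ₁ μ₂ : ℝ} (hs0 : 0 ≤ s) (hs : c.MgfFinite s) (hμ : 0 ≤ μ₁)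
    (h1 : μ₁ < deriv c.logRet s) (h2 : deriv c.logRet s < μ₂) :
    ∃ C, 0 < C ∧ ∀ᶠ K : ℕ in atTop, ∀ x,
      C * Real.exp (K * (c.logRet s - s * μ₂)) ≤ c.tail ⌊μ₁ * K⌋₊ x K := by
  obtain ⟨δ, hδ, hsδ, hm, hp⟩ := exists_shift hs h1 h2
  have hsd : c.MgfFinite (s - δ) := hs.mono (by linarith)
  have hφ := retMgf_pos hs
  set A := min 1 (c.hitMgf s / c.retMgf s) with hA
  have hA0 : 0 < A := lt_min one_pos (div_pos (hitMgf_pos hs) hφ)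
  set B₁ := max 1 (c.hitMgf (s - δ) / c.retMgf (s - δ)) with hB1
  set B₂ := max 1 (c.hitMgf (s + δ) / c.retMgf (s + δ)) with hB2
  have hB1' : 0 < B₁ := lt_max_of_lt_left one_pos
  have hB2' : 0 < B₂ := lt_max_of_lt_left one_pos
  set q₁ := Real.exp (c.logRet (s - δ) + δ * μ₁ - c.logRet s) with hq1
  set q₂ := Real.exp (c.logRet (s + δ) - δ * μ₂ - c.logRet s) with hq2
  have hq1' : q₁ < 1 := Real.exp_lt_one_iff.2 (by linarith)
  have hq2' : q₂ < 1 := Real.exp_lt_one_iff.2 (by linarith)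
  have hlim : Tendsto (fun K : ℕ => B₁ * q₁ ^ K + B₂ * q₂ ^ K) atTop (𝓝 0) := by
    have := ((tendsto_pow_atTop_nhds_zero_of_lt_one (Real.exp_pos _).le hq1').const_mul B₁).add
      ((tendsto_pow_atTop_nhds_zero_of_lt_one (Real.exp_pos _).le hq2').const_mul B₂)
    simpa using this
  -- The outer two of the three terms take up at most half of A e^{KΨ(s)}; the factor e^{-s} pays
  -- for rounding μ₂K up to N.
  refine ⟨A / 2 * Real.exp (-s), by positivity, ?_⟩
  filter_upwards [hlim.eventually (gt_mem_nhds (half_pos hA0))] with K hK x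
  set M := ⌊μ₁ * K⌋₊ with hM
  set N := ⌈μ₂ * K⌉₊ with hN
  have hμ2 : 0 ≤ μ₂ := by linarith
  have hMle : (M : ℝ) ≤ μ₁ * K := Nat.floor_le (by positivity)
  have hNge : μ₂ * K ≤ N := Nat.le_ceil _
  have hNle : (N : ℝ) ≤ μ₂ * K + 1 := (Nat.ceil_lt_add_one (by positivity)).le
  have hMN : M ≤ N := by
    have : μ₁ * K ≤ μ₂ * K := mul_le_mul_of_nonneg_right (by linarith) (by positivity)
    exact_mod_cast hMle.trans (this.trans hNge)
  have key := timeMgf_le_three hs0 hδ.le hsδ M N hMN x K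
  have k0 := mul_pow_le_timeMgf hs x K
  have k1 := timeMgf_le_mul_pow hsd x K
  have k2 := timeMgf_le_mul_pow hsδ x K
  have hu := tail_nonneg (c := c) M x K
  set P := c.retMgf s ^ K with hP
  have hP0 : 0 < P := pow_pos hφ K
  have t1 : Real.exp (δ * M) * c.timeMgf (s - δ) x K ≤ B₁ * q₁ ^ K * P := by
    have e : q₁ ^ K * P = Real.exp (δ * (μ₁ * K)) * c.retMgf (s - δ) ^ K := by
      rw [hP, hq1, ← exp_logRet hs, ← exp_logRet hsd, ← Real.exp_nat_mul, ← Real.exp_nat_mul,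
        ← Real.exp_nat_mul, ← Real.exp_add, ← Real.exp_add]
      ring_nf
    rw [mul_assoc, e]
    calc _ ≤ Real.exp (δ * (μ₁ * K)) * (B₁ * c.retMgf (s - δ) ^ K) :=
          mul_le_mul (Real.exp_le_exp.2 (mul_le_mul_of_nonneg_left hMle hδ.le)) k1
            (timeMgf_pos hsd x K).le (Real.exp_pos _).le
      _ = _ := by ring
  have t2 : Real.exp (-(δ * N)) * c.timeMgf (s + δ) x K ≤ B₂ * q₂ ^ K * P := by
    have e : q₂ ^ K * P = Real.exp (-(δ * (μ₂ * K))) * c.retMgf (s + δ) ^ K := by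
      rw [hP, hq2, ← exp_logRet hs, ← exp_logRet hsδ, ← Real.exp_nat_mul, ← Real.exp_nat_mul,
        ← Real.exp_nat_mul, ← Real.exp_add, ← Real.exp_add]
      ring_nf
    rw [mul_assoc, e]
    calc _ ≤ Real.exp (-(δ * (μ₂ * K))) * (B₂ * c.retMgf (s + δ) ^ K) :=
          mul_le_mul (Real.exp_le_exp.2 (neg_le_neg (mul_le_mul_of_nonneg_left hNge hδ.le))) k2
            (timeMgf_pos hsδ x K).le (Real.exp_pos _).le
      _ = _ := by ring
  have t3 : Real.exp (s * N) * c.tail M x K ≤ Real.exp (s * (μ₂ * K + 1)) * c.tail M x K :=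
    mul_le_mul_of_nonneg_right (Real.exp_le_exp.2 (mul_le_mul_of_nonneg_left hNle hs0)) hu
  have hmain : A / 2 * P ≤ Real.exp (s * (μ₂ * K + 1)) * c.tail M x K := by
    have := mul_le_mul_of_nonneg_right hK.le hP0.le
    linarith
  have e4 : A / 2 * Real.exp (-s) * Real.exp (K * (c.logRet s - s * μ₂)) =
      Real.exp (-(s * (μ₂ * K + 1))) * (A / 2 * P) := by
    have : Real.exp (-s) * Real.exp (K * (c.logRet s - s * μ₂)) =
        Real.exp (-(s * (μ₂ * K + 1))) * P := by
      rw [hP, ← exp_logRet hs, ← Real.exp_nat_mul, ← Real.exp_add, ← Real.exp_add]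
      ring_nf
    rw [mul_assoc, this]
    ring
  rw [e4]
  calc _ ≤ Real.exp (-(s * (μ₂ * K + 1))) * (Real.exp (s * (μ₂ * K + 1)) * c.tail M x K) :=
        mul_le_mul_of_nonneg_left hmain (Real.exp_pos _).le
    _ = c.tail M x K := by
        rw [← mul_assoc, ← Real.exp_add]
        simp

/-- The condition on the left says that T exceeds K/β at exponent s; the last one, that n receivers
suffice to see this deviation when log n ≈ K/r. The proof is by contradiction and does not use a
maximiser of s/(Ψ(s) + 1/r), which need not exist. -/
lemma exists_exponent {r β : ℝ} (hr : 0 < r) (hβ : c.R r < β) :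
    ∃ s, 0 < s ∧ c.MgfFinite s ∧ 1 / β < deriv c.logRet s ∧
      0 < c.logRet s + 1 / r - s * deriv c.logRet s := by
  have hR := R_pos (c := c) hr
  have hβ0 : 0 < β := hR.trans hβ
  have hr' : 0 < 1 / r := by positivity
  by_contra! hcon
  set d := 1 / r * (1 - c.R r / β) with hd
  have hd1 : c.R r / β < 1 := (div_lt_one hβ0).2 hβ
  have hd0 : 0 < d := mul_pos hr' (by linarith)
  have hdr : d ≤ 1 / r := mul_le_of_le_one_right hr'.le (by have := div_pos hR hβ0; linarith)
  -- D is the numerator of the derivative of s/(Ψ(s) + 1/r).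
  set D : ℝ → ℝ := fun s => c.logRet s + 1 / r - s * deriv c.logRet s with hD
  -- Where D > 0, the assumption gives Ψ' ≤ 1/β, and s ≤ R(r)(Ψ + 1/r) then yields D ≥ (1 -
  -- R(r)/β)(Ψ + 1/r) ≥ d.
  have hgap : ∀ s, 0 < s → c.MgfFinite s → 0 < D s → d ≤ D s := by
    intro s hs0 hs hDs
    have h1 : deriv c.logRet s ≤ 1 / β := by
      by_contra! h
      exact absurd (hcon s hs0 hs h) (not_le.2 hDs)
    have hΨ := logRet_nonneg hs hs0.le
    have h2 := div_le_R hr hs0.le hs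
    rw [div_le_iff₀ (by positivity)] at h2
    have h3 : s * deriv c.logRet s ≤ c.R r / β * (c.logRet s + 1 / r) := by
      calc s * deriv c.logRet s ≤ s * (1 / β) := mul_le_mul_of_nonneg_left h1 hs0.le
        _ ≤ c.R r * (c.logRet s + 1 / r) * (1 / β) :=
            mul_le_mul_of_nonneg_right h2 (by positivity)
        _ = _ := by ring
    have h4 : 0 ≤ (1 - c.R r / β) * c.logRet s := mul_nonneg (by linarith) hΨ
    simp only [hD, hd]
    linarith
  -- D starts at 1/r ≥ d and omits the values strictly between 0 and d, so by continuity it never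
  -- reaches 0.
  have hpos : ∀ s, 0 < s → c.MgfFinite s → 0 < D s := by
    intro s hs0 hs
    by_contra! hneg
    have hsub : Set.Icc 0 s ⊆ {s | c.MgfFinite s} := fun t ht => hs.mono ht.2
    have hcont : ContinuousOn D (Set.Icc 0 s) := by
      have h1 : ContinuousOn c.logRet (Set.Icc 0 s) := fun t ht =>
        (contDiffAt_logRet (hsub ht)).continuousAt.continuousWithinAt
      exact (h1.add continuousOn_const).sub
        (continuousOn_id.mul (continuousOn_deriv_logRet.mono hsub))
    have hD0 : D 0 = 1 / r := by simp [hD, logRet_zero]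
    obtain ⟨t, ht, htd⟩ := intermediate_value_Icc' hs0.le hcont
      (show d / 2 ∈ Set.Icc (D s) (D 0) from ⟨by linarith, by rw [hD0]; linarith⟩)
    have ht0 : 0 < t := by
      refine ht.1.lt_of_ne ?_
      rintro rfl
      rw [hD0] at htd
      linarith
    have := hgap t ht0 (hsub ht) (by rw [htd]; linarith)
    linarith
  have hder : ∀ s, 0 < s → c.MgfFinite s → deriv c.logRet s ≤ 1 / β := by
    intro s hs0 hs
    by_contra! h
    exact absurd (hcon s hs0 hs h) (not_le.2 (hpos s hs0 hs))
  have hle : ∀ s, 0 < s → c.MgfFinite s → c.logRet s ≤ s / β := by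
    intro s hs0 hs
    have h := (convex_Icc 0 s).image_sub_le_mul_sub_of_deriv_le (f := c.logRet) (C := 1 / β)
      (fun t ht => (contDiffAt_logRet (hs.mono ht.2)).continuousAt.continuousWithinAt)
      (fun t ht => by
        rw [interior_Icc] at ht
        exact (hasDerivAt_logRet (hs.mono ht.2.le)).differentiableAt.differentiableWithinAt)
      (fun t ht => by
        rw [interior_Icc] at ht
        exact hder t ht.1 (hs.mono ht.2.le))
      0 ⟨le_rfl, hs0.le⟩ s ⟨hs0.le, le_rfl⟩ hs0.le
    rw [logRet_zero] at h
    have e : s / β = 1 / β * (s - 0) := by ring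
    linarith
  -- The bound Ψ(s) ≤ s/β is now contradicted: for p01 = 1 it lets s/(Ψ + 1/r) come close to β >
  -- R(r) for large s, and for p01 < 1 it denies the blow-up of Ψ at B.
  by_cases hp : c.p01 = 1
  · have hfin : ∀ s, c.MgfFinite s := fun s => by simp [MgfFinite, hp]
    obtain ⟨b, hb, hbβ⟩ := exists_between hβ
    have hb0 : 0 < b := hR.trans hb
    -- Large enough that s/(s/β + 1/r) > b, where R(r) < b < β.
    set s := b / r / (1 - b / β) + 1 with hs
    have h1 : 0 < 1 - b / β := sub_pos.2 ((div_lt_one hβ0).2 hbβ)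
    have hs0 : 0 < s := by positivity
    have h2 := div_le_R hr hs0.le (hfin s)
    have h3 := hle s hs0 (hfin s)
    have hΨ := logRet_nonneg (hfin s) hs0.le
    rw [div_le_iff₀ (by positivity)] at h2
    have h4 : c.R r * (c.logRet s + 1 / r) ≤ b * (s / β + 1 / r) :=
      mul_le_mul hb.le (by linarith) (by positivity) hb0.le
    have h5 : b / r < s * (1 - b / β) := by
      rw [hs, add_mul, div_mul_cancel₀ _ h1.ne']
      linarith
    have h6 : b * (s / β + 1 / r) = s * (b / β) + b / r := by ring
    linarith
  · have hp1 : 0 < 1 - c.p01 := sub_pos.2 (lt_of_le_of_ne c.p01_le_one hp)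
    have hp0 := c.p01_pos
    have hq0 := c.p10_pos
    set B := -Real.log (1 - c.p01) with hB
    have hB0 : 0 < B := neg_pos.2 (Real.log_neg hp1 (by linarith))
    have hexpB : (1 - c.p01) * Real.exp B = 1 := by
      rw [hB, Real.exp_neg, Real.exp_log hp1, mul_inv_cancel₀ hp1.ne']
    have hlim : Tendsto (fun s => Real.exp (B / β) * (1 - (1 - c.p01) * Real.exp s)) (𝓝[<] B)
        (𝓝 (Real.exp (B / β) * (1 - (1 - c.p01) * Real.exp B))) := by
      have : Continuous fun s => Real.exp (B / β) * (1 - (1 - c.p01) * Real.exp s) := by fun_prop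
      exact (this.tendsto B).mono_left nhdsWithin_le_nhds
    rw [hexpB, sub_self, mul_zero] at hlim
    have hge : c.p10 * c.p01 ≤ 0 := by
      refine ge_of_tendsto hlim ?_
      filter_upwards [Ioo_mem_nhdsLT hB0] with s hs
      have hsf : c.MgfFinite s := by
        refine lt_of_lt_of_eq ?_ hexpB
        exact mul_lt_mul_of_pos_left (Real.exp_lt_exp.2 hs.2) hp1
      have hsf' : (1 - c.p01) * Real.exp s < 1 := hsf
      refine (mul_one_sub_ge hsf hs.1.le).trans ?_
      refine mul_le_mul_of_nonneg_right (Real.exp_le_exp.2 ?_) (by linarith)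
      exact (hle s hs.1 hsf).trans (div_le_div_of_nonneg_right hs.2.le hβ0.le)
    have : 0 < c.p10 * c.p01 := by positivity
    linarith

lemma one_sub_exp_le_blockTail {p : ℝ} (t K : ℕ) (x : Fin n → Bool)
    (hp : ∀ b, p ≤ c.tail t b K) : 1 - Real.exp (-(n * p)) ≤ c.blockTail t x fun _ => K := by
  refine sub_le_sub_left ?_ 1
  calc ∏ i, (1 - c.tail t (x i) K) ≤ ∏ _i : Fin n, Real.exp (-p) := by
        refine Finset.prod_le_prod (fun i _ => sub_nonneg.2 (tail_le_one _ _ _)) fun i _ => ?_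
        have := Real.add_one_le_exp (-p)
        have := hp (x i)
        linarith
    _ = Real.exp (-(n * p)) := by
        rw [Finset.prod_const, Finset.card_univ, Fintype.card_fin, ← Real.exp_nat_mul]
        ring_nf

/-- Asymptotically, expected completion times are at least `K / β` for every `β > R r`. -/
theorem eventually_le_blockTime {r β : ℝ} (hr : 0 < r) (hβ : c.R r < β) {K : ℕ → ℕ}
    (hK : Tendsto (fun n : ℕ => (K n : ℝ) / Real.log n) atTop (𝓝 r)) :
    ∀ᶠ n : ℕ in atTop, ∀ x : Fin n → Bool, (K n : ℝ) / β ≤ c.blockTime x fun _ => K n := by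
  have hβ0 : 0 < β := (R_pos (c := c) hr).trans hβ
  obtain ⟨s, hs0, hs, h1, h2⟩ := exists_exponent hr hβ
  obtain ⟨μ₁, hμ1, hμ1'⟩ := exists_between h1
  obtain ⟨μ₂, hμ2, hμ2'⟩ : ∃ μ₂, deriv c.logRet s < μ₂ ∧ 0 < c.logRet s + 1 / r - s * μ₂ := by
    have : deriv c.logRet s < (c.logRet s + 1 / r) / s := by
      rw [lt_div_iff₀ hs0]
      linarith
    obtain ⟨μ, h3, h4⟩ := exists_between this
    rw [lt_div_iff₀ hs0] at h4
    exact ⟨μ, h3, by linarith⟩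
  have hμ0 : 0 < μ₁ := lt_trans (by positivity) hμ1
  obtain ⟨C, hC, hev⟩ := exists_le_tail hs0.le hs hμ0.le hμ1' hμ2
  set ε := c.logRet s + 1 / r - s * μ₂ with hε
  have hlog : Tendsto (fun n : ℕ => Real.log n) atTop atTop :=
    Real.tendsto_log_atTop.comp tendsto_natCast_atTop_atTop
  have hKtop : Tendsto (fun n : ℕ => (K n : ℝ)) atTop atTop := by
    have := hK.pos_mul_atTop hr hlog
    refine this.congr' ?_
    filter_upwards [hlog.eventually_gt_atTop 0] with n hn
    field_simp
  have hKnat : Tendsto K atTop atTop := tendsto_natCast_atTop_iff.1 hKtop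
  have hinv : Tendsto (fun n : ℕ => Real.log n / (K n : ℝ)) atTop (𝓝 (1 / r)) := by
    have := hK.inv₀ hr.ne'
    simpa only [inv_div, one_div] using this
  -- The 1/K absorbs the floor in ⌊μ₁K⌋. The limit μ₁ exceeds 1/β, which leaves room for the error
  -- terms.
  have hlim : Tendsto (fun n : ℕ => (μ₁ - 1 / (K n : ℝ)) *
      (1 - Real.exp (-(C * Real.exp (K n * (ε / 2)))))) atTop (𝓝 ((μ₁ - 0) * (1 - 0))) := by
    refine Tendsto.mul (tendsto_const_nhds.sub ?_) (tendsto_const_nhds.sub ?_)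
    · simp only [one_div]
      exact tendsto_inv_atTop_zero.comp hKtop
    · refine Real.tendsto_exp_neg_atTop_nhds_zero.comp (Tendsto.const_mul_atTop hC ?_)
      exact Real.tendsto_exp_atTop.comp (hKtop.atTop_mul_const (half_pos hμ2'))
  rw [sub_zero, sub_zero, mul_one] at hlim
  filter_upwards [hKnat.eventually hev, hKtop.eventually_gt_atTop 0, eventually_gt_atTop 0,
    hinv.eventually (lt_mem_nhds (show 1 / r - ε / 2 < 1 / r by linarith)),
    hlim.eventually (lt_mem_nhds hμ1)] with n htail hK0 hn0 hlogn hfin x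
  have hn0' : (0 : ℝ) < n := by exact_mod_cast hn0
  set b := 1 - Real.exp (-(C * Real.exp (K n * (ε / 2)))) with hb
  have hb0 : 0 ≤ b := by
    rw [hb, sub_nonneg, Real.exp_le_one_iff, neg_nonpos]
    positivity
  rw [lt_div_iff₀ hK0] at hlogn
  -- Eventually log n > K(1/r - ε/2), so n times the one-receiver tail is at least C e^{Kε/2}.
  have hbt : b ≤ c.blockTail ⌊μ₁ * K n⌋₊ x fun _ => K n := by
    refine le_trans (sub_le_sub_left (Real.exp_le_exp.2 (neg_le_neg ?_)) 1)
      (one_sub_exp_le_blockTail _ _ x htail)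
    rw [mul_left_comm]
    refine mul_le_mul_of_nonneg_left ?_ hC.le
    rw [show (n : ℝ) * _ = Real.exp (Real.log n) * _ by rw [Real.exp_log hn0']]
    rw [← Real.exp_add]
    refine Real.exp_le_exp.2 ?_
    rw [hε] at hlogn ⊢
    linarith
  have hfl : μ₁ * K n - 1 ≤ (⌊μ₁ * K n⌋₊ : ℝ) := (Nat.sub_one_lt_floor _).le
  calc (K n : ℝ) / β = K n * (1 / β) := by ring
    _ ≤ K n * ((μ₁ - 1 / (K n : ℝ)) * b) := mul_le_mul_of_nonneg_left hfin.le hK0.le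
    _ = (μ₁ * K n - 1) * b := by
        have : (K n : ℝ) * (μ₁ - 1 / (K n : ℝ)) = μ₁ * K n - 1 := by field_simp
        rw [← mul_assoc, this]
    _ ≤ (⌊μ₁ * K n⌋₊ : ℝ) * b := mul_le_mul_of_nonneg_right hfl hb0
    _ ≤ (⌊μ₁ * K n⌋₊ : ℝ) * c.blockTail ⌊μ₁ * K n⌋₊ x (fun _ => K n) :=
        mul_le_mul_of_nonneg_left hbt (Nat.cast_nonneg _)
    _ ≤ _ := mul_blockTail_le_blockTime _ _ _

end GilbertElliott

/-! ### Poisson's equation for finite Markov chains -/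

/-- A finite Markov chain is given by transition weights `w s y` and a successor function `next`.
If some state can be reached from every state, then Poisson's equation is solvable. -/
theorem exists_poisson {S Y : Type*} [Finite S] [Fintype Y] (w : S → Y → ℝ) (next : S → Y → S)
    (hw : ∀ s y, 0 ≤ w s y) (hsum : ∀ s, ∑ y, w s y = 1) (s₀ : S)
    (hreach : ∀ s, Relation.ReflTransGen (fun a b => ∃ y, 0 < w a y ∧ next a y = b) s s₀)
    (f : S → ℝ) : ∃ (η : ℝ) (h : S → ℝ), ∀ s, f s = η + h s - ∑ y, w s y * h (next s y) := by
  have : Nonempty S := ⟨s₀⟩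
  have hmax : ∀ (h : S → ℝ) (a : S), (∀ s, h s ≤ h a) →
      (∀ s, h s = ∑ y, w s y * h (next s y)) → h s₀ = h a := by
    intro h a ha hh
    have key : ∀ s, Relation.ReflTransGen (fun a b => ∃ y, 0 < w a y ∧ next a y = b) a s →
        h s = h a := by
      intro s hs
      induction hs with
      | refl => rfl
      | @tail b d _ hstep ih =>
        obtain ⟨y, hy, rfl⟩ := hstep
        have h1 : ∑ y, w b y * (h a - h (next b y)) = 0 := by
          simp only [mul_sub, Finset.sum_sub_distrib, ← Finset.sum_mul, hsum, one_mul]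
          rw [← hh b, ih, sub_self]
        rw [Finset.sum_eq_zero_iff_of_nonneg
          fun y _ => mul_nonneg (hw b y) (sub_nonneg.2 (ha _))] at h1
        have := h1 y (Finset.mem_univ y)
        rcases mul_eq_zero.1 this with h' | h'
        · exact absurd h' hy.ne'
        · linarith
    exact key s₀ (hreach a)
  -- Adding evaluation at s₀ removes the constants from the kernel of I - P; an injective
  -- endomorphism in finite dimension is onto, and h s₀ becomes η.
  let P : (S → ℝ) →ₗ[ℝ] (S → ℝ) :=
    { toFun := fun h s => h s - ∑ y, w s y * h (next s y) + h s₀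
      map_add' := fun h g => by
        funext s
        simp only [Pi.add_apply, mul_add, Finset.sum_add_distrib]
        ring
      map_smul' := fun r h => by
        funext s
        simp only [Pi.smul_apply, smul_eq_mul, RingHom.id_apply, mul_add, mul_sub, Finset.mul_sum]
        congr 2
        exact Finset.sum_congr rfl fun y _ => by ring }
  have hinj : Function.Injective P := by
    rw [← LinearMap.ker_eq_bot, LinearMap.ker_eq_bot']
    intro h hP
    have hP' : ∀ s, h s - ∑ y, w s y * h (next s y) + h s₀ = 0 := fun s => congrFun hP s
    obtain ⟨a, ha⟩ := Finite.exists_max h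
    obtain ⟨b, hb⟩ := Finite.exists_min h
    have h1 : ∑ y, w a y * h (next a y) ≤ h a := by
      calc _ ≤ ∑ y, w a y * h a :=
            Finset.sum_le_sum fun y _ => mul_le_mul_of_nonneg_left (ha _) (hw a y)
        _ = h a := by rw [← Finset.sum_mul, hsum, one_mul]
    have h2 : h b ≤ ∑ y, w b y * h (next b y) := by
      calc h b = ∑ y, w b y * h b := by rw [← Finset.sum_mul, hsum, one_mul]
        _ ≤ _ := Finset.sum_le_sum fun y _ => mul_le_mul_of_nonneg_left (hb _) (hw b y)
    -- At a maximum of h the equation gives h s₀ ≤ 0, at a minimum h s₀ ≥ 0. So h is harmonic, and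
    -- its extreme values propagate to s₀.
    have h0 : h s₀ = 0 := by
      have := hP' a
      have := hP' b
      linarith
    have hharm : ∀ s, h s = ∑ y, w s y * h (next s y) := fun s => by
      have := hP' s
      linarith
    have e1 := hmax h a ha hharm
    have e2 := hmax (fun s => -h s) b (fun s => neg_le_neg (hb s)) fun s => by
      simp only [mul_neg, Finset.sum_neg_distrib]
      rw [← hharm s]
    funext s
    have := ha s
    have := hb s
    simp only [Pi.zero_apply]
    linarith
  obtain ⟨h, hh⟩ := LinearMap.injective_iff_surjective.1 hinj f
  refine ⟨h s₀, h, fun s => ?_⟩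
  rw [← hh]
  change h s - ∑ y, w s y * h (next s y) + h s₀ = _
  ring

namespace GilbertElliott

variable {c : GilbertElliott} {n K : ℕ}

/-! ### The Markov chain of channel states and remaining receptions -/

/-- After the next slot, with channel state `y`, no receptions remain. -/
def BlockDone (k : Fin n → Fin (K + 1)) (y : Fin n → Bool) : Prop :=
  ∀ i, (k i : ℕ) - (if y i then 1 else 0) = 0

open scoped Classical in
/-- The remaining receptions after a slot with channel state `y`; a completed block is followed by
a new one. -/
def nextRemaining (k : Fin n → Fin (K + 1)) (y : Fin n → Bool) : Fin n → Fin (K + 1) :=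
  if BlockDone k y then fun _ => Fin.last K
  else fun i => ⟨k i - if y i then 1 else 0, lt_of_le_of_lt (Nat.sub_le _ _) (k i).2⟩

/-- The successor of a state when the next channel state is `y`. -/
def nextState (s : (Fin n → Bool) × (Fin n → Fin (K + 1))) (y : Fin n → Bool) :
    (Fin n → Bool) × (Fin n → Fin (K + 1)) :=
  (y, nextRemaining s.2 y)

lemma nextRemaining_of_done {k : Fin n → Fin (K + 1)} {y : Fin n → Bool} (h : BlockDone k y) :
    nextRemaining k y = fun _ => Fin.last K := if_pos h

lemma nextRemaining_apply_of_not_done {k : Fin n → Fin (K + 1)} {y : Fin n → Bool}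
    (h : ¬ BlockDone k y) (i : Fin n) :
    (nextRemaining k y i : ℕ) = k i - if y i then 1 else 0 := by
  rw [nextRemaining, if_neg h]

variable (c) in
/-- One-step accessibility. -/
def StepTo (a b : (Fin n → Bool) × (Fin n → Fin (K + 1))) : Prop :=
  ∃ y, 0 < c.weight a.1 y ∧ nextState a y = b

lemma weight_pos {x y : Fin n → Bool} (h : ∀ i, 0 < c.trans (x i) (y i)) : 0 < c.weight x y :=
  Finset.prod_pos fun i _ => h i

lemma reach_of_p10_lt_one (h : c.p10 < 1) (j : ℕ) :
    ∀ s : (Fin n → Bool) × (Fin n → Fin (K + 1)), (∀ i, (s.2 i : ℕ) ≤ j) →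
      Relation.ReflTransGen (c.StepTo) s (fun _ => true, fun _ => Fin.last K) := by
  have htr : ∀ b, 0 < c.trans b true := by
    have := c.p01_pos
    rintro (_ | _) <;> simp only [trans] <;> linarith
  induction j with
  | zero =>
    intro s hs
    refine Relation.ReflTransGen.single ⟨fun _ => true, weight_pos fun i => htr _, ?_⟩
    have : BlockDone s.2 fun _ => true := fun i => by have := hs i; omega
    rw [nextState, nextRemaining_of_done this]
  | succ j ih =>
    intro s hs
    have hstep : c.StepTo s (nextState s fun _ => true) :=
      ⟨fun _ => true, weight_pos fun i => htr _, rfl⟩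
    refine Relation.ReflTransGen.head hstep ?_
    by_cases hd : BlockDone s.2 fun _ => true
    · rw [nextState, nextRemaining_of_done hd]
    · refine ih _ fun i => ?_
      rw [nextState]
      simp only
      rw [nextRemaining_apply_of_not_done hd]
      have := hs i
      simp only [if_true]
      omega

/-- When state 1 may be impossible to keep (p10 = 1), the path alternates between all received and
all erased; every second slot lowers the remaining counts. -/
lemma reach_of_p01_lt_one (h : c.p01 < 1) (j : ℕ) :
    ∀ k : Fin n → Fin (K + 1), (∀ i, (k i : ℕ) ≤ j) →
      Relation.ReflTransGen (c.StepTo) (fun _ => false, k) (fun _ => true, fun _ => Fin.last K) := by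
  have htr : ∀ b, 0 < c.trans b false := by
    have := c.p10_pos
    rintro (_ | _) <;> simp only [trans] <;> linarith
  induction j with
  | zero =>
    intro k hk
    refine Relation.ReflTransGen.single ⟨fun _ => true, weight_pos fun i => c.p01_pos, ?_⟩
    have : BlockDone k fun _ => true := fun i => by have := hk i; omega
    rw [nextState, nextRemaining_of_done this]
  | succ j ih =>
    intro k hk
    have hstep : c.StepTo (fun _ => false, k) (fun _ => true, nextRemaining k fun _ => true) :=
      ⟨fun _ => true, weight_pos fun i => c.p01_pos, rfl⟩
    refine Relation.ReflTransGen.head hstep ?_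
    by_cases hd : BlockDone k fun _ => true
    · rw [nextRemaining_of_done hd]
    · set k' := nextRemaining k fun _ => true with hk'
      have hk1 : ∀ i, (k' i : ℕ) = k i - 1 := fun i => by
        rw [hk', nextRemaining_apply_of_not_done hd]; simp
      have hd' : ¬ BlockDone k' fun _ => false := by
        intro hd'
        apply hd
        intro i
        have := hd' i
        rw [hk1] at this
        simpa using this
      have hstep' : c.StepTo (fun _ => true, k') (fun _ => false, k') := by
        refine ⟨fun _ => false, weight_pos fun i => htr _, ?_⟩
        refine Prod.ext rfl (funext fun i => Fin.ext ?_)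
        simp only [nextState]
        rw [nextRemaining_apply_of_not_done hd']
        simp
      refine Relation.ReflTransGen.head hstep' (ih k' fun i => ?_)
      have := hk i
      rw [hk1]
      omega

lemma reach (s : (Fin n → Bool) × (Fin n → Fin (K + 1))) :
    Relation.ReflTransGen (c.StepTo) s (fun _ => true, fun _ => Fin.last K) := by
  rcases lt_or_eq_of_le c.p10_le_one with h | h
  · exact reach_of_p10_lt_one h K s fun i => Nat.lt_succ_iff.1 (s.2 i).2
  · have h' : c.p01 < 1 := lt_of_le_of_ne c.p01_le_one fun h' => c.aperiodic ⟨h', h⟩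
    have hstep : c.StepTo s (fun _ => false, nextRemaining s.2 fun _ => false) := by
      refine ⟨fun _ => false, weight_pos fun i => ?_, rfl⟩
      have := c.p10_pos
      cases s.1 i <;> simp only [trans] <;> linarith
    exact Relation.ReflTransGen.head hstep
      (reach_of_p01_lt_one h' K _ fun i => Nat.lt_succ_iff.1 (Fin.is_lt _))

open scoped Classical in
/-- The indicator of the completion of a block. -/
def doneInd (k : Fin n → Fin (K + 1)) (y : Fin n → Bool) : ℝ := if BlockDone k y then 1 else 0

variable (c) in
/-- The expected time until the current block is completed, at least one slot. -/
def remTime (s : (Fin n → Bool) × (Fin n → Fin (K + 1))) : ℝ :=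
  1 + ∑ y, c.weight s.1 y * c.blockTime y fun i => (s.2 i : ℕ) - if y i then 1 else 0

lemma remTime_nonneg (s : (Fin n → Bool) × (Fin n → Fin (K + 1))) : 0 ≤ c.remTime s :=
  add_nonneg zero_le_one
    (Finset.sum_nonneg fun _ _ => mul_nonneg (weight_nonneg _ _) (blockTime_nonneg _ _))

lemma remTime_of_exists {s : (Fin n → Bool) × (Fin n → Fin (K + 1))} (h : ∃ i, (s.2 i : ℕ) ≠ 0) :
    c.remTime s = c.blockTime s.1 fun i => (s.2 i : ℕ) :=
  (blockTime_of_exists h).symm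

lemma remTime_last (hn : 1 ≤ n) (hK : 1 ≤ K) (x : Fin n → Bool) :
    c.remTime (x, fun _ => Fin.last K) = c.blockTime x fun _ => K :=
  remTime_of_exists ⟨⟨0, hn⟩, by simp only [Fin.val_last]; omega⟩

/-- First-step analysis. Since the chain restarts at a completion, the fresh block's expected time
is subtracted there. -/
lemma remTime_eq (hn : 1 ≤ n) (hK : 1 ≤ K) (s : (Fin n → Bool) × (Fin n → Fin (K + 1))) :
    c.remTime s = 1 + ∑ y, c.weight s.1 y * (c.remTime (nextState s y) -
      doneInd s.2 y * c.blockTime y fun _ => K) := by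
  rw [remTime]
  congr 1
  refine Finset.sum_congr rfl fun y _ => ?_
  congr 1
  by_cases hd : BlockDone s.2 y
  · rw [blockTime_of_forall hd, nextState, nextRemaining_of_done hd, remTime_last hn hK, doneInd,
      if_pos hd]
    ring
  · have hne : ∃ i, ((nextState s y).2 i : ℕ) ≠ 0 := by
      by_contra! hcon
      refine hd fun i => ?_
      have := hcon i
      rwa [nextState, nextRemaining_apply_of_not_done hd] at this
    rw [remTime_of_exists hne, doneInd, if_neg hd, zero_mul, sub_zero]
    simp only [nextState, nextRemaining_apply_of_not_done hd]

lemma sum_weight_remTime_le (hn : 1 ≤ n) (hK : 1 ≤ K) {m : ℝ}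
    (hm : ∀ x : Fin n → Bool, c.blockTime x (fun _ => K) ≤ m)
    (s : (Fin n → Bool) × (Fin n → Fin (K + 1))) :
    ∑ y, c.weight s.1 y * c.remTime (nextState s y) ≤
      c.remTime s - 1 + m * ∑ y, c.weight s.1 y * doneInd s.2 y := by
  rw [remTime_eq hn hK s, Finset.mul_sum]
  simp only [mul_sub, Finset.sum_sub_distrib]
  have : ∑ y, c.weight s.1 y * (doneInd s.2 y * c.blockTime y fun _ => K) ≤
      ∑ y, m * (c.weight s.1 y * doneInd s.2 y) := by
    refine Finset.sum_le_sum fun y _ => ?_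
    have h0 : 0 ≤ c.weight s.1 y * doneInd s.2 y :=
      mul_nonneg (weight_nonneg _ _) (by unfold doneInd; split_ifs <;> norm_num)
    have := mul_le_mul_of_nonneg_left (hm y) h0
    linarith
  linarith

lemma le_sum_weight_remTime (hn : 1 ≤ n) (hK : 1 ≤ K) {m : ℝ}
    (hm : ∀ x : Fin n → Bool, m ≤ c.blockTime x (fun _ => K))
    (s : (Fin n → Bool) × (Fin n → Fin (K + 1))) :
    c.remTime s - 1 + m * ∑ y, c.weight s.1 y * doneInd s.2 y ≤
      ∑ y, c.weight s.1 y * c.remTime (nextState s y) := by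
  rw [remTime_eq hn hK s, Finset.mul_sum]
  simp only [mul_sub, Finset.sum_sub_distrib]
  have : ∑ y, m * (c.weight s.1 y * doneInd s.2 y) ≤
      ∑ y, c.weight s.1 y * (doneInd s.2 y * c.blockTime y fun _ => K) := by
    refine Finset.sum_le_sum fun y _ => ?_
    have h0 : 0 ≤ c.weight s.1 y * doneInd s.2 y :=
      mul_nonneg (weight_nonneg _ _) (by unfold doneInd; split_ifs <;> norm_num)
    have := mul_le_mul_of_nonneg_left (hm y) h0
    linarith
  linarith

/-- The long-run rate of block completions: a corrected count of completions has zero drift, and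
the rate is bounded in terms of expected completion times. -/
theorem exists_blockRate (hn : 1 ≤ n) (hK : 1 ≤ K) :
    ∃ (η : ℝ) (h : (Fin n → Bool) × (Fin n → Fin (K + 1)) → ℝ),
      (∀ s, ∑ y, c.weight s.1 y * (doneInd s.2 y - η + h (nextState s y) - h s) = 0) ∧
      (∀ m, (∀ x : Fin n → Bool, c.blockTime x (fun _ => K) ≤ m) → 1 ≤ m * η) ∧
      (∀ m, (∀ x : Fin n → Bool, m ≤ c.blockTime x (fun _ => K)) → m * η ≤ 1) := by
  obtain ⟨η, h, hη⟩ := exists_poisson (fun (s : (Fin n → Bool) × (Fin n → Fin (K + 1))) y =>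
    c.weight s.1 y) nextState (fun _ _ => weight_nonneg _ _) (fun s => sum_weight s.1)
    (fun _ => true, fun _ => Fin.last K) reach
    (fun s => ∑ y, c.weight s.1 y * doneInd s.2 y)
  refine ⟨η, h, fun s => ?_, fun m hm => ?_, fun m hm => ?_⟩
  · have := hη s
    simp only [mul_add, mul_sub, Finset.sum_sub_distrib, Finset.sum_add_distrib,
      ← Finset.sum_mul, sum_weight, one_mul]
    linarith
  · obtain ⟨s, hs⟩ := Finite.exists_min fun s => c.remTime s + m * h s
    have h1 : c.remTime s + m * h s ≤
        ∑ y, c.weight s.1 y * (c.remTime (nextState s y) + m * h (nextState s y)) := by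
      calc _ = ∑ y, c.weight s.1 y * (c.remTime s + m * h s) := by
            rw [← Finset.sum_mul, sum_weight, one_mul]
        _ ≤ _ := Finset.sum_le_sum fun y _ => mul_le_mul_of_nonneg_left (hs _) (weight_nonneg _ _)
    have h2 := sum_weight_remTime_le hn hK hm s
    have h3 := hη s
    have h4 : ∑ y, c.weight s.1 y * (m * h (nextState s y)) =
        m * ∑ y, c.weight s.1 y * h (nextState s y) := by
      rw [Finset.mul_sum]
      exact Finset.sum_congr rfl fun y _ => by ring
    simp only [mul_add, Finset.sum_add_distrib] at h1
    rw [h4] at h1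
    rw [h3] at h2
    linarith
  · obtain ⟨s, hs⟩ := Finite.exists_max fun s => c.remTime s + m * h s
    have h1 : ∑ y, c.weight s.1 y * (c.remTime (nextState s y) + m * h (nextState s y)) ≤
        c.remTime s + m * h s := by
      calc _ ≤ ∑ y, c.weight s.1 y * (c.remTime s + m * h s) :=
            Finset.sum_le_sum fun y _ => mul_le_mul_of_nonneg_left (hs _) (weight_nonneg _ _)
        _ = _ := by rw [← Finset.sum_mul, sum_weight, one_mul]
    have h2 := le_sum_weight_remTime hn hK hm s
    have h3 := hη s
    have h4 : ∑ y, c.weight s.1 y * (m * h (nextState s y)) =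
        m * ∑ y, c.weight s.1 y * h (nextState s y) := by
      rw [Finset.mul_sum]
      exact Finset.sum_congr rfl fun y _ => by ring
    simp only [mul_add, Finset.sum_add_distrib] at h1
    rw [h4] at h1
    rw [h3] at h2
    linarith

end GilbertElliott

/-! ### Measurability and one-step laws of sequences -/

/-- A function of finitely many coordinates with countable values is measurable. -/
lemma measurable_of_dependsOn_Iic {Ω α : Type*} [MeasurableSpace Ω] [Countable Ω]
    [MeasurableSingletonClass Ω] [Nonempty Ω] [MeasurableSpace α] {t : ℕ} {f : (ℕ → Ω) → α}
    (hf : DependsOn f (Set.Iic t)) : Measurable f := by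
  classical
  -- The values filled in after t are arbitrary, as f does not see them.
  let e : ((_ : Finset.Iic t) → Ω) → ℕ → Ω := fun p i =>
    if h : i ∈ Finset.Iic t then p ⟨i, h⟩ else Classical.arbitrary Ω
  have hfe : f = (fun p => f (e p)) ∘ Preorder.frestrictLe t := by
    funext ω
    refine hf fun i hi => ?_
    have : i ∈ Finset.Iic t := Finset.mem_Iic.2 hi
    simp only [e]
    rw [dif_pos this]
    rfl
  rw [hfe]
  exact (Measurable.of_discrete).comp (Preorder.measurable_frestrictLe t)

/-- If the joint law of the past up to time `t` and the next value is given by a kernel, so are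
integrals of functions of the past and the next value. -/
lemma lintegral_past_next {Ω : Type*} [MeasurableSpace Ω] [Countable Ω]
    [MeasurableSingletonClass Ω] [Nonempty Ω] {P : Measure (ℕ → Ω)} [IsProbabilityMeasure P]
    {t : ℕ} {κ : Kernel ((_ : Finset.Iic t) → Ω) Ω} [IsMarkovKernel κ]
    (hκ : (P.map (Preorder.frestrictLe (π := fun _ => Ω) t)) ⊗ₘ κ =
      P.map (fun ω => (Preorder.frestrictLe (π := fun _ => Ω) t ω, ω (t + 1))))
    {F : (ℕ → Ω) → Ω → ℝ≥0∞} (hF : ∀ y, DependsOn (fun ω => F ω y) (Set.Iic t)) :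
    ∫⁻ ω, F ω (ω (t + 1)) ∂P = ∫⁻ ω, ∫⁻ y, F ω y ∂(κ (Preorder.frestrictLe t ω)) ∂P := by
  classical
  let e : ((_ : Finset.Iic t) → Ω) → ℕ → Ω := fun p i =>
    if h : i ∈ Finset.Iic t then p ⟨i, h⟩ else Classical.arbitrary Ω
  have hfe : ∀ ω y, F ω y = F (e (Preorder.frestrictLe t ω)) y := by
    intro ω y
    refine hF y fun i hi => ?_
    have : i ∈ Finset.Iic t := Finset.mem_Iic.2 hi
    simp only [e]
    rw [dif_pos this]
    rfl
  have hm : Measurable fun p : ((_ : Finset.Iic t) → Ω) × Ω => F (e p.1) p.2 :=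
    Measurable.of_discrete
  have hr : Measurable (Preorder.frestrictLe (π := fun _ => Ω) t) :=
    Preorder.measurable_frestrictLe t
  calc ∫⁻ ω, F ω (ω (t + 1)) ∂P
      = ∫⁻ ω, (fun p : ((_ : Finset.Iic t) → Ω) × Ω => F (e p.1) p.2)
          (Preorder.frestrictLe t ω, ω (t + 1)) ∂P := by
        refine lintegral_congr fun ω => ?_
        exact hfe _ _
    _ = ∫⁻ p, F (e p.1) p.2 ∂((P.map (Preorder.frestrictLe (π := fun _ => Ω) t)) ⊗ₘ κ) := by
        rw [hκ, lintegral_map hm (hr.prodMk (measurable_pi_apply _))]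
    _ = ∫⁻ ω, ∫⁻ y, F (e (Preorder.frestrictLe t ω)) y ∂(κ (Preorder.frestrictLe t ω)) ∂P := by
        have : IsProbabilityMeasure (P.map (Preorder.frestrictLe (π := fun _ => Ω) t)) :=
          Measure.isProbabilityMeasure_map hr.aemeasurable
        rw [Measure.lintegral_compProd hm, lintegral_map Measurable.of_discrete hr]
    _ = _ := by simp only [← hfe]

namespace GilbertElliott

variable {c : GilbertElliott} {n K : ℕ}

instance (n : ℕ) (μ₀ : Measure (Fin n → Bool)) [IsProbabilityMeasure μ₀] :
    IsProbabilityMeasure (c.channelLaw n μ₀) := by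
  unfold channelLaw
  infer_instance

lemma stepOne_singleton (s b : Bool) : c.stepOne s {b} = ENNReal.ofReal (c.trans s b) := by
  cases b <;> simp [stepOne]

lemma step_singleton (x y : Fin n → Bool) :
    c.step n x {y} = ENNReal.ofReal (c.weight x y) := by
  change Measure.pi (fun i => c.stepOne (x i)) {y} = _
  rw [Measure.pi_singleton, weight, ENNReal.ofReal_prod_of_nonneg fun _ _ => trans_nonneg _ _]
  simp only [stepOne_singleton]

lemma lintegral_step (x : Fin n → Bool) (f : (Fin n → Bool) → ℝ≥0∞) :
    ∫⁻ y, f y ∂(c.step n x) = ∑ y, ENNReal.ofReal (c.weight x y) * f y := by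
  rw [lintegral_fintype]
  exact Finset.sum_congr rfl fun y _ => by rw [step_singleton, mul_comm]

/-- The Markov property of the channel process. -/
lemma lintegral_channelLaw (μ₀ : Measure (Fin n → Bool)) [IsProbabilityMeasure μ₀] {t : ℕ}
    {F : (ℕ → Fin n → Bool) → (Fin n → Bool) → ℝ≥0∞}
    (hF : ∀ y, DependsOn (fun X => F X y) (Set.Iic t)) :
    ∫⁻ X, F X (X (t + 1)) ∂(c.channelLaw n μ₀) =
      ∫⁻ X, ∑ y, ENNReal.ofReal (c.weight (X t) y) * F X y ∂(c.channelLaw n μ₀) := by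
  rw [lintegral_past_next (P := c.channelLaw n μ₀) (κ := c.stepPast n t)
    (Kernel.map_frestrictLe_trajMeasure_compProd_eq_map_trajMeasure
      (X := fun _ => Fin n → Bool)) hF]
  refine lintegral_congr fun X => ?_
  change ∫⁻ y, F X y ∂(c.step n (X t)) = _
  rw [lintegral_step]

/-! ### Martingales with bounded increments -/

/-- An adapted process with bounded increments of mean zero grows sublinearly. -/
lemma ae_eventually_le (μ₀ : Measure (Fin n → Bool)) [IsProbabilityMeasure μ₀]
    {M : ℕ → (ℕ → Fin n → Bool) → ℝ} {D : ℕ → (ℕ → Fin n → Bool) → (Fin n → Bool) → ℝ} {C ε : ℝ}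
    (hM : ∀ t, DependsOn (M t) (Set.Iic t)) (hD : ∀ t y, DependsOn (fun X => D t X y) (Set.Iic t))
    (hC : 1 ≤ C) (hε : 0 < ε) (hM0 : ∀ X, M 0 X ≤ C) (hDC : ∀ t X y, |D t X y| ≤ C)
    (hsum : ∀ t X, ∑ y, c.weight (X t) y * D t X y = 0)
    (hstep : ∀ t X, M (t + 1) X = M t X + D t X (X (t + 1))) :
    ∀ᵐ X ∂(c.channelLaw n μ₀), ∀ᶠ t : ℕ in atTop, M t X ≤ ε * t := by
  have hC0 : 0 < C := one_pos.trans_le hC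
  -- The first entry gives |lD| ≤ 1, where e^x ≤ 1 + x + x² holds; the second makes the growth
  -- factor 1 + (lC)² smaller than e^{lε}.
  set l := min (1 / C) (ε / (2 * C ^ 2)) with hl
  have hl0 : 0 < l := lt_min (by positivity) (by positivity)
  have hlC : l * C ≤ 1 := by
    have := mul_le_mul_of_nonneg_right (min_le_left (1 / C) (ε / (2 * C ^ 2))) hC0.le
    rwa [one_div_mul_cancel hC0.ne'] at this
  have hlε : l * (2 * C ^ 2) ≤ ε := by
    have := mul_le_mul_of_nonneg_right (min_le_right (1 / C) (ε / (2 * C ^ 2)))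
      (show 0 ≤ 2 * C ^ 2 by positivity)
    rwa [div_mul_cancel₀ _ (by positivity)] at this
  set q := 1 + (l * C) ^ 2 with hq
  have hq0 : 0 < q := by positivity
  have hstepE : ∀ t X, ∑ y, c.weight (X t) y * Real.exp (l * D t X y) ≤ q := by
    intro t X
    calc ∑ y, c.weight (X t) y * Real.exp (l * D t X y)
        ≤ ∑ y, c.weight (X t) y * (1 + l * D t X y + (l * C) ^ 2) := by
          refine Finset.sum_le_sum fun y _ => mul_le_mul_of_nonneg_left ?_ (weight_nonneg _ _)
          have h1 : |l * D t X y| ≤ l * C := by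
            rw [abs_mul, abs_of_pos hl0]
            exact mul_le_mul_of_nonneg_left (hDC t X y) hl0.le
          have h2 := (abs_le.1 (Real.abs_exp_sub_one_sub_id_le (h1.trans hlC))).2
          have h3 : (l * D t X y) ^ 2 ≤ (l * C) ^ 2 := sq_le_sq' (by linarith [(abs_le.1 h1).1])
            (abs_le.1 h1).2
          linarith
      _ = q := by
          have : ∑ y, c.weight (X t) y * (l * D t X y) = 0 := by
            rw [← mul_zero l, ← hsum t X, Finset.mul_sum]
            exact Finset.sum_congr rfl fun y _ => by ring
          simp only [mul_add, Finset.sum_add_distrib, ← Finset.sum_mul, sum_weight, this]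
          rw [hq]
          ring
  have hE : ∀ t, ∫⁻ X, ENNReal.ofReal (Real.exp (l * M t X)) ∂(c.channelLaw n μ₀) ≤
      ENNReal.ofReal (Real.exp (l * C) * q ^ t) := by
    intro t
    induction t with
    | zero =>
      calc _ ≤ ∫⁻ _X, ENNReal.ofReal (Real.exp (l * C)) ∂(c.channelLaw n μ₀) := by
            refine lintegral_mono fun X => ENNReal.ofReal_le_ofReal (Real.exp_le_exp.2 ?_)
            exact mul_le_mul_of_nonneg_left (hM0 X) hl0.le
        _ = _ := by simp
    | succ t ih =>
      calc ∫⁻ X, ENNReal.ofReal (Real.exp (l * M (t + 1) X)) ∂(c.channelLaw n μ₀)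
          = ∫⁻ X, (fun X y => ENNReal.ofReal (Real.exp (l * (M t X + D t X y)))) X (X (t + 1))
              ∂(c.channelLaw n μ₀) := by simp only [hstep]
        _ = ∫⁻ X, ∑ y, ENNReal.ofReal (c.weight (X t) y) *
              ENNReal.ofReal (Real.exp (l * (M t X + D t X y))) ∂(c.channelLaw n μ₀) := by
            refine lintegral_channelLaw (t := t) (F := fun X y =>
              ENNReal.ofReal (Real.exp (l * (M t X + D t X y)))) μ₀ fun y X X' h => ?_
            simp only [hM t h]
            rw [show D t X y = D t X' y from hD t y h]
        _ ≤ ∫⁻ X, ENNReal.ofReal q * ENNReal.ofReal (Real.exp (l * M t X))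
              ∂(c.channelLaw n μ₀) := by
            refine lintegral_mono fun X => ?_
            simp only [← ENNReal.ofReal_mul (weight_nonneg _ _), ← ENNReal.ofReal_mul hq0.le]
            rw [← ENNReal.ofReal_sum_of_nonneg fun y _ =>
              mul_nonneg (weight_nonneg _ _) (Real.exp_pos _).le]
            refine ENNReal.ofReal_le_ofReal ?_
            have := mul_le_mul_of_nonneg_right (hstepE t X) (Real.exp_pos (l * M t X)).le
            refine le_trans (le_of_eq ?_) this
            rw [Finset.sum_mul]
            refine Finset.sum_congr rfl fun y _ => ?_
            rw [mul_add, Real.exp_add]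
            ring
        _ = ENNReal.ofReal q * ∫⁻ X, ENNReal.ofReal (Real.exp (l * M t X))
              ∂(c.channelLaw n μ₀) := lintegral_const_mul' _ _ ENNReal.ofReal_ne_top
        _ ≤ ENNReal.ofReal q * ENNReal.ofReal (Real.exp (l * C) * q ^ t) :=
            mul_le_mul_right ih _
        _ = _ := by
            rw [← ENNReal.ofReal_mul hq0.le, pow_succ]
            ring_nf
  have hqε : q * Real.exp (-(l * ε)) < 1 := by
    have h1 : q < Real.exp (l * ε) := by
      have h2 := Real.add_one_le_exp (l * ε)
      have h3 : (l * C) ^ 2 < l * ε := by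
        have : l * (l * (2 * C ^ 2)) ≤ l * ε := mul_le_mul_of_nonneg_left hlε hl0.le
        have : 0 < (l * C) ^ 2 := by positivity
        nlinarith
      linarith
    calc q * Real.exp (-(l * ε)) < Real.exp (l * ε) * Real.exp (-(l * ε)) :=
          mul_lt_mul_of_pos_right h1 (Real.exp_pos _)
      _ = 1 := by rw [← Real.exp_add]; simp
  have hmeas : ∀ t, Measurable fun X => ENNReal.ofReal (Real.exp (l * (M t X - ε * t))) := by
    intro t
    refine measurable_of_dependsOn_Iic (t := t) fun X X' h => ?_
    simp only [hM t h]
  -- Borel–Cantelli in integrated form: the sum has finite mean, so almost surely its terms tend to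
  -- 0.
  have hfin : ∫⁻ X, ∑' t, ENNReal.ofReal (Real.exp (l * (M t X - ε * t)))
      ∂(c.channelLaw n μ₀) ≠ ⊤ := by
    rw [lintegral_tsum fun t => (hmeas t).aemeasurable]
    have hle : ∀ t : ℕ, ∫⁻ X, ENNReal.ofReal (Real.exp (l * (M t X - ε * t)))
        ∂(c.channelLaw n μ₀) ≤
        ENNReal.ofReal (Real.exp (l * C) * (q * Real.exp (-(l * ε))) ^ t) := by
      intro t
      calc _ = ∫⁻ X, ENNReal.ofReal (Real.exp (-(l * ε)) ^ t) *
            ENNReal.ofReal (Real.exp (l * M t X)) ∂(c.channelLaw n μ₀) := by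
            refine lintegral_congr fun X => ?_
            rw [← ENNReal.ofReal_mul (by positivity), ← Real.exp_nat_mul, ← Real.exp_add]
            ring_nf
        _ = ENNReal.ofReal (Real.exp (-(l * ε)) ^ t) *
            ∫⁻ X, ENNReal.ofReal (Real.exp (l * M t X)) ∂(c.channelLaw n μ₀) :=
            lintegral_const_mul' _ _ ENNReal.ofReal_ne_top
        _ ≤ ENNReal.ofReal (Real.exp (-(l * ε)) ^ t) *
            ENNReal.ofReal (Real.exp (l * C) * q ^ t) := mul_le_mul_right (hE t) _
        _ = _ := by
            rw [← ENNReal.ofReal_mul (by positivity), mul_pow]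
            ring_nf
    refine ne_top_of_le_ne_top ?_ (ENNReal.tsum_le_tsum hle)
    exact ((summable_geometric_of_lt_one (by positivity) hqε).mul_left _).tsum_ofReal_ne_top
  filter_upwards [ae_lt_top' (AEMeasurable.tsum fun t => (hmeas t).aemeasurable) hfin]
    with X hX
  have h0 := ENNReal.tendsto_atTop_zero_of_tsum_ne_top hX.ne
  filter_upwards [h0.eventually (gt_mem_nhds one_pos)] with t ht
  by_contra! hlt
  have : 1 ≤ Real.exp (l * (M t X - ε * t)) :=
    Real.one_le_exp (mul_nonneg hl0.le (by linarith))
  rw [ENNReal.ofReal_lt_one] at ht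
  linarith

lemma ae_tendsto_div (μ₀ : Measure (Fin n → Bool)) [IsProbabilityMeasure μ₀]
    {M : ℕ → (ℕ → Fin n → Bool) → ℝ} {D : ℕ → (ℕ → Fin n → Bool) → (Fin n → Bool) → ℝ} {C : ℝ}
    (hM : ∀ t, DependsOn (M t) (Set.Iic t)) (hD : ∀ t y, DependsOn (fun X => D t X y) (Set.Iic t))
    (hC : 1 ≤ C) (hM0 : ∀ X, |M 0 X| ≤ C) (hDC : ∀ t X y, |D t X y| ≤ C)
    (hsum : ∀ t X, ∑ y, c.weight (X t) y * D t X y = 0)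
    (hstep : ∀ t X, M (t + 1) X = M t X + D t X (X (t + 1))) :
    ∀ᵐ X ∂(c.channelLaw n μ₀), Tendsto (fun t : ℕ => M t X / t) atTop (𝓝 0) := by
  have hup : ∀ᵐ X ∂(c.channelLaw n μ₀), ∀ m : ℕ, ∀ᶠ t : ℕ in atTop,
      M t X ≤ (1 / ((m : ℝ) + 1)) * t :=
    ae_all_iff.2 fun m => ae_eventually_le μ₀ hM hD hC (by positivity)
      (fun X => (abs_le.1 (hM0 X)).2) hDC hsum hstep
  have hlow : ∀ᵐ X ∂(c.channelLaw n μ₀), ∀ m : ℕ, ∀ᶠ t : ℕ in atTop,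
      -M t X ≤ (1 / ((m : ℝ) + 1)) * t :=
    ae_all_iff.2 fun m => ae_eventually_le (M := fun t X => -M t X) (D := fun t X y => -D t X y)
      μ₀ (fun t X X' h => congrArg Neg.neg (hM t h))
      (fun t y X X' h => congrArg Neg.neg (hD t y h)) hC (by positivity)
      (fun X => by linarith [(abs_le.1 (hM0 X)).1]) (fun t X y => by rw [abs_neg]; exact hDC t X y)
      (fun t X => by simp only [mul_neg, Finset.sum_neg_distrib, hsum, neg_zero])
      (fun t X => by rw [hstep]; ring)
  filter_upwards [hup, hlow] with X h1 h2
  rw [Metric.tendsto_nhds]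
  intro ε hε
  obtain ⟨m, hm⟩ := exists_nat_one_div_lt hε
  filter_upwards [h1 m, h2 m, eventually_gt_atTop 0] with t ht1 ht2 ht0
  have ht0' : (0 : ℝ) < t := by exact_mod_cast ht0
  rw [Real.dist_eq, sub_zero, abs_div, abs_of_pos ht0', div_lt_iff₀ ht0']
  have := mul_lt_mul_of_pos_right hm ht0'
  rw [abs_lt]
  constructor <;> linarith

/-! ### The throughput -/

/-- The remaining receptions of a block of size `K`, given the numbers of received symbols. -/
def remaining (K : ℕ) (a : Fin n → ℕ) : Fin n → Fin (K + 1) :=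
  fun i => ⟨K - a i, Nat.lt_succ_of_le (Nat.sub_le _ _)⟩

lemma remaining_zero : remaining K (0 : Fin n → ℕ) = fun _ => Fin.last K := by
  funext i
  exact Fin.ext (by simp [remaining])

lemma blockDone_remaining_iff (a : Fin n → ℕ) (y : Fin n → Bool) :
    BlockDone (remaining K a) y ↔ ∀ i, K ≤ receive a y i := by
  refine forall_congr' fun i => ?_
  simp only [remaining, receive]
  omega

lemma nextRemaining_remaining {a : Fin n → ℕ} {y : Fin n → Bool}
    (h : ¬ ∀ i, K ≤ receive a y i) :
    nextRemaining (remaining K a) y = remaining K (receive a y) := by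
  funext i
  refine Fin.ext ?_
  rw [nextRemaining_apply_of_not_done (by rwa [blockDone_remaining_iff])]
  simp only [remaining, receive]
  omega

lemma dependsOn_backlogged (K t : ℕ) :
    DependsOn (fun X : ℕ → Fin n → Bool => backlogged K X t) (Set.Iic t) := by
  induction t with
  | zero => intro X X' _; rfl
  | succ t ih =>
    intro X X' h
    have h1 : backlogged K X t = backlogged K X' t :=
      ih fun i hi => h i (Set.Iic_subset_Iic.2 (Nat.le_succ t) hi)
    have h2 : X (t + 1) = X' (t + 1) := h _ Set.self_mem_Iic
    simp only [backlogged, h1, h2]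

/-- The state of the block chain after `t` slots of the backlogged system. -/
def backState (K : ℕ) (X : ℕ → Fin n → Bool) (t : ℕ) : (Fin n → Bool) × (Fin n → Fin (K + 1)) :=
  (X t, remaining K (backlogged K X t).1)

lemma backState_succ (X : ℕ → Fin n → Bool) (t : ℕ) :
    backState K X (t + 1) = nextState (backState K X t) (X (t + 1)) := by
  refine Prod.ext rfl ?_
  simp only [backState, nextState, backlogged]
  split_ifs with h
  · rw [remaining_zero, nextRemaining_of_done ((blockDone_remaining_iff _ _).2 h)]
  · rw [nextRemaining_remaining h]

lemma blocksDone_succ (X : ℕ → Fin n → Bool) (t : ℕ) :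
    (blocksDone K X (t + 1) : ℝ) =
      blocksDone K X t + doneInd (backState K X t).2 (X (t + 1)) := by
  simp only [blocksDone, backlogged, doneInd, backState, blockDone_remaining_iff]
  split_ifs <;> simp

lemma dependsOn_backState (K t : ℕ) :
    DependsOn (fun X : ℕ → Fin n → Bool => backState K X t) (Set.Iic t) := by
  intro X X' h
  have h1 : backlogged K X t = backlogged K X' t := dependsOn_backlogged K t h
  have h2 : X t = X' t := h _ Set.self_mem_Iic
  simp only [backState, h1, h2]

/-- With h from Poisson's equation, the number of completed blocks minus ηt plus h of the current
state has bounded increments of conditional mean zero. Dividing by t kills both the martingale and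
the bounded h. -/
theorem exists_isThroughput (c : GilbertElliott) {n K : ℕ} (hn : 1 ≤ n) (hK : 1 ≤ K) :
    ∃ η : ℝ, c.IsThroughput n K η ∧
      (∀ m, (∀ x : Fin n → Bool, c.blockTime x (fun _ => K) ≤ m) → K ≤ m * η) ∧
      (∀ m, (∀ x : Fin n → Bool, m ≤ c.blockTime x (fun _ => K)) → m * η ≤ K) := by
  obtain ⟨η, h, hpoisson, hlow, hup⟩ := exists_blockRate (c := c) hn hK
  refine ⟨K * η, ?_, fun m hm => ?_, fun m hm => ?_⟩
  · intro μ₀ _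
    obtain ⟨B, hB⟩ := (Set.finite_range fun s => |h s|).bddAbove
    have hB' : ∀ s, |h s| ≤ B := fun s => hB ⟨s, rfl⟩
    set D : ℕ → (ℕ → Fin n → Bool) → (Fin n → Bool) → ℝ := fun t X y =>
      doneInd (backState K X t).2 y - η + h (nextState (backState K X t) y) -
        h (backState K X t) with hD
    have hB0 : 0 ≤ B := (abs_nonneg _).trans (hB' (fun _ => true, fun _ => Fin.last K))
    have hlim := ae_tendsto_div (c := c) μ₀
      (M := fun t X => blocksDone K X t - η * t + h (backState K X t)) (D := D)
      (C := 1 + |η| + B + B)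
      (fun t X X' hX => by
        have h1 : backlogged K X t = backlogged K X' t := dependsOn_backlogged K t hX
        have h2 : backState K X t = backState K X' t := dependsOn_backState K t hX
        simp only [blocksDone, h1, h2])
      (fun t y X X' hX => by
        have h2 : backState K X t = backState K X' t := dependsOn_backState K t hX
        simp only [hD, h2])
      (by have := abs_nonneg η; linarith)
      (fun X => by
        have := abs_nonneg η
        simp only [blocksDone, backlogged, Nat.cast_zero, mul_zero, sub_zero, zero_add]
        exact (hB' _).trans (by linarith))
      (fun t X y => by
        have h1 := abs_le.1 (hB' (nextState (backState K X t) y))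
        have h2 := abs_le.1 (hB' (backState K X t))
        have h3 := neg_abs_le η
        have h4 := le_abs_self η
        have h5 : 0 ≤ doneInd (backState K X t).2 y ∧ doneInd (backState K X t).2 y ≤ 1 := by
          unfold doneInd
          split_ifs <;> norm_num
        rw [abs_le]
        constructor <;> simp only [hD] <;> linarith [h1.1, h1.2, h2.1, h2.2, h5.1, h5.2])
      (fun t X => hpoisson (backState K X t))
      (fun t X => by
        rw [blocksDone_succ, backState_succ]
        simp only [hD]
        push_cast
        ring)
    filter_upwards [hlim] with X hX
    have hh : Tendsto (fun t : ℕ => h (backState K X t) / t) atTop (𝓝 0) := by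
      refine squeeze_zero_norm (a := fun t : ℕ => B / t) (fun t => ?_)
        (tendsto_const_div_atTop_nhds_zero_nat B)
      rw [norm_div, Real.norm_eq_abs, Real.norm_natCast]
      exact div_le_div_of_nonneg_right (hB' _) (Nat.cast_nonneg _)
    have hsum := ((hX.sub hh).add_const η).const_mul (K : ℝ)
    rw [sub_zero, zero_add] at hsum
    refine hsum.congr' ?_
    filter_upwards [eventually_gt_atTop 0] with t ht
    have ht0' : (t : ℝ) ≠ 0 := by positivity
    field_simp
    ring
  · have := mul_le_mul_of_nonneg_left (hlow m hm) (Nat.cast_nonneg (α := ℝ) K)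
    linarith
  · have := mul_le_mul_of_nonneg_left (hup m hm) (Nat.cast_nonneg (α := ℝ) K)
    linarith

end GilbertElliott

/-! ### One-step laws with independent arrivals -/

/-- The next coordinate of an i.i.d. sequence is independent of the past. -/
lemma lintegral_infinitePi_next (ν : Measure ℕ) [IsProbabilityMeasure ν] {t : ℕ}
    {F : (ℕ → ℕ) → ℕ → ℝ≥0∞} (hF : ∀ a, DependsOn (fun A => F A a) (Set.Iic t)) :
    ∫⁻ A, F A (A (t + 1)) ∂(Measure.infinitePi fun _ : ℕ => ν) =
      ∫⁻ A, ∫⁻ a, F A a ∂ν ∂(Measure.infinitePi fun _ : ℕ => ν) := by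
  have hr : Measurable (Preorder.frestrictLe (π := fun _ : ℕ => ℕ) t) :=
    Preorder.measurable_frestrictLe t
  have hind : IndepFun (Preorder.frestrictLe (π := fun _ : ℕ => ℕ) t)
      (fun A : ℕ → ℕ => A (t + 1)) (Measure.infinitePi fun _ : ℕ => ν) := by
    have h := (iIndepFun_infinitePi (P := fun _ : ℕ => ν) (X := fun _ a => a)
      (fun _ => measurable_id)).indepFun_finset (Finset.Iic t) {t + 1}
      (by simp) fun i => measurable_pi_apply i
    exact h.comp (φ := id)
      (ψ := fun g : (({t + 1} : Finset ℕ) → ℕ) => g ⟨t + 1, Finset.mem_singleton_self _⟩)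
      measurable_id (measurable_pi_apply _)
  rw [lintegral_past_next (P := Measure.infinitePi fun _ : ℕ => ν) (t := t)
    (κ := Kernel.const _ ν) ?_ hF]
  · simp only [Kernel.const_apply]
  · have : IsProbabilityMeasure ((Measure.infinitePi fun _ : ℕ => ν).map
        (Preorder.frestrictLe (π := fun _ : ℕ => ℕ) t)) :=
      Measure.isProbabilityMeasure_map hr.aemeasurable
    rw [Measure.compProd_const, hind.map_prod_eq_prod_map_map hr.aemeasurable
      (measurable_pi_apply _).aemeasurable, Measure.infinitePi_map_eval]

/-- A function of finitely many coordinates of two sequences is measurable. -/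
lemma measurable_of_forall_eq {Ω α : Type*} [MeasurableSpace Ω] [Countable Ω]
    [MeasurableSingletonClass Ω] [Nonempty Ω] [MeasurableSpace α] {t : ℕ}
    {f : (ℕ → Ω) → (ℕ → ℕ) → α}
    (hf : ∀ X X' A A', (∀ i ∈ Set.Iic t, X i = X' i) → (∀ i ∈ Set.Iic t, A i = A' i) →
      f X A = f X' A') : Measurable fun p : (ℕ → Ω) × (ℕ → ℕ) => f p.1 p.2 := by
  -- The two sequences are zipped into one sequence of pairs, to which the one-sequence criterion
  -- applies.
  have h1 : Measurable fun z : ℕ → Ω × ℕ => f (fun i => (z i).1) fun i => (z i).2 :=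
    measurable_of_dependsOn_Iic (t := t) fun z z' h =>
      hf _ _ _ _ (fun i hi => congrArg Prod.fst (h i hi)) fun i hi => congrArg Prod.snd (h i hi)
  have h2 : Measurable fun (p : (ℕ → Ω) × (ℕ → ℕ)) (i : ℕ) => (p.1 i, p.2 i) := by fun_prop
  exact h1.comp h2

namespace GilbertElliott

variable {c : GilbertElliott} {n K : ℕ}

/-- The joint Markov property of channels and arrivals. -/
lemma lintegral_prod_next (μ₀ : Measure (Fin n → Bool)) [IsProbabilityMeasure μ₀]
    (ν : Measure ℕ) [IsProbabilityMeasure ν] {t : ℕ}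
    {F : (ℕ → Fin n → Bool) → (ℕ → ℕ) → (Fin n → Bool) → ℕ → ℝ≥0∞}
    (hF : ∀ X X' A A', (∀ i ∈ Set.Iic t, X i = X' i) → (∀ i ∈ Set.Iic t, A i = A' i) →
      F X A = F X' A') :
    ∫⁻ p, F p.1 p.2 (p.1 (t + 1)) (p.2 (t + 1))
        ∂((c.channelLaw n μ₀).prod (Measure.infinitePi fun _ : ℕ => ν)) =
      ∫⁻ p, ∑ y, ENNReal.ofReal (c.weight (p.1 t) y) * ∫⁻ a, F p.1 p.2 y a ∂ν
        ∂((c.channelLaw n μ₀).prod (Measure.infinitePi fun _ : ℕ => ν)) := by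
  have hsub : Set.Iic t ⊆ Set.Iic (t + 1) := Set.Iic_subset_Iic.2 (Nat.le_succ t)
  have m1 : Measurable fun p : (ℕ → Fin n → Bool) × (ℕ → ℕ) =>
      F p.1 p.2 (p.1 (t + 1)) (p.2 (t + 1)) := by
    refine measurable_of_forall_eq (t := t + 1)
      (f := fun X A => F X A (X (t + 1)) (A (t + 1))) fun X X' A A' hX hA => ?_
    rw [hF X X' A A' (fun i hi => hX i (hsub hi)) (fun i hi => hA i (hsub hi)),
      hX _ Set.self_mem_Iic, hA _ Set.self_mem_Iic]
  have m2 : Measurable fun p : (ℕ → Fin n → Bool) × (ℕ → ℕ) =>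
      ∫⁻ a, F p.1 p.2 (p.1 (t + 1)) a ∂ν := by
    refine measurable_of_forall_eq (t := t + 1)
      (f := fun X A => ∫⁻ a, F X A (X (t + 1)) a ∂ν) fun X X' A A' hX hA => ?_
    rw [hF X X' A A' (fun i hi => hX i (hsub hi)) (fun i hi => hA i (hsub hi)),
      hX _ Set.self_mem_Iic]
  have m3 : Measurable fun p : (ℕ → Fin n → Bool) × (ℕ → ℕ) =>
      ∑ y, ENNReal.ofReal (c.weight (p.1 t) y) * ∫⁻ a, F p.1 p.2 y a ∂ν := by
    refine measurable_of_forall_eq (t := t)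
      (f := fun X A => ∑ y, ENNReal.ofReal (c.weight (X t) y) * ∫⁻ a, F X A y a ∂ν)
      fun X X' A A' hX hA => ?_
    rw [hF X X' A A' hX hA, hX _ Set.self_mem_Iic]
  -- The next arrival is averaged first with the channels fixed, then the next channel state with
  -- the arrivals fixed; Tonelli's theorem exchanges the order between.
  calc _ = ∫⁻ X, ∫⁻ A, F X A (X (t + 1)) (A (t + 1)) ∂(Measure.infinitePi fun _ : ℕ => ν)
        ∂(c.channelLaw n μ₀) := lintegral_prod _ m1.aemeasurable
    _ = ∫⁻ X, ∫⁻ A, ∫⁻ a, F X A (X (t + 1)) a ∂ν ∂(Measure.infinitePi fun _ : ℕ => ν)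
        ∂(c.channelLaw n μ₀) := by
        refine lintegral_congr fun X => ?_
        refine lintegral_infinitePi_next ν (F := fun A a => F X A (X (t + 1)) a)
          fun a A A' hA => ?_
        simp only
        rw [hF X X A A' (fun _ _ => rfl) hA]
    _ = ∫⁻ A, ∫⁻ X, ∫⁻ a, F X A (X (t + 1)) a ∂ν ∂(c.channelLaw n μ₀)
        ∂(Measure.infinitePi fun _ : ℕ => ν) := lintegral_lintegral_swap m2.aemeasurable
    _ = ∫⁻ A, ∫⁻ X, ∑ y, ENNReal.ofReal (c.weight (X t) y) * ∫⁻ a, F X A y a ∂ν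
        ∂(c.channelLaw n μ₀) ∂(Measure.infinitePi fun _ : ℕ => ν) := by
        refine lintegral_congr fun A => ?_
        refine lintegral_channelLaw μ₀ (F := fun X y => ∫⁻ a, F X A y a ∂ν)
          fun y X X' hX => ?_
        simp only
        rw [hF X X' A A hX fun _ _ => rfl]
    _ = ∫⁻ X, ∫⁻ A, ∑ y, ENNReal.ofReal (c.weight (X t) y) * ∫⁻ a, F X A y a ∂ν
        ∂(Measure.infinitePi fun _ : ℕ => ν) ∂(c.channelLaw n μ₀) :=
        (lintegral_lintegral_swap m3.aemeasurable).symm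
    _ = _ := (lintegral_prod _ m3.aemeasurable).symm

/-! ### A quadratic Lyapunov function for the queue -/

variable (c) in
/-- The number of packets plus a multiple of the remaining completion time. -/
def lyap (θ : ℝ) (q : ℕ) (s : (Fin n → Bool) × (Fin n → Fin (K + 1))) : ℝ := q + θ * c.remTime s

variable (c) in
/-- The value of `lyap` after a slot with channel state `y` and without arrivals. -/
def lyapNext (θ : ℝ) (q : ℕ) (s : (Fin n → Bool) × (Fin n → Fin (K + 1))) (y : Fin n → Bool) : ℝ :=
  if q < K then q + θ * c.remTime (K := K) (y, fun _ => Fin.last K)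
  else q - K * doneInd s.2 y + θ * c.remTime (nextState s y)

lemma doneInd_nonneg (k : Fin n → Fin (K + 1)) (y : Fin n → Bool) : 0 ≤ doneInd k y := by
  unfold doneInd
  split_ifs <;> norm_num

lemma doneInd_le_one (k : Fin n → Fin (K + 1)) (y : Fin n → Bool) : doneInd k y ≤ 1 := by
  unfold doneInd
  split_ifs <;> norm_num

lemma lyap_nonneg {θ : ℝ} (hθ : 0 ≤ θ) (q : ℕ) (s : (Fin n → Bool) × (Fin n → Fin (K + 1))) :
    0 ≤ c.lyap θ q s :=
  add_nonneg (Nat.cast_nonneg _) (mul_nonneg hθ (remTime_nonneg _))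

lemma lyapNext_nonneg {θ : ℝ} (hθ : 0 ≤ θ) (q : ℕ) (s : (Fin n → Bool) × (Fin n → Fin (K + 1)))
    (y : Fin n → Bool) : 0 ≤ c.lyapNext θ q s y := by
  unfold lyapNext
  split_ifs with h
  · exact add_nonneg (Nat.cast_nonneg _) (mul_nonneg hθ (remTime_nonneg _))
  · have h1 : (K : ℝ) ≤ q := by exact_mod_cast not_lt.1 h
    have h2 := mul_le_of_le_one_right (Nat.cast_nonneg (α := ℝ) K) (doneInd_le_one s.2 y)
    have h3 := mul_nonneg hθ (remTime_nonneg (c := c) (nextState s y))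
    linarith

/-- The summand is the second moment of the next value including arrivals of mean l and second
moment v. With θ = K/m, a completion removes K packets and adds at most θm = K of fresh work, so a
busy slot lowers the mean by at least θ before arrivals. -/
lemma exists_drift_bound (hn : 1 ≤ n) (hK : 1 ≤ K) {m l v : ℝ} (hm0 : 0 < m)
    (hm : ∀ x : Fin n → Bool, c.blockTime x (fun _ => K) ≤ m) (hl0 : 0 ≤ l) (hl : l < K / m)
    (hv : 0 ≤ v) :
    ∃ C, 0 ≤ C ∧ ∀ q (s : (Fin n → Bool) × (Fin n → Fin (K + 1))),
      ∑ y, c.weight s.1 y * (c.lyapNext (K / m) q s y ^ 2 + 2 * l * c.lyapNext (K / m) q s y + v) +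
        2 * (K / m - l) * c.lyap (K / m) q s ≤ c.lyap (K / m) q s ^ 2 + C := by
  obtain ⟨B, hB⟩ := (Set.finite_range fun s : (Fin n → Bool) × (Fin n → Fin (K + 1)) =>
    c.remTime s).bddAbove
  have hB' : ∀ s : (Fin n → Bool) × (Fin n → Fin (K + 1)), c.remTime s ≤ B := fun s => hB ⟨s, rfl⟩
  set θ : ℝ := K / m with hθ
  have hθ0 : 0 ≤ θ := hl0.trans hl.le
  have hB0 : 0 ≤ B := (remTime_nonneg _).trans (hB' (fun _ => true, fun _ => Fin.last K))
  have hK0 : (0 : ℝ) ≤ K := Nat.cast_nonneg _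
  set D : ℝ := K + θ * B with hD
  have hθB : 0 ≤ θ * B := mul_nonneg hθ0 hB0
  have hD0 : 0 ≤ D := by positivity
  have hrem : ∀ s : (Fin n → Bool) × (Fin n → Fin (K + 1)),
      0 ≤ θ * c.remTime s ∧ θ * c.remTime s ≤ θ * B := fun s =>
    ⟨mul_nonneg hθ0 (remTime_nonneg s), mul_le_mul_of_nonneg_left (hB' s) hθ0⟩
  have hdiff : ∀ q (s : (Fin n → Bool) × (Fin n → Fin (K + 1))) y,
      |c.lyapNext θ q s y - c.lyap θ q s| ≤ D := by
    intro q s y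
    have h1 := hrem s
    have h2 := hrem (nextState s y)
    have h3 := hrem (y, fun _ => Fin.last K)
    have h4 := mul_le_of_le_one_right hK0 (doneInd_le_one s.2 y)
    have h5 := mul_nonneg hK0 (doneInd_nonneg s.2 y)
    rw [abs_le]
    unfold lyapNext lyap
    constructor <;> split_ifs <;> linarith [h1.1, h1.2, h2.1, h2.2, h3.1, h3.2]
  -- All terms but the last cover q < K, where U ≤ D and the next value is at most 2D. For q ≥ K, v
  -- plus the final D² bounds what is left after the linear drift.
  refine ⟨4 * D ^ 2 + 4 * l * D + 2 * (θ - l) * D + v + D ^ 2, by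
    have : 0 ≤ θ - l := by linarith
    positivity, fun q s => ?_⟩
  set U := c.lyap θ q s with hU
  have hU0 : 0 ≤ U := lyap_nonneg hθ0 q s
  have hδ : 0 ≤ θ - l := by linarith
  by_cases hq : q < K
  · have hUD : U ≤ D := by
      have h1 := (hrem s).2
      have h2 : (q : ℝ) ≤ K := by exact_mod_cast hq.le
      rw [hU, lyap, hD]
      linarith
    have hle : ∑ y, c.weight s.1 y * (c.lyapNext θ q s y ^ 2 + 2 * l * c.lyapNext θ q s y + v) ≤
        ∑ y, c.weight s.1 y * ((2 * D) ^ 2 + 2 * l * (2 * D) + v) := by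
      refine Finset.sum_le_sum fun y _ => mul_le_mul_of_nonneg_left ?_ (weight_nonneg _ _)
      have h1 : c.lyapNext θ q s y ≤ 2 * D := by
        have := (abs_le.1 (hdiff q s y)).2
        linarith
      have h2 := lyapNext_nonneg (c := c) hθ0 q s y
      gcongr
    rw [← Finset.sum_mul, sum_weight, one_mul] at hle
    have h3 : 2 * (θ - l) * U ≤ 2 * (θ - l) * D := by gcongr
    nlinarith [sq_nonneg U, sq_nonneg D]
  · have hdrift : ∑ y, c.weight s.1 y * (c.lyapNext θ q s y - U) ≤ -θ := by
      have h1 := mul_le_mul_of_nonneg_left (sum_weight_remTime_le hn hK hm s) hθ0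
      have h2 : ∑ y, c.weight s.1 y * (c.lyapNext θ q s y - U) =
          θ * ∑ y, c.weight s.1 y * c.remTime (nextState s y) - θ * c.remTime s -
            K * ∑ y, c.weight s.1 y * doneInd s.2 y := by
        have h3 : ∀ y, c.weight s.1 y * (c.lyapNext θ q s y - U) =
            θ * (c.weight s.1 y * c.remTime (nextState s y)) -
              c.weight s.1 y * (θ * c.remTime s) - K * (c.weight s.1 y * doneInd s.2 y) := by
          intro y
          rw [lyapNext, if_neg hq, hU, lyap]
          ring
        simp only [h3, Finset.sum_sub_distrib, ← Finset.mul_sum, ← Finset.sum_mul, sum_weight,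
          one_mul]
      have h4 : θ * (m * ∑ y, c.weight s.1 y * doneInd s.2 y) =
          K * ∑ y, c.weight s.1 y * doneInd s.2 y := by
        rw [← mul_assoc, hθ, div_mul_cancel₀ _ hm0.ne']
      rw [h2]
      rw [mul_add, mul_sub, h4] at h1
      linarith
    have hsq : ∑ y, c.weight s.1 y * (c.lyapNext θ q s y - U) ^ 2 ≤ D ^ 2 := by
      calc _ ≤ ∑ y, c.weight s.1 y * D ^ 2 := by
            refine Finset.sum_le_sum fun y _ => mul_le_mul_of_nonneg_left ?_ (weight_nonneg _ _)
            have := abs_le.1 (hdiff q s y)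
            exact sq_le_sq' this.1 this.2
        _ = D ^ 2 := by rw [← Finset.sum_mul, sum_weight, one_mul]
    have hexp : ∑ y, c.weight s.1 y *
        (c.lyapNext θ q s y ^ 2 + 2 * l * c.lyapNext θ q s y + v) =
        (U ^ 2 + 2 * l * U + v) +
          (2 * U + 2 * l) * ∑ y, c.weight s.1 y * (c.lyapNext θ q s y - U) +
          ∑ y, c.weight s.1 y * (c.lyapNext θ q s y - U) ^ 2 := by
      have h3 : ∀ y, c.weight s.1 y *
          (c.lyapNext θ q s y ^ 2 + 2 * l * c.lyapNext θ q s y + v) =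
          c.weight s.1 y * (U ^ 2 + 2 * l * U + v) +
            (2 * U + 2 * l) * (c.weight s.1 y * (c.lyapNext θ q s y - U)) +
            c.weight s.1 y * (c.lyapNext θ q s y - U) ^ 2 := fun y => by ring
      simp only [h3, Finset.sum_add_distrib, ← Finset.mul_sum, ← Finset.sum_mul, sum_weight,
        one_mul]
    rw [hexp]
    have h5 := mul_le_mul_of_nonneg_left hdrift (show 0 ≤ 2 * U + 2 * l by positivity)
    have h6 : 0 ≤ 2 * l * θ := by positivity
    have h7 : 0 ≤ 4 * l * D := by positivity
    have h8 : 0 ≤ 2 * (θ - l) * D := by positivity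
    nlinarith [sq_nonneg D]

/-- The state of the block chain after `t` slots of the queueing system. -/
def queueBlock (K q₀ : ℕ) (X : ℕ → Fin n → Bool) (A : ℕ → ℕ) (t : ℕ) :
    (Fin n → Bool) × (Fin n → Fin (K + 1)) :=
  (X t, remaining K (queueState K q₀ X A t).2)

lemma queueState_congr (q₀ : ℕ) {t : ℕ} : ∀ {X X' : ℕ → Fin n → Bool} {A A' : ℕ → ℕ},
    (∀ i ∈ Set.Iic t, X i = X' i) → (∀ i ∈ Set.Iic t, A i = A' i) →
      queueState K q₀ X A t = queueState K q₀ X' A' t := by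
  induction t with
  | zero => intros; rfl
  | succ t ih =>
    intro X X' A A' hX hA
    have hsub : Set.Iic t ⊆ Set.Iic (t + 1) := Set.Iic_subset_Iic.2 (Nat.le_succ t)
    have h1 := ih (fun i hi => hX i (hsub hi)) (fun i hi => hA i (hsub hi))
    have h2 : X (t + 1) = X' (t + 1) := hX _ Set.self_mem_Iic
    have h3 : A (t + 1) = A' (t + 1) := hA _ Set.self_mem_Iic
    simp only [queueState, h1, h2, h3]

/-- In an idle slot the counters are reset to 0, so the block part restarts with K receptions
remaining for everyone. -/
lemma lyap_queue_succ (θ : ℝ) (q₀ : ℕ) (X : ℕ → Fin n → Bool) (A : ℕ → ℕ) (t : ℕ) :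
    c.lyap θ (queueLength K q₀ X A (t + 1)) (queueBlock K q₀ X A (t + 1)) =
      c.lyapNext θ (queueLength K q₀ X A t) (queueBlock K q₀ X A t) (X (t + 1)) + A (t + 1) := by
  unfold lyap lyapNext
  by_cases hq : (queueState K q₀ X A t).1 < K
  · rw [if_pos (show queueLength K q₀ X A t < K from hq)]
    simp only [queueLength, queueBlock, queueState, if_pos hq, remaining_zero]
    push_cast
    ring
  · rw [if_neg (show ¬ queueLength K q₀ X A t < K from hq)]
    by_cases hd : ∀ i, K ≤ receive (queueState K q₀ X A t).2 (X (t + 1)) i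
    · have hd' : BlockDone (queueBlock K q₀ X A t).2 (X (t + 1)) :=
        (blockDone_remaining_iff _ _).2 hd
      rw [doneInd, if_pos hd', nextState, nextRemaining_of_done hd']
      simp only [queueLength, queueBlock, queueState, if_neg hq, if_pos hd, remaining_zero]
      rw [Nat.cast_add, Nat.cast_sub (not_lt.1 hq)]
      ring
    · have hd' : ¬ BlockDone (queueBlock K q₀ X A t).2 (X (t + 1)) := fun h =>
        hd ((blockDone_remaining_iff _ _).1 h)
      have hnext : nextRemaining (queueBlock K q₀ X A t).2 (X (t + 1)) =
          remaining K (receive (queueState K q₀ X A t).2 (X (t + 1))) :=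
        nextRemaining_remaining hd
      rw [doneInd, if_neg hd', nextState, hnext]
      simp only [queueLength, queueBlock, queueState, if_neg hq, if_neg hd]
      push_cast
      ring

lemma lintegral_sq_add (ν : Measure ℕ) [IsProbabilityMeasure ν]
    (hν : MemLp (fun a : ℕ => (a : ℝ)) 2 ν) {b : ℝ} :
    ∫⁻ a : ℕ, ENNReal.ofReal ((b + a) ^ 2) ∂ν =
      ENNReal.ofReal (b ^ 2 + 2 * (∫ a : ℕ, (a : ℝ) ∂ν) * b + ∫ a : ℕ, (a : ℝ) ^ 2 ∂ν) := by
  have h1 : Integrable (fun a : ℕ => (a : ℝ)) ν := hν.integrable one_le_two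
  have h2 : Integrable (fun a : ℕ => (a : ℝ) ^ 2) ν := hν.integrable_sq
  have e : ∀ a : ℕ, (b + a) ^ 2 = b ^ 2 + (2 * b * a + (a : ℝ) ^ 2) := fun a => by ring
  have h3 : Integrable (fun a : ℕ => 2 * b * (a : ℝ) + (a : ℝ) ^ 2) ν := (h1.const_mul _).add h2
  rw [← ofReal_integral_eq_lintegral_ofReal]
  · congr 1
    simp only [e]
    rw [integral_add (integrable_const _) h3, integral_add (h1.const_mul _) h2,
      integral_const_mul, integral_const, probReal_univ, one_smul]
    ring
  · simp only [e]
    exact (integrable_const _).add h3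
  · exact Eventually.of_forall fun a => sq_nonneg _

lemma sum_lintegral_sq_le (ν : Measure ℕ) [IsProbabilityMeasure ν]
    (hν : MemLp (fun a : ℕ => (a : ℝ)) 2 ν) {θ δ C : ℝ} (hθ : 0 ≤ θ) (hδ : 0 ≤ δ) (hC : 0 ≤ C)
    (q : ℕ) (s : (Fin n → Bool) × (Fin n → Fin (K + 1)))
    (h : ∑ y, c.weight s.1 y * (c.lyapNext θ q s y ^ 2 +
      2 * (∫ a : ℕ, (a : ℝ) ∂ν) * c.lyapNext θ q s y + ∫ a : ℕ, (a : ℝ) ^ 2 ∂ν) +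
        δ * c.lyap θ q s ≤ c.lyap θ q s ^ 2 + C) :
    ∑ y, ENNReal.ofReal (c.weight s.1 y) *
        ∫⁻ a : ℕ, ENNReal.ofReal ((c.lyapNext θ q s y + a) ^ 2) ∂ν +
      ENNReal.ofReal δ * ENNReal.ofReal (c.lyap θ q s) ≤
        ENNReal.ofReal (c.lyap θ q s ^ 2) + ENNReal.ofReal C := by
  have hl0 : 0 ≤ ∫ a : ℕ, (a : ℝ) ∂ν := integral_nonneg fun a => Nat.cast_nonneg a
  have hv0 : 0 ≤ ∫ a : ℕ, (a : ℝ) ^ 2 ∂ν := integral_nonneg fun a => sq_nonneg _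
  simp only [lintegral_sq_add ν hν]
  generalize (∫ a : ℕ, (a : ℝ) ∂ν) = l at *
  generalize (∫ a : ℕ, (a : ℝ) ^ 2 ∂ν) = v at *
  have hnn : ∀ y, 0 ≤ c.weight s.1 y *
      (c.lyapNext θ q s y ^ 2 + 2 * l * c.lyapNext θ q s y + v) := fun y => by
    have := lyapNext_nonneg (c := c) hθ q s y
    have := weight_nonneg (c := c) s.1 y
    positivity
  simp only [← ENNReal.ofReal_mul (weight_nonneg _ _)]
  rw [← ENNReal.ofReal_sum_of_nonneg fun y _ => hnn y, ← ENNReal.ofReal_mul hδ,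
    ← ENNReal.ofReal_add (Finset.sum_nonneg fun y _ => hnn y)
      (mul_nonneg hδ (lyap_nonneg hθ _ _)), ← ENNReal.ofReal_add (sq_nonneg _) hC]
  exact ENNReal.ofReal_le_ofReal h

lemma queueLength_congr (q₀ : ℕ) {t : ℕ} {X X' : ℕ → Fin n → Bool} {A A' : ℕ → ℕ}
    (hX : ∀ i ∈ Set.Iic t, X i = X' i) (hA : ∀ i ∈ Set.Iic t, A i = A' i) :
    queueLength K q₀ X A t = queueLength K q₀ X' A' t := by
  rw [queueLength, queueState_congr q₀ hX hA, queueLength]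

lemma queueBlock_congr (q₀ : ℕ) {t : ℕ} {X X' : ℕ → Fin n → Bool} {A A' : ℕ → ℕ}
    (hX : ∀ i ∈ Set.Iic t, X i = X' i) (hA : ∀ i ∈ Set.Iic t, A i = A' i) :
    queueBlock K q₀ X A t = queueBlock K q₀ X' A' t := by
  rw [queueBlock, queueState_congr q₀ hX hA, hX t Set.self_mem_Iic, queueBlock]

variable (c) in
/-- The value of `lyap` after `t` slots of the queueing system. -/
def lyapQueue (θ : ℝ) (K q₀ t : ℕ) (X : ℕ → Fin n → Bool) (A : ℕ → ℕ) : ℝ :=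
  c.lyap θ (queueLength K q₀ X A t) (queueBlock K q₀ X A t)

lemma measurable_lyapQueue (θ : ℝ) (K q₀ t : ℕ) :
    Measurable fun p : (ℕ → Fin n → Bool) × (ℕ → ℕ) => c.lyapQueue θ K q₀ t p.1 p.2 :=
  measurable_of_forall_eq (t := t) (f := c.lyapQueue θ K q₀ t) fun X X' A A' hX hA => by
    rw [lyapQueue, queueLength_congr q₀ hX hA, queueBlock_congr q₀ hX hA, lyapQueue]

lemma lintegral_lyapQueue_succ (μ₀ : Measure (Fin n → Bool)) [IsProbabilityMeasure μ₀]
    (ν : Measure ℕ) [IsProbabilityMeasure ν] (θ : ℝ) (q₀ t : ℕ) :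
    ∫⁻ p, ENNReal.ofReal (c.lyapQueue θ K q₀ (t + 1) p.1 p.2 ^ 2)
        ∂((c.channelLaw n μ₀).prod (Measure.infinitePi fun _ : ℕ => ν)) =
      ∫⁻ p, ∑ y, ENNReal.ofReal (c.weight (queueBlock K q₀ p.1 p.2 t).1 y) *
        ∫⁻ a : ℕ, ENNReal.ofReal ((c.lyapNext θ (queueLength K q₀ p.1 p.2 t)
            (queueBlock K q₀ p.1 p.2 t) y + a) ^ 2) ∂ν
        ∂((c.channelLaw n μ₀).prod (Measure.infinitePi fun _ : ℕ => ν)) := by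
  have hq : ∀ (X : ℕ → Fin n → Bool) A, (queueBlock K q₀ X A t).1 = X t := fun X A => rfl
  simp only [hq]
  rw [← lintegral_prod_next (c := c) μ₀ ν (t := t) (F := fun X A y a =>
    ENNReal.ofReal ((c.lyapNext θ (queueLength K q₀ X A t) (queueBlock K q₀ X A t) y + a) ^ 2))]
  · refine lintegral_congr fun p => ?_
    rw [lyapQueue, lyap_queue_succ]
  · intro X X' A A' hX hA
    rw [queueLength_congr q₀ hX hA, queueBlock_congr q₀ hX hA]

/-- One step of the expected squared Lyapunov function. -/
lemma lintegral_lyapQueue_drift (μ₀ : Measure (Fin n → Bool)) [IsProbabilityMeasure μ₀]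
    (ν : Measure ℕ) [IsProbabilityMeasure ν] (hν : MemLp (fun a : ℕ => (a : ℝ)) 2 ν) {θ δ C : ℝ}
    (hθ : 0 ≤ θ) (hδ : 0 ≤ δ) (hC : 0 ≤ C)
    (h : ∀ q (s : (Fin n → Bool) × (Fin n → Fin (K + 1))),
      ∑ y, c.weight s.1 y * (c.lyapNext θ q s y ^ 2 +
        2 * (∫ a : ℕ, (a : ℝ) ∂ν) * c.lyapNext θ q s y + ∫ a : ℕ, (a : ℝ) ^ 2 ∂ν) +
          δ * c.lyap θ q s ≤ c.lyap θ q s ^ 2 + C) (q₀ t : ℕ) :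
    ∫⁻ p, ENNReal.ofReal (c.lyapQueue θ K q₀ (t + 1) p.1 p.2 ^ 2)
        ∂((c.channelLaw n μ₀).prod (Measure.infinitePi fun _ : ℕ => ν)) +
      ENNReal.ofReal δ * ∫⁻ p, ENNReal.ofReal (c.lyapQueue θ K q₀ t p.1 p.2)
        ∂((c.channelLaw n μ₀).prod (Measure.infinitePi fun _ : ℕ => ν)) ≤
      ∫⁻ p, ENNReal.ofReal (c.lyapQueue θ K q₀ t p.1 p.2 ^ 2)
        ∂((c.channelLaw n μ₀).prod (Measure.infinitePi fun _ : ℕ => ν)) + ENNReal.ofReal C := by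
  have hmeas := measurable_lyapQueue (c := c) (n := n) θ K q₀ t
  rw [lintegral_lyapQueue_succ, ← lintegral_const_mul _ hmeas.ennreal_ofReal,
    ← lintegral_add_right _ (hmeas.ennreal_ofReal.const_mul _)]
  have hconst : ENNReal.ofReal C = ∫⁻ _p : (ℕ → Fin n → Bool) × (ℕ → ℕ), ENNReal.ofReal C
      ∂((c.channelLaw n μ₀).prod (Measure.infinitePi fun _ : ℕ => ν)) := by
    rw [lintegral_const, measure_univ, mul_one]
  rw [hconst, ← lintegral_add_right _ measurable_const]
  exact lintegral_mono fun p => sum_lintegral_sq_le ν hν hθ hδ hC _ _ (h _ _)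

/-- The queue is stable if blocks are completed faster, on average, than packets arrive. -/
theorem isStable_of_lt (hn : 1 ≤ n) (hK : 1 ≤ K) {m : ℝ} (hm0 : 0 < m)
    (hm : ∀ x : Fin n → Bool, c.blockTime x (fun _ => K) ≤ m) (ν : Measure ℕ)
    [IsProbabilityMeasure ν] (hν : MemLp (fun a : ℕ => (a : ℝ)) 2 ν)
    (hl : (∫ a : ℕ, (a : ℝ) ∂ν) < K / m) : c.IsStable n K ν := by
  intro μ₀ _ q₀
  set l := ∫ a : ℕ, (a : ℝ) ∂ν with hldef
  set v := ∫ a : ℕ, (a : ℝ) ^ 2 ∂ν with hvdef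
  have hl0 : 0 ≤ l := integral_nonneg fun a => Nat.cast_nonneg a
  have hv0 : 0 ≤ v := integral_nonneg fun a => sq_nonneg _
  obtain ⟨C, hC0, hC⟩ := exists_drift_bound (c := c) hn hK hm0 hm hl0 hl hv0
  set θ : ℝ := K / m with hθ
  have hθ0 : 0 ≤ θ := hl0.trans hl.le
  set δ := 2 * (θ - l) with hδ
  have hδ0 : 0 < δ := by
    rw [hδ]
    linarith
  have hstep := lintegral_lyapQueue_drift (c := c) μ₀ ν hν hθ0 hδ0.le hC0 hC q₀
  set P := (c.channelLaw n μ₀).prod (Measure.infinitePi fun _ : ℕ => ν) with hP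
  obtain ⟨u, hu0, hu⟩ : ∃ u, 0 ≤ u ∧ ∫⁻ p, ENNReal.ofReal (c.lyapQueue θ K q₀ 0 p.1 p.2 ^ 2) ∂P ≤
      ENNReal.ofReal u := by
    obtain ⟨B, hB⟩ := (Set.finite_range fun s : (Fin n → Bool) × (Fin n → Fin (K + 1)) =>
      c.lyap θ q₀ s ^ 2).bddAbove
    have hB' : ∀ s : (Fin n → Bool) × (Fin n → Fin (K + 1)), c.lyap θ q₀ s ^ 2 ≤ B :=
      fun s => hB ⟨s, rfl⟩
    refine ⟨B, (sq_nonneg _).trans (hB' (fun _ => true, fun _ => Fin.last K)), ?_⟩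
    calc _ ≤ ∫⁻ _p, ENNReal.ofReal B ∂P :=
          lintegral_mono fun p => ENNReal.ofReal_le_ofReal (hB' _)
      _ = _ := by simp
  -- The one-step drift inequality, summed over the first N slots.
  have hsum : ∀ N : ℕ, ∫⁻ p, ENNReal.ofReal (c.lyapQueue θ K q₀ N p.1 p.2 ^ 2) ∂P +
      ENNReal.ofReal δ * ∑ t ∈ Finset.range N, ∫⁻ p, ENNReal.ofReal (c.lyapQueue θ K q₀ t p.1 p.2) ∂P ≤
      ENNReal.ofReal u + N * ENNReal.ofReal C := by
    intro N
    induction N with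
    | zero => simpa using hu
    | succ N ih =>
      rw [Finset.sum_range_succ, mul_add]
      calc _ = (∫⁻ p, ENNReal.ofReal (c.lyapQueue θ K q₀ (N + 1) p.1 p.2 ^ 2) ∂P +
            ENNReal.ofReal δ * ∫⁻ p, ENNReal.ofReal (c.lyapQueue θ K q₀ N p.1 p.2) ∂P) +
            ENNReal.ofReal δ * ∑ t ∈ Finset.range N, ∫⁻ p, ENNReal.ofReal (c.lyapQueue θ K q₀ t p.1 p.2) ∂P := by
            ring
        _ ≤ (∫⁻ p, ENNReal.ofReal (c.lyapQueue θ K q₀ N p.1 p.2 ^ 2) ∂P + ENNReal.ofReal C) +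
            ENNReal.ofReal δ * ∑ t ∈ Finset.range N, ∫⁻ p, ENNReal.ofReal (c.lyapQueue θ K q₀ t p.1 p.2) ∂P :=
            add_le_add_left (hstep N) _
        _ = (∫⁻ p, ENNReal.ofReal (c.lyapQueue θ K q₀ N p.1 p.2 ^ 2) ∂P +
            ENNReal.ofReal δ * ∑ t ∈ Finset.range N, ∫⁻ p, ENNReal.ofReal (c.lyapQueue θ K q₀ t p.1 p.2) ∂P) +
            ENNReal.ofReal C := by ring
        _ ≤ (ENNReal.ofReal u + N * ENNReal.ofReal C) + ENNReal.ofReal C := add_le_add_left ih _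
        _ = _ := by push_cast; ring
  -- The initial term u is at most uN for N ≥ 1, which gives this bound for every average.
  refine lt_of_le_of_lt (b := ENNReal.ofReal ((u + C) / δ)) ?_ ENNReal.ofReal_lt_top
  refine limsup_le_of_le (by isBoundedDefault) ?_
  filter_upwards [eventually_gt_atTop 0] with N hN
  have hN0 : (0 : ℝ) < N := by exact_mod_cast hN
  have hN1 : (1 : ℝ) ≤ N := by exact_mod_cast hN
  refine ENNReal.div_le_of_le_mul ?_
  have hle : ∑ t ∈ Finset.range N, ∫⁻ p, (queueLength K q₀ p.1 p.2 t : ℝ≥0∞) ∂P ≤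
      ∑ t ∈ Finset.range N, ∫⁻ p, ENNReal.ofReal (c.lyapQueue θ K q₀ t p.1 p.2) ∂P := by
    refine Finset.sum_le_sum fun t _ => lintegral_mono fun p => ?_
    rw [← ENNReal.ofReal_natCast]
    exact ENNReal.ofReal_le_ofReal
      (le_add_of_nonneg_right (mul_nonneg hθ0 (remTime_nonneg _)))
  refine hle.trans ?_
  have h2 : ENNReal.ofReal δ * ∑ t ∈ Finset.range N, ∫⁻ p, ENNReal.ofReal (c.lyapQueue θ K q₀ t p.1 p.2) ∂P ≤
      ENNReal.ofReal (u + N * C) := by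
    rw [ENNReal.ofReal_add hu0 (by positivity), ENNReal.ofReal_mul hN0.le, ENNReal.ofReal_natCast]
    exact le_add_self.trans (hsum N)
  rw [← ENNReal.ofReal_natCast N, ← ENNReal.ofReal_mul (by positivity)]
  have h3 : ∑ t ∈ Finset.range N, ∫⁻ p, ENNReal.ofReal (c.lyapQueue θ K q₀ t p.1 p.2) ∂P ≤
      ENNReal.ofReal (u + N * C) / ENNReal.ofReal δ := by
    rw [ENNReal.le_div_iff_mul_le (Or.inl (ENNReal.ofReal_pos.2 hδ0).ne')
      (Or.inl ENNReal.ofReal_ne_top), mul_comm]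
    exact h2
  refine h3.trans ?_
  rw [← ENNReal.ofReal_div_of_pos hδ0]
  refine ENNReal.ofReal_le_ofReal ?_
  rw [div_mul_eq_mul_div]
  refine div_le_div_of_nonneg_right ?_ hδ0.le
  nlinarith

end GilbertElliott

/-! ### The common lower bound and its limit -/

namespace GilbertElliott

variable {c : GilbertElliott} {n K : ℕ}

/-- Taking m for the worst initial channel state turns the strict time bound into a strict gap below
K/m, which serves both the throughput and stability. -/
lemma exists_blockTime_le (hn : 2 ≤ n) (hK : 1 ≤ K) :
    ∃ m, 0 < m ∧ (∀ x : Fin n → Bool, c.blockTime x (fun _ => K) ≤ m) ∧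
      (K : ℝ) / ((K : ℝ) + (c.K₀ : ℝ)) * c.R (((K : ℝ) + (c.K₀ : ℝ)) / Real.log (n : ℝ)) <
        K / m := by
  obtain ⟨x, hx⟩ := Finite.exists_max fun x : Fin n → Bool => c.blockTime x fun _ => K
  have h1 : 1 ≤ c.blockTime x fun _ => K := one_le_blockTime ⟨⟨0, by omega⟩, by omega⟩
  have hm0 : 0 < c.blockTime x fun _ => K := one_pos.trans_le h1
  refine ⟨_, hm0, hx, ?_⟩
  have hlt := blockTime_mul_R_lt (c := c) hn hK x
  have hK0 : (0 : ℝ) < K := by exact_mod_cast hK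
  rw [div_mul_eq_mul_div, div_lt_div_iff₀ (by positivity) hm0, mul_assoc]
  refine mul_lt_mul_of_pos_left ?_ hK0
  rw [mul_comm]
  exact hlt

variable (c) in
lemma tendsto_lowerBound {r : ℝ} {K : ℕ → ℕ} (hr : 0 < r)
    (hK : Tendsto (fun n : ℕ => (K n : ℝ) / Real.log (n : ℝ)) atTop (𝓝 r)) :
    Tendsto (fun n : ℕ => (K n : ℝ) / ((K n : ℝ) + (c.K₀ : ℝ)) *
      c.R (((K n : ℝ) + (c.K₀ : ℝ)) / Real.log (n : ℝ))) atTop (𝓝 (c.R r)) := by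
  have hlog : Tendsto (fun n : ℕ => Real.log n) atTop atTop :=
    Real.tendsto_log_atTop.comp tendsto_natCast_atTop_atTop
  have hc : Tendsto (fun n : ℕ => (c.K₀ : ℝ) / Real.log (n : ℝ)) atTop (𝓝 0) :=
    tendsto_const_nhds.div_atTop hlog
  have h1 : Tendsto (fun n : ℕ => ((K n : ℝ) + (c.K₀ : ℝ)) / Real.log (n : ℝ)) atTop (𝓝 r) := by
    simpa only [add_div, add_zero] using hK.add hc
  have h2 : Tendsto (fun n : ℕ => (K n : ℝ) / ((K n : ℝ) + (c.K₀ : ℝ))) atTop (𝓝 1) := by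
    have := hK.div h1 hr.ne'
    rw [div_self hr.ne'] at this
    refine this.congr' ?_
    filter_upwards [hlog.eventually_gt_atTop 0] with n hn
    simp only [Pi.div_apply]
    rw [div_div_div_cancel_right₀ hn.ne']
  simpa only [one_mul] using h2.mul (tendsto_R hr h1)

end GilbertElliott

theorem theorem3 (c : GilbertElliott) :
    ∃ η : ℕ → ℕ → ℝ,
      (∀ n K : ℕ, 1 ≤ n → 1 ≤ K → c.IsThroughput n K (η n K)) ∧
      (∀ n K : ℕ, 2 ≤ n → 1 ≤ K →
        η n K > (K : ℝ) / ((K : ℝ) + (c.K₀ : ℝ)) *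
          c.R (((K : ℝ) + (c.K₀ : ℝ)) / Real.log (n : ℝ))) ∧
      (∀ n K : ℕ, 2 ≤ n → 1 ≤ K →
        ∀ (ν : Measure ℕ) [IsProbabilityMeasure ν], MemLp (fun a : ℕ => (a : ℝ)) 2 ν →
          (∫ a : ℕ, (a : ℝ) ∂ν) ≤ (K : ℝ) / ((K : ℝ) + (c.K₀ : ℝ)) *
            c.R (((K : ℝ) + (c.K₀ : ℝ)) / Real.log (n : ℝ)) →
          c.IsStable n K ν) ∧
      (∀ (r : ℝ) (K : ℕ → ℕ), 0 < r →
        Tendsto (fun n : ℕ => (K n : ℝ) / Real.log (n : ℝ)) atTop (𝓝 r) →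
          Tendsto (fun n : ℕ => (K n : ℝ) / ((K n : ℝ) + (c.K₀ : ℝ)) *
            c.R (((K n : ℝ) + (c.K₀ : ℝ)) / Real.log (n : ℝ))) atTop (𝓝 (c.R r)) ∧
          Tendsto (fun n : ℕ => η n (K n)) atTop (𝓝 (c.R r))) := by
  classical
  choose η hη using fun (n K : ℕ) (h : 1 ≤ n ∧ 1 ≤ K) =>
    GilbertElliott.exists_isThroughput c h.1 h.2
  have hlow : ∀ n K : ℕ, ∀ (hn : 2 ≤ n) (hK : 1 ≤ K),
      (K : ℝ) / ((K : ℝ) + (c.K₀ : ℝ)) * c.R (((K : ℝ) + (c.K₀ : ℝ)) / Real.log (n : ℝ)) <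
        η n K ⟨by omega, hK⟩ := by
    intro n K hn hK
    obtain ⟨m, hm0, hm, hlt⟩ := GilbertElliott.exists_blockTime_le (c := c) hn hK
    refine hlt.trans_le ?_
    rw [div_le_iff₀ hm0, mul_comm]
    exact (hη n K ⟨by omega, hK⟩).2.1 m hm
  refine ⟨fun n K => if h : 1 ≤ n ∧ 1 ≤ K then η n K h else 0, ?_, ?_, ?_, ?_⟩
  · intro n K hn hK
    simp only [dif_pos (show 1 ≤ n ∧ 1 ≤ K from ⟨hn, hK⟩)]
    exact (hη n K ⟨hn, hK⟩).1
  · intro n K hn hK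
    simp only [dif_pos (show 1 ≤ n ∧ 1 ≤ K from ⟨by omega, hK⟩)]
    exact hlow n K hn hK
  · intro n K hn hK ν _ hν hle
    obtain ⟨m, hm0, hm, hlt⟩ := GilbertElliott.exists_blockTime_le (c := c) hn hK
    -- Arrival rates equal to the bound are allowed because the bound is strictly below K/m.
    exact GilbertElliott.isStable_of_lt (by omega) hK hm0 hm ν hν (hle.trans_lt hlt)
  · intro r K hr hK
    have hlim := GilbertElliott.tendsto_lowerBound c hr hK
    have hK1 : ∀ᶠ n : ℕ in atTop, 1 ≤ K n := by
      filter_upwards [hK.eventually (lt_mem_nhds hr)] with n hn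
      rw [Nat.one_le_iff_ne_zero]
      intro h0
      simp [h0] at hn
    refine ⟨hlim, tendsto_order.2 ⟨fun b hb => ?_, fun b hb => ?_⟩⟩
    · filter_upwards [hlim.eventually (lt_mem_nhds hb), hK1, eventually_ge_atTop 2]
        with n h1 h2 h3
      simp only [dif_pos (show 1 ≤ n ∧ 1 ≤ K n from ⟨by omega, h2⟩)]
      exact h1.trans (hlow n (K n) h3 h2)
    · obtain ⟨β, hβ, hβb⟩ := exists_between hb
      have hβ0 : 0 < β := (GilbertElliott.R_pos hr).trans hβ
      filter_upwards [GilbertElliott.eventually_le_blockTime hr hβ hK, hK1, eventually_ge_atTop 2]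
        with n h1 h2 h3
      have h : 1 ≤ n ∧ 1 ≤ K n := ⟨by omega, h2⟩
      simp only [dif_pos h]
      refine lt_of_le_of_lt ?_ hβb
      have h4 := (hη n (K n) h).2.2 _ h1
      have h5 : (0 : ℝ) < K n := by exact_mod_cast h2
      rw [div_mul_eq_mul_div, div_le_iff₀ hβ0] at h4
      exact le_of_mul_le_mul_left h4 h5

end
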